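/- **Setting.** Let $\mathcal H$ be a complex Hilbert space (for instance $L^2(\Omega;\mathbb C)$) with inner product $\langle\cdot,\cdot\rangle$, conjugate-linear in the first variable, and write $\langle f|F|g\rangle=\langle f,Fg\rangle$. Let $H$ be a (possibly unbounded) self-adjoint operator on $\mathcal H$, $\mu$ a bounded self-adjoint operator, $O$ a bounded self-adjoint positive semi-definite operator, $\psi_0\in\mathcal H$, $T>0$ and $\alpha>0$. For a control $\varepsilon\in L^2([0,T];\mathbb R)$, a solution of $i\partial_t\varphi=(H-\varepsilon(t)\mu)\varphi$ on $[0,T]$ is a continuous $\varphi:[0,T]\to\mathcal H$ such that for all $v$ in the domain of $H$ and $t\in[0,T]$ $$\langle v,\varphi(t)\rangle=\langle v,\varphi(0)\rangle-i\int_0^t\big(\langle Hv,\varphi(s)\rangle-\varepsilon(s)\langle\mu v,\varphi(s)\rangle\big)ds .$$ Let $$J(\varepsilon)=\langle\psi(T)|O|\psi(T)\rangle-\alpha\int_0^T\varepsilon(t)^2\,dt,$$ where $\psi$ is the solution driven by $\varepsilon$ with $\psi(0)=\psi_0$. **Monotonic scheme.** Let $\delta,\eta\in[0,2]$ satisfy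 $|(1-\delta)(1-\eta)|<1$. Starting from an initial control $\varepsilon^0\in L^2([0,T];\mathbb R)$, let the controls $\varepsilon^k,\widetilde\varepsilon^k\in L^2([0,T];\mathbb R)$, states $\psi^k$ and adjoint states $\chi^k$ satisfy, for all $k\ge 0$ (the equations for the controls holding for almost every $t\in[0,T]$), $$i\partial_t\psi^k=(H-\varepsilon^k\mu)\psi^k,\quad \psi^k(0)=\psi_0,$$ $$i\partial_t\chi^k=(H-\widetilde\varepsilon^k\mu)\chi^k,\quad \chi^k(T)=O\psi^k(T),$$ $$\widetilde\varepsilon^k(t)=(1-\eta)\varepsilon^k(t)-\tfrac{\eta}{\alpha}\,\mathrm{Im}\langle\chi^k(t)|\mu|\psi^k(t)\rangle,$$ $$\varepsilon^{k+1}(t)=(1-\delta)\widetilde\varepsilon^k(t)-\tfrac{\delta}{\alpha}\,\mathrm{Im}\langle\chi^k(t)|\mu|\psi^{k+1}(t)\rangle .$$ **Theorem.** Let $A$ be the set of limit points of $(\varepsilon^k)_k$, that is, the set of limits in $L^2([0,T];\mathbb R)$ of its convergent subsequences. Then $A$ is (nonempty and) connected in $L^2([0,T];\mathbb R)$; $A$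 is compact; every $\varepsilon\in A$ is a critical point of $J$, i.e. $J$ is Fréchet differentiable at $\varepsilon$ with zero derivative, and $\varepsilon$ satisfies the Euler–Lagrange equations $$i\partial_t\psi=(H-\varepsilon\mu)\psi,\ \ \psi(0)=\psi_0;\qquad i\partial_t\chi=(H-\varepsilon\mu)\chi,\ \ \chi(T)=O\psi(T);\qquad \alpha\,\varepsilon(t)=-\mathrm{Im}\langle\chi(t)|\mu|\psi(t)\rangle\ \text{ for a.e. } t\in[0,T]$$ for some $\psi,\chi$; and $J$ is constant on $A$. -/

import Mathlib

open MeasureTheory Set Filter Topology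
open scoped InnerProductSpace

noncomputable section

namespace QuantumControl

/-- The space `L²([0,T]; ℝ)` of controls. -/
abbrev Control (T : ℝ) : Type := Lp ℝ 2 (volume.restrict (Icc (0 : ℝ) T))

variable {E : Type*} [NormedAddCommGroup E] [InnerProductSpace ℂ E]

/-- `φ : [0,T] → E` is a solution of `i ∂φ/∂t = (H - ε(t) μ) φ` on `[0,T]`: it is continuous and it
satisfies the equation, integrated in time, against every vector of the domain of the (possibly
unbounded) self-adjoint operator `H` (for self-adjoint `H` and bounded self-adjoint `μ`).
The values of `φ` outside `[0,T]` play no role. -/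
def IsSchrodingerSolution {T : ℝ} (H : E →ₗ.[ℂ] E) (μ : E →L[ℂ] E) (ε : Control T)
    (φ : ℝ → E) : Prop :=
  ContinuousOn φ (Icc 0 T) ∧
  ∀ t ∈ Icc (0 : ℝ) T, ∀ v : H.domain,
    ⟪(v : E), φ t⟫_ℂ = ⟪(v : E), φ 0⟫_ℂ
      - Complex.I * ∫ s in (0 : ℝ)..t, (⟪H v, φ s⟫_ℂ - (ε s : ℂ) * ⟪μ (v : E), φ s⟫_ℂ)

/-- `ψ` is the state driven by the control `ε` from the initial state `ψ₀`. -/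
def IsState {T : ℝ} (H : E →ₗ.[ℂ] E) (μ : E →L[ℂ] E) (ψ₀ : E) (ε : Control T)
    (ψ : ℝ → E) : Prop :=
  IsSchrodingerSolution H μ ε ψ ∧ ψ 0 = ψ₀

/-- `χ` is the adjoint state driven by the control `ε`, with final value `O ψ(T)`. -/
def IsAdjointState {T : ℝ} (H : E →ₗ.[ℂ] E) (μ O : E →L[ℂ] E) (ε : Control T)
    (ψ χ : ℝ → E) : Prop :=
  IsSchrodingerSolution H μ ε χ ∧ χ T = O (ψ T)

/-- The state `ψ` driven by `ε`; on `[0,T]` it is the unique solution of the initial value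
problem. -/
def state {T : ℝ} (H : E →ₗ.[ℂ] E) (μ : E →L[ℂ] E) (ψ₀ : E) (ε : Control T) : ℝ → E :=
  Classical.epsilon (IsState H μ ψ₀ ε)

/-- The cost functional `J(ε) = ⟨ψ(T)|O|ψ(T)⟩ - α ∫₀ᵀ ε(t)² dt`; the first term is real since `O`
is self-adjoint. -/
def cost {T : ℝ} (H : E →ₗ.[ℂ] E) (μ O : E →L[ℂ] E) (ψ₀ : E) (α : ℝ) (ε : Control T) : ℝ :=
  (⟪state H μ ψ₀ ε T, O (state H μ ψ₀ ε T)⟫_ℂ).re - α * ∫ t in (0 : ℝ)..T, (ε t) ^ 2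

/-- The Euler-Lagrange (critical point) equations of the cost functional. -/
def SolvesEulerLagrange {T : ℝ} (H : E →ₗ.[ℂ] E) (μ O : E →L[ℂ] E) (ψ₀ : E) (α : ℝ)
    (ε : Control T) : Prop :=
  ∃ ψ χ : ℝ → E, IsState H μ ψ₀ ε ψ ∧ IsAdjointState H μ O ε ψ χ ∧
    ∀ᵐ t ∂(volume.restrict (Icc (0 : ℝ) T)), α * ε t = -(⟪χ t, μ (ψ t)⟫_ℂ).im

/-- The sequences `ε k`, `ε' k` of controls (the second one being the one with a tilde), `ψ k` of
states and `χ k` of adjoint states are produced by the monotonic scheme with parameters `δ`, `η`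
from the initial guess `ε 0`. -/
structure IsMonotonicScheme {T : ℝ} (H : E →ₗ.[ℂ] E) (μ O : E →L[ℂ] E) (ψ₀ : E) (α δ η : ℝ)
    (ε ε' : ℕ → Control T) (ψ χ : ℕ → ℝ → E) : Prop where
  state_eq : ∀ k, IsState H μ ψ₀ (ε k) (ψ k)
  control_eq : ∀ k, ∀ᵐ t ∂(volume.restrict (Icc (0 : ℝ) T)),
    ε (k + 1) t = (1 - δ) * ε' k t - δ / α * (⟪χ k t, μ (ψ (k + 1) t)⟫_ℂ).im
  adjoint_eq : ∀ k, IsAdjointState H μ O (ε' k) (ψ k) (χ k)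
  control'_eq : ∀ k, ∀ᵐ t ∂(volume.restrict (Icc (0 : ℝ) T)),
    ε' k t = (1 - η) * ε k t - η / α * (⟪χ k t, μ (ψ k t)⟫_ℂ).im

/-- The set of limit points of a sequence of controls: the limits in `L²([0,T]; ℝ)` of its
convergent subsequences. -/
def limitSet {T : ℝ} (ε : ℕ → Control T) : Set (Control T) :=
  {e | ∃ n : ℕ → ℕ, StrictMono n ∧ Tendsto (fun j => ε (n j)) atTop (𝓝 e)}

end QuantumControl

end

open MeasureTheory Set Filter Topology
open scoped InnerProductSpace

noncomputable section

namespace QuantumControl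

variable {E : Type*} [NormedAddCommGroup E] [InnerProductSpace ℂ E]

/-! Let `p` and `q` be the feedback controls `-α⁻¹ Im ⟨χ|μ|ψ⟩` built from `(χ k, ψ k)` and `(χ k, ψ
(k+1))`. The two updates of the scheme are relaxations towards `p` and `q`, and Green's formula for
solutions driven by different controls yields the exact identity `J(ε (k+1)) - J(ε k) = ⟨Δ, OΔ⟩ + α
(η(2-η) ‖ε k - p‖² + δ(2-δ) ‖ε' k - q‖²)`, with `Δ = ψ (k+1) T - ψ k T` (`cost_increment`). All
terms are nonnegative. Since the norm of a state is conserved, `J` is bounded above; hence `J(ε k)`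
converges and the controls are bounded.

Compactness comes from the control-to-state map being weak-to-strong: along an ultrafilter the
controls converge weakly, the solutions converge weakly by equicontinuity, and conservation of the
norm makes this convergence strong and uniform in time (`exists_uniform_limit`). The feedback terms
therefore converge strongly, and eliminating `ε'` leaves an affine recursion of ratio `(1-δ)(1-η)`
with precompact forcing, so the controls stay in a compact set.

In the limit of one iteration every term of the increment vanishes. The condition on `δ, η` prevents
both weights from being zero; whichever is nonzero forces a feedback equation, and Grönwall
uniqueness, forward for states or backward for adjoint states, shows that consecutive limits
coincide and solve the Euler–Lagrange equations (`IsLimitIteration.eq_of_eta`,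
`IsLimitIteration.eq_of_delta`). Thus the steps tend to zero, and a sequence in a compact set with
vanishing steps has a connected limit set. At a solution of these equations the variation of `J` is
quadratic, so `J` is differentiable there with zero derivative; being continuous there, it equals
the limit of `J(ε k)`.

As `H` is unbounded, Green's formula is first proved after applying the resolvent `(1 + i r H)⁻¹`,
then `r → 0`. -/

/-! ### Integration by parts for Bochner primitives -/

theorem integrable_inner_prod {X : Type*} [MeasurableSpace X] {ν : Measure X} [SFinite ν]
    {f g : X → E} (hf : Integrable f ν) (hg : Integrable g ν) :
    Integrable (fun p : X × X => ⟪f p.1, g p.2⟫_ℂ) (ν.prod ν) := by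
  refine Integrable.mono' (hf.norm.mul_prod hg.norm) ?_ (ae_of_all _ fun p => ?_)
  · exact hf.1.comp_fst.inner hg.1.comp_snd
  · exact norm_inner_le_norm _ _

theorem integral_inner_const [CompleteSpace E] {X : Type*} [MeasurableSpace X] {ν : Measure X}
    {f : X → E} (hf : Integrable f ν) (y : E) : ∫ s, ⟪f s, y⟫_ℂ ∂ν = ⟪∫ s, f s ∂ν, y⟫_ℂ := by
  rw [← inner_conj_symm, ← integral_inner hf, ← integral_conj]
  simp only [inner_conj_symm]

/-- Integration by parts for the inner product of two primitives of Bochner integrable functions. -/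
theorem inner_add_integral_add_integral [CompleteSpace E] {t : ℝ} (ht : 0 ≤ t) {f g : ℝ → E}
    (hf : IntegrableOn f (Ioc 0 t)) (hg : IntegrableOn g (Ioc 0 t)) (x y : E) :
    ⟪x + ∫ s in (0 : ℝ)..t, f s, y + ∫ s in (0 : ℝ)..t, g s⟫_ℂ =
      ⟪x, y⟫_ℂ + ∫ s in (0 : ℝ)..t,
        (⟪f s, y + ∫ r in (0 : ℝ)..s, g r⟫_ℂ + ⟪x + ∫ r in (0 : ℝ)..s, f r, g s⟫_ℂ) := by
  set ν : Measure ℝ := volume.restrict (Ioc 0 t) with hν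
  have hK := integrable_inner_prod (ν := ν) hf hg
  have hprim : ∀ h : ℝ → E, ∀ s ∈ Ioc 0 t,
      ∫ r in (0 : ℝ)..s, h r = ∫ r, (Iic s).indicator h r ∂ν := by
    intro h s hs
    rw [intervalIntegral.integral_of_le hs.1.le, integral_indicator measurableSet_Iic, hν,
      Measure.restrict_restrict measurableSet_Iic]
    congr 2
    ext r; simp only [mem_Ioc, mem_inter_iff, mem_Iic]
    exact ⟨fun h => ⟨h.2, h.1, h.2.trans hs.2⟩, fun h => ⟨h.2.1, h.1⟩⟩
  have hS1 : MeasurableSet {p : ℝ × ℝ | p.2 ≤ p.1} := measurableSet_le measurable_snd measurable_fst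
  have hS2 : MeasurableSet {p : ℝ × ℝ | p.1 ≤ p.2} := measurableSet_le measurable_fst measurable_snd
  have hK1 := hK.indicator hS1
  have hK2 := hK.indicator hS2
  have e1 : ∀ s ∈ Ioc 0 t, ⟪f s, ∫ r in (0 : ℝ)..s, g r⟫_ℂ =
      ∫ r, ({p : ℝ × ℝ | p.2 ≤ p.1}.indicator (fun p => ⟪f p.1, g p.2⟫_ℂ)) (s, r) ∂ν := by
    intro s hs
    rw [hprim g s hs, ← integral_inner (hg.indicator measurableSet_Iic)]
    refine integral_congr_ae (ae_of_all _ fun r => ?_)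
    by_cases h : r ≤ s <;> simp [h, indicator]
  have e2 : ∀ r ∈ Ioc 0 t, ⟪∫ s in (0 : ℝ)..r, f s, g r⟫_ℂ =
      ∫ s, ({p : ℝ × ℝ | p.1 ≤ p.2}.indicator (fun p => ⟪f p.1, g p.2⟫_ℂ)) (s, r) ∂ν := by
    intro s hs
    rw [hprim f s hs, ← integral_inner_const (hf.indicator measurableSet_Iic)]
    refine integral_congr_ae (ae_of_all _ fun r => ?_)
    by_cases h : r ≤ s <;> simp [h, indicator]
  -- The square `(0,t]²` is cut along the diagonal, a null set, and Fubini is applied on each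
  -- triangle; this only needs `f` and `g` to be integrable.
  have hsum : ⟪∫ s, f s ∂ν, ∫ s, g s ∂ν⟫_ℂ =
      (∫ s, ⟪f s, ∫ r in (0 : ℝ)..s, g r⟫_ℂ ∂ν) + ∫ s, ⟪∫ r in (0 : ℝ)..s, f r, g s⟫_ℂ ∂ν := by
    have a1 : ∫ s, ⟪f s, ∫ r in (0 : ℝ)..s, g r⟫_ℂ ∂ν = ∫ p,
        {p : ℝ × ℝ | p.2 ≤ p.1}.indicator (fun p => ⟪f p.1, g p.2⟫_ℂ) p ∂(ν.prod ν) := by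
      rw [integral_prod _ hK1]
      exact setIntegral_congr_fun measurableSet_Ioc e1
    have a2 : ∫ s, ⟪∫ r in (0 : ℝ)..s, f r, g s⟫_ℂ ∂ν = ∫ p,
        {p : ℝ × ℝ | p.1 ≤ p.2}.indicator (fun p => ⟪f p.1, g p.2⟫_ℂ) p ∂(ν.prod ν) := by
      rw [integral_prod_symm _ hK2]
      exact setIntegral_congr_fun measurableSet_Ioc e2
    have a3 : ⟪∫ s, f s ∂ν, ∫ s, g s ∂ν⟫_ℂ = ∫ p, ⟪f p.1, g p.2⟫_ℂ ∂(ν.prod ν) := by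
      rw [integral_prod _ hK]
      have : ∀ s, ∫ r, ⟪f s, g r⟫_ℂ ∂ν = ⟪f s, ∫ r, g r ∂ν⟫_ℂ := fun s => integral_inner hg _
      simp only [this]
      exact (integral_inner_const hf _).symm
    rw [a1, a2, a3, ← integral_add hK1 hK2]
    refine integral_congr_ae ?_
    have : ∀ᵐ p ∂(ν.prod ν), p.1 ≠ p.2 := by
      refine (Measure.ae_prod_iff_ae_ae
        (measurableSet_eq_fun measurable_fst measurable_snd).compl).2 ?_
      refine ae_of_all _ fun s => ?_
      have : ∀ᵐ r ∂ν, r ≠ s := by simp [ae_iff]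
      filter_upwards [this] with r hr using hr.symm
    filter_upwards [this] with p hp
    rcases lt_or_gt_of_ne hp with h | h
    · simp [indicator, h.le, h.not_ge]
    · simp [indicator, h.le, h.not_ge]
  have i1 : Integrable (fun s => ⟪f s, ∫ r in (0 : ℝ)..s, g r⟫_ℂ) ν :=
    hK1.integral_prod_left.congr
      ((ae_restrict_iff' measurableSet_Ioc).2 (ae_of_all _ fun s hs => (e1 s hs).symm))
  have i2 : Integrable (fun s => ⟪∫ r in (0 : ℝ)..s, f r, g s⟫_ℂ) ν :=
    hK2.integral_prod_right.congr
      ((ae_restrict_iff' measurableSet_Ioc).2 (ae_of_all _ fun s hs => (e2 s hs).symm))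
  have i3 : Integrable (fun s => ⟪f s, y⟫_ℂ) ν := hf.inner_const y
  have i4 : Integrable (fun s => ⟪x, g s⟫_ℂ) ν := hg.const_inner x
  rw [intervalIntegral.integral_of_le ht, intervalIntegral.integral_of_le ht,
    intervalIntegral.integral_of_le ht]
  change ⟪x + ∫ s, f s ∂ν, y + ∫ s, g s ∂ν⟫_ℂ = ⟪x, y⟫_ℂ + ∫ s,
    (⟪f s, y + ∫ r in (0 : ℝ)..s, g r⟫_ℂ + ⟪x + ∫ r in (0 : ℝ)..s, f r, g s⟫_ℂ) ∂ν
  have split : ∀ s, ⟪f s, y + ∫ r in (0 : ℝ)..s, g r⟫_ℂ + ⟪x + ∫ r in (0 : ℝ)..s, f r, g s⟫_ℂ =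
      (⟪f s, y⟫_ℂ + ⟪f s, ∫ r in (0 : ℝ)..s, g r⟫_ℂ) +
        (⟪x, g s⟫_ℂ + ⟪∫ r in (0 : ℝ)..s, f r, g s⟫_ℂ) := fun s => by
    rw [inner_add_right, inner_add_left]
  simp_rw [split]
  have i13 : Integrable (fun s => ⟪f s, y⟫_ℂ + ⟪f s, ∫ r in (0 : ℝ)..s, g r⟫_ℂ) ν := i3.add i1
  have i24 : Integrable (fun s => ⟪x, g s⟫_ℂ + ⟪∫ r in (0 : ℝ)..s, f r, g s⟫_ℂ) ν := i4.add i2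
  rw [integral_add i13 i24, integral_add i3 i1, integral_add i4 i2,
    integral_inner hg, integral_inner_const hf, inner_add_left, inner_add_right, inner_add_right,
    hsum]
  ring

/-! ### Resolvents of a self-adjoint operator -/

theorem inner_map_eq_of_isSelfAdjoint [CompleteSpace E] {H : E →ₗ.[ℂ] E} (hH : IsSelfAdjoint H)
    (v w : H.domain) : ⟪H v, (w : E)⟫_ℂ = ⟪(v : E), H w⟫_ℂ := by
  have h := LinearPMap.adjoint_isFormalAdjoint hH.dense_domain
  rw [LinearPMap.isSelfAdjoint_def.1 hH] at h
  exact h v w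

/-- The cross term vanishes because `⟪v, H v⟫` is real. -/
theorem norm_add_smul_sq [CompleteSpace E] {H : E →ₗ.[ℂ] E} (hH : IsSelfAdjoint H) (r : ℝ)
    (v : H.domain) :
    ‖(v : E) + (Complex.I * r) • H v‖ ^ 2 = ‖(v : E)‖ ^ 2 + r ^ 2 * ‖H v‖ ^ 2 := by
  rw [@norm_add_sq ℂ, inner_smul_right, norm_smul]
  have h := inner_map_eq_of_isSelfAdjoint hH v v
  rw [← inner_conj_symm, Complex.conj_eq_iff_im] at h
  simp only [norm_mul, Complex.norm_I, one_mul, Complex.norm_real, Real.norm_eq_abs, mul_pow,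
    sq_abs]
  simp [h]

/-- On the graph of `H`, complete because `H` is closed, the map `v ↦ v + i r H v` is bounded below,
so its range is closed. A vector orthogonal to the range would be an eigenvector of `H* = H` with a
nonreal eigenvalue. -/
theorem exists_add_smul_eq [CompleteSpace E] {H : E →ₗ.[ℂ] E} (hH : IsSelfAdjoint H) {r : ℝ}
    (hr : r ≠ 0) (x : E) : ∃ v : H.domain, (v : E) + (Complex.I * r) • H v = x := by
  have hclosed : IsClosed (H.graph : Set (E × E)) := hH.isClosed
  have : CompleteSpace H.graph := hclosed.completeSpace_coe
  let L : (E × E) →L[ℂ] E :=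
    ContinuousLinearMap.fst ℂ E E + (Complex.I * r) • ContinuousLinearMap.snd ℂ E E
  let M : H.graph →L[ℂ] E := L.comp H.graph.subtypeL
  have hM : ∀ v : H.domain, M ⟨(v, H v), H.mem_graph v⟩ = (v : E) + (Complex.I * r) • H v :=
    fun v => rfl
  have hsurj : ∀ p : H.graph, ∃ v : H.domain, p = ⟨(v, H v), H.mem_graph v⟩ := by
    rintro ⟨⟨a, b⟩, hp⟩
    obtain ⟨v, rfl, rfl⟩ := H.mem_graph_iff.1 hp
    exact ⟨v, rfl⟩
  have hanti : ∃ K, AntilipschitzWith K M := by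
    refine ⟨⟨1 + |r|⁻¹, by positivity⟩, M.antilipschitz_of_bound fun p => ?_⟩
    obtain ⟨v, rfl⟩ := hsurj p
    rw [hM]
    have hsq := norm_add_smul_sq hH r v
    have h1 : ‖(v : E)‖ ≤ ‖(v : E) + (Complex.I * r) • H v‖ :=
      abs_le_of_sq_le_sq' (by rw [hsq]; nlinarith [sq_nonneg (r * ‖H v‖)]) (norm_nonneg _) |>.2
    have h2 : |r| * ‖H v‖ ≤ ‖(v : E) + (Complex.I * r) • H v‖ :=
      abs_le_of_sq_le_sq' (by rw [hsq, mul_pow, sq_abs]; nlinarith [sq_nonneg ‖(v : E)‖])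
        (norm_nonneg _) |>.2
    have hr' : 0 < |r| := abs_pos.2 hr
    have h3 : ‖H v‖ ≤ |r|⁻¹ * ‖(v : E) + (Complex.I * r) • H v‖ := by
      rwa [inv_mul_eq_div, le_div_iff₀' hr']
    have h4 : (0 : ℝ) ≤ |r|⁻¹ := by positivity
    have h5 := norm_nonneg ((v : E) + (Complex.I * r) • H v)
    change max ‖(v : E)‖ ‖H v‖ ≤ (1 + |r|⁻¹) * _
    refine max_le ?_ ?_ <;> nlinarith [mul_nonneg h4 h5]
  obtain ⟨K, hK⟩ := hanti
  have hrange : IsClosed (M.range : Set E) := by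
    exact hK.isClosed_range M.uniformContinuous
  have : CompleteSpace M.range := hrange.completeSpace_coe
  have hbot : M.rangeᗮ = ⊥ := by
    rw [Submodule.eq_bot_iff]
    intro w hw
    have hw' : ∀ v : H.domain, ⟪(v : E) + (Complex.I * r) • H v, w⟫_ℂ = 0 := fun v =>
      (Submodule.mem_orthogonal _ _).1 hw _ ⟨_, hM v⟩
    have hr' : (r : ℂ) ≠ 0 := by exact_mod_cast hr
    have hadj : ∀ v : H.domain, ⟪(Complex.I * r)⁻¹ • w, (v : E)⟫_ℂ = ⟪w, H v⟫_ℂ := fun v => by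
      have h := congrArg (starRingEnd ℂ) (hw' v)
      rw [inner_conj_symm, inner_add_right, inner_smul_right, map_zero] at h
      rw [inner_smul_left, eq_neg_of_add_eq_zero_left h]
      simp only [map_inv₀, map_mul, Complex.conj_I, Complex.conj_ofReal]
      field_simp
    have hex : ∃ w' : H.domain, (w' : E) = w ∧ H w' = (Complex.I * r)⁻¹ • w := by
      have hmem := LinearPMap.mem_adjoint_domain_of_exists w ⟨_, hadj⟩
      have happ := LinearPMap.adjoint_apply_eq hH.dense_domain ⟨w, hmem⟩ hadj
      -- The equality of `H` with its adjoint also identifies their domains; generalizing over `A`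
      -- allows it to be substituted.
      have key : ∀ A : E →ₗ.[ℂ] E, A = H → ∀ y : A.domain,
          ∃ w' : H.domain, (w' : E) = y ∧ H w' = A y := by
        rintro A rfl y; exact ⟨y, rfl, rfl⟩
      obtain ⟨w', h1, h2⟩ := key _ (LinearPMap.isSelfAdjoint_def.1 hH) ⟨w, hmem⟩
      exact ⟨w', h1, h2.trans happ⟩
    obtain ⟨w', h1, h2⟩ := hex
    -- With the sign of `r` reversed, the left side of the norm identity is `‖w - w‖² = 0`.
    have h3 := norm_add_smul_sq hH (-r) w'
    rw [h1, h2, smul_smul] at h3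
    have : (Complex.I * ((-r : ℝ) : ℂ)) * (Complex.I * r)⁻¹ = -1 := by
      push_cast; field_simp
    rw [this] at h3
    simp only [neg_smul, one_smul, add_neg_cancel, norm_zero] at h3
    have h4 := mul_nonneg (sq_nonneg (-r)) (sq_nonneg ‖(Complex.I * (r : ℂ))⁻¹ • w‖)
    have : ‖w‖ ^ 2 = 0 := by nlinarith [sq_nonneg ‖w‖]
    simpa using this
  rw [Submodule.orthogonal_eq_bot_iff] at hbot
  obtain ⟨p, hp⟩ : x ∈ M.range := by rw [hbot]; trivial
  obtain ⟨v, rfl⟩ := hsurj p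
  exact ⟨v, hp⟩

theorem eq_of_add_smul_eq [CompleteSpace E] {H : E →ₗ.[ℂ] E} (hH : IsSelfAdjoint H) (r : ℝ)
    {v w : H.domain} (h : (v : E) + (Complex.I * r) • H v = (w : E) + (Complex.I * r) • H w) :
    v = w := by
  have h1 := norm_add_smul_sq hH r (v - w)
  rw [LinearPMap.map_sub, Submodule.coe_sub, smul_sub, sub_add_sub_comm, h, sub_self,
    norm_zero] at h1
  have : ‖(v : E) - w‖ ^ 2 = 0 := by
    nlinarith [sq_nonneg ‖(v : E) - w‖, mul_nonneg (sq_nonneg r) (sq_nonneg ‖H v - H w‖)]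
  exact Subtype.ext (sub_eq_zero.1 (by simpa using this))

/-- `J` is a contraction into the domain of `H` commuting with `H`, and `B = H J`. -/
structure IsRegularizer [CompleteSpace E] (H : E →ₗ.[ℂ] E) (J B : E →L[ℂ] E) : Prop where
  exists_adjoint : ∀ w, ∃ v : H.domain, (v : E) = J.adjoint w ∧ H v = B.adjoint w
  symm : ∀ x y, ⟪J x, B y⟫_ℂ = ⟪B x, J y⟫_ℂ
  norm_le : ∀ x, ‖J x‖ ≤ ‖x‖
  comm : ∀ v : H.domain, B v = J (H v)

theorem exists_resolvent [CompleteSpace E] {H : E →ₗ.[ℂ] E} (hH : IsSelfAdjoint H) {r : ℝ}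
    (hr : r ≠ 0) : ∃ J : E →L[ℂ] E, ∀ x, ‖J x‖ ≤ ‖x‖ ∧
      ∃ v : H.domain, (v : E) = J x ∧ (v : E) + (Complex.I * r) • H v = x := by
  choose R hR using exists_add_smul_eq hH hr
  let J : E →ₗ[ℂ] E :=
    { toFun := fun x => R x
      map_add' := fun x y => by
        rw [← Submodule.coe_add]
        congr 1
        apply eq_of_add_smul_eq hH r
        rw [hR, LinearPMap.map_add, smul_add, Submodule.coe_add, add_add_add_comm, hR, hR]
      map_smul' := fun c x => by
        rw [RingHom.id_apply, ← Submodule.coe_smul]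
        congr 1
        apply eq_of_add_smul_eq hH r
        rw [hR, LinearPMap.map_smul, smul_comm, Submodule.coe_smul, ← smul_add, hR] }
  have hJ : ∀ x, ‖J x‖ ≤ ‖x‖ := fun x => by
    have h := norm_add_smul_sq hH r (R x)
    rw [hR] at h
    change ‖(R x : E)‖ ≤ ‖x‖
    exact abs_le_of_sq_le_sq' (by rw [h]; nlinarith [sq_nonneg (r * ‖H (R x)‖)])
      (norm_nonneg _) |>.2
  exact ⟨J.mkContinuous 1 (by simpa using hJ), fun x => ⟨hJ x, R x, rfl, hR x⟩⟩

theorem resolvent_adjoint [CompleteSpace E] {H : E →ₗ.[ℂ] E} (hH : IsSelfAdjoint H) {r : ℝ}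
    {J J' : E →L[ℂ] E}
    (hJ : ∀ x, ∃ v : H.domain, (v : E) = J x ∧ (v : E) + (Complex.I * r) • H v = x)
    (hJ' : ∀ x, ∃ v : H.domain, (v : E) = J' x ∧ (v : E) + (Complex.I * (-r : ℝ)) • H v = x) :
    J.adjoint = J' := by
  symm
  rw [ContinuousLinearMap.eq_adjoint_iff]
  intro x y
  obtain ⟨v, hv, hx⟩ := hJ' x
  obtain ⟨w, hw, hy⟩ := hJ y
  rw [← hv, ← hw, ← hx]
  nth_rw 1 [← hy]
  rw [inner_add_left, inner_add_right, inner_smul_left, inner_smul_right,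
    inner_map_eq_of_isSelfAdjoint hH]
  simp

/-- Here `J = (1 + i r H)⁻¹`, with adjoint `(1 - i r H)⁻¹`, and `B = H J = (i r)⁻¹ (1 - J)`, which
is bounded. On the domain, `J v - v = -i r J (H v)`, whence the rate `|r| ‖H v‖`. -/
theorem exists_regularizer [CompleteSpace E] {H : E →ₗ.[ℂ] E} (hH : IsSelfAdjoint H) {r : ℝ}
    (hr : r ≠ 0) : ∃ J B : E →L[ℂ] E, IsRegularizer H J B ∧ (∀ x, ‖J.adjoint x‖ ≤ ‖x‖) ∧
      (∀ v : H.domain, ‖J v - v‖ ≤ |r| * ‖H v‖) ∧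
      (∀ v : H.domain, ‖J.adjoint v - v‖ ≤ |r| * ‖H v‖) := by
  obtain ⟨J, hJ⟩ := exists_resolvent hH hr
  obtain ⟨J', hJ'⟩ := exists_resolvent hH (neg_ne_zero.2 hr)
  have hadj := resolvent_adjoint hH (fun x => (hJ x).2) (fun x => (hJ' x).2)
  have hr' : Complex.I * (r : ℂ) ≠ 0 := by simpa using hr
  set c : ℂ := Complex.I * r with hc
  have hcc : Complex.I * ((-r : ℝ) : ℂ) = -c := by rw [hc]; push_cast; ring
  set B : E →L[ℂ] E := c⁻¹ • (1 - J) with hB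
  have hBx : ∀ x, ∃ v : H.domain, (v : E) = J x ∧ H v = B x := fun x => by
    obtain ⟨v, h1, h2⟩ := (hJ x).2
    refine ⟨v, h1, ?_⟩
    change H v = c⁻¹ • (x - J x)
    rw [← h1, sub_eq_of_eq_add' h2.symm, smul_smul, inv_mul_cancel₀ hr', one_smul]
  have hBadj : B.adjoint = (-c)⁻¹ • (1 - J') := by
    have h1 : (1 : E →L[ℂ] E).adjoint = 1 := by
      rw [← ContinuousLinearMap.star_eq_adjoint, star_one]
    rw [hB, map_smulₛₗ, map_sub, hadj, h1, hc]
    simp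
  have hcomm : ∀ (s : ℝ) (K : E →L[ℂ] E),
      (∀ x, ∃ v : H.domain, (v : E) = K x ∧ (v : E) + (Complex.I * s) • H v = x) →
      ∀ v : H.domain, (v : E) = K v + (Complex.I * s) • K (H v) := by
    intro s K hK v
    obtain ⟨w, h1, h2⟩ := hK ((v : E) + (Complex.I * s) • H v)
    rw [← map_smul, ← map_add, ← h1]
    rw [eq_of_add_smul_eq hH s h2]
  have hdiff : ∀ (s : ℝ) (K : E →L[ℂ] E), (∀ x, ‖K x‖ ≤ ‖x‖ ∧
      ∃ v : H.domain, (v : E) = K x ∧ (v : E) + (Complex.I * s) • H v = x) →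
      ∀ v : H.domain, ‖K v - v‖ ≤ |s| * ‖H v‖ := by
    intro s K hK v
    have h := hcomm s K (fun x => (hK x).2) v
    have : K v - v = -((Complex.I * s) • K (H v)) := by nth_rw 2 [h]; abel
    rw [this, norm_neg, norm_smul]
    simpa using mul_le_mul_of_nonneg_left (hK (H v)).1 (abs_nonneg s)
  refine ⟨J, B, ⟨fun w => ?_, fun x y => ?_, fun x => (hJ x).1, fun v => ?_⟩, ?_, ?_, ?_⟩
  · obtain ⟨v, h1, h2⟩ := (hJ' w).2
    refine ⟨v, by rw [h1, hadj], ?_⟩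
    rw [hBadj]
    change H v = (-c)⁻¹ • (w - J' w)
    rw [← h1, sub_eq_of_eq_add' h2.symm, smul_smul, hcc, inv_mul_cancel₀ (neg_ne_zero.2 hr'), one_smul]
  · obtain ⟨v, h1, h2⟩ := hBx x
    obtain ⟨w, h3, h4⟩ := hBx y
    rw [← h1, ← h2, ← h3, ← h4, inner_map_eq_of_isSelfAdjoint hH]
  · have h := hcomm r J (fun x => (hJ x).2) v
    change c⁻¹ • ((v : E) - J v) = _
    nth_rw 1 [h]
    rw [add_sub_cancel_left, smul_smul, inv_mul_cancel₀ hr', one_smul]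
  · rw [hadj]; exact fun x => (hJ' x).1
  · exact hdiff r J hJ
  · rw [hadj]; simpa using hdiff (-r) J' hJ'

/-- A sequence of contractions which is close to the identity on a dense set converges strongly. -/
theorem tendsto_of_dense_of_norm_le {D : Set E} (hD : Dense D) {J : ℕ → E →L[ℂ] E}
    (hJ : ∀ n x, ‖J n x‖ ≤ ‖x‖) (h : ∀ v ∈ D, Tendsto (fun n => J n v) atTop (𝓝 v)) (x : E) :
    Tendsto (fun n => J n x) atTop (𝓝 x) := by
  rw [Metric.tendsto_nhds]
  intro ε hε
  obtain ⟨v, hv, hxv⟩ := Metric.mem_closure_iff.1 (hD x) (ε / 3) (by positivity)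
  filter_upwards [Metric.tendsto_nhds.1 (h v hv) (ε / 3) (by positivity)] with n hn
  have h1 : dist (J n x) (J n v) ≤ dist x v := by
    rw [dist_eq_norm, dist_eq_norm, ← map_sub]; exact hJ n _
  have h2 := dist_triangle4 (J n x) (J n v) v x
  rw [dist_comm v x] at h2
  linarith

theorem exists_seq_regularizer [CompleteSpace E] {H : E →ₗ.[ℂ] E} (hH : IsSelfAdjoint H) :
    ∃ J B : ℕ → E →L[ℂ] E, (∀ n, IsRegularizer H (J n) (B n)) ∧
      (∀ n x, ‖(J n).adjoint x‖ ≤ ‖x‖) ∧ (∀ x, Tendsto (fun n => J n x) atTop (𝓝 x)) ∧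
      (∀ x, Tendsto (fun n => (J n).adjoint x) atTop (𝓝 x)) := by
  have hr : ∀ n : ℕ, (1 / ((n : ℝ) + 1)) ≠ 0 := fun n => by positivity
  choose J B h1 h2 h3 h4 using fun n => exists_regularizer hH (hr n)
  have lim : ∀ C : ℝ, Tendsto (fun n : ℕ => |1 / ((n : ℝ) + 1)| * C) atTop (𝓝 0) := fun C => by
    have := (tendsto_one_div_add_atTop_nhds_zero_nat (𝕜 := ℝ)).abs.mul_const C
    simpa using this
  refine ⟨J, B, h1, h2, ?_, ?_⟩
  · refine tendsto_of_dense_of_norm_le hH.dense_domain (fun n => (h1 n).norm_le) fun v hv => ?_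
    rw [tendsto_iff_norm_sub_tendsto_zero]
    exact squeeze_zero (fun _ => norm_nonneg _) (fun n => h3 n ⟨v, hv⟩) (lim _)
  · refine tendsto_of_dense_of_norm_le hH.dense_domain h2 fun v hv => ?_
    rw [tendsto_iff_norm_sub_tendsto_zero]
    exact squeeze_zero (fun _ => norm_nonneg _) (fun n => h4 n ⟨v, hv⟩) (lim _)

/-! ### Estimates for controls -/

theorem control_integrableOn {T : ℝ} (a : Control T) : IntegrableOn a (Icc 0 T) :=
  (Lp.memLp a).integrable one_le_two

theorem control_intervalIntegrable {T s t : ℝ} (a : Control T) (hs : s ∈ Icc 0 T)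
    (ht : t ∈ Icc 0 T) : IntervalIntegrable a volume s t :=
  ((control_integrableOn a).mono_set (uIcc_subset_Icc hs ht)).intervalIntegrable

/-- Cauchy–Schwarz against the indicator of `S`. This is the source of the square-root moduli of
continuity below. -/
theorem setIntegral_abs_control_le {T : ℝ} (a : Control T) {S : Set ℝ} (hS : MeasurableSet S)
    (hST : S ⊆ Icc 0 T) : ∫ r in S, |a r| ≤ ‖a‖ * Real.sqrt (volume.real S) := by
  have hfin : (volume.restrict (Icc (0 : ℝ) T)) S ≠ ⊤ := measure_ne_top _ _
  have h := real_inner_le_norm (indicatorConstLp 2 hS hfin (1 : ℝ)) |a|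
  rw [L2.inner_indicatorConstLp_one, norm_indicatorConstLp two_ne_zero ENNReal.ofNat_ne_top,
    norm_abs_eq_norm, Measure.restrict_restrict hS, inter_eq_left.2 hST, norm_one, one_mul] at h
  have h1 : ∫ r in S, |a r| = ∫ r in S, (|a| : Control T) r := by
    refine integral_congr_ae ?_
    have := ae_restrict_of_ae_restrict_of_subset hST (Lp.coeFn_abs a)
    filter_upwards [this] with r hr using hr.symm
  have h2 : (volume.restrict (Icc (0 : ℝ) T)).real S = volume.real S := by
    rw [measureReal_restrict_apply hS, inter_eq_left.2 hST]
  rw [h1, mul_comm, Real.sqrt_eq_rpow]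
  simpa [h2] using h

theorem intervalIntegral_abs_control_le {T s t : ℝ} (a : Control T) (hs : s ∈ Icc 0 T)
    (ht : t ∈ Icc 0 T) : |(∫ r in s..t, |a r|)| ≤ ‖a‖ * Real.sqrt |t - s| := by
  rw [intervalIntegral.abs_intervalIntegral_eq, abs_of_nonneg (integral_nonneg fun _ => abs_nonneg _)]
  refine (setIntegral_abs_control_le a measurableSet_uIoc
    (uIoc_subset_uIcc.trans (uIcc_subset_Icc hs ht))).trans_eq ?_
  simp [Measure.real, uIoc, Real.volume_Ioc, max_sub_min_eq_abs', abs_sub_comm]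

theorem integral_sq_control {T : ℝ} (hT : 0 ≤ T) (a : Control T) :
    ∫ t in (0 : ℝ)..T, (a t) ^ 2 = ‖a‖ ^ 2 := by
  rw [← real_inner_self_eq_norm_sq, L2.inner_def, intervalIntegral.integral_of_le hT,
    integral_Icc_eq_integral_Ioc]
  simp [pow_two]

/-! ### Weak solutions, Green's formula and conservation of the norm -/

/-- A bounded, weakly continuous solution of the Schrödinger equation. -/
structure IsWeakSolution {T : ℝ} (H : E →ₗ.[ℂ] E) (μ : E →L[ℂ] E) (a : Control T)
    (φ : ℝ → E) : Prop where
  bounded : ∃ C, ∀ t ∈ Icc (0 : ℝ) T, ‖φ t‖ ≤ C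
  continuousOn_inner : ∀ u, ContinuousOn (fun t => ⟪u, φ t⟫_ℂ) (Icc 0 T)
  eq : ∀ t ∈ Icc (0 : ℝ) T, ∀ v : H.domain,
    ⟪(v : E), φ t⟫_ℂ = ⟪(v : E), φ 0⟫_ℂ
      - Complex.I * ∫ s in (0 : ℝ)..t, (⟪H v, φ s⟫_ℂ - (a s : ℂ) * ⟪μ (v : E), φ s⟫_ℂ)

theorem IsSchrodingerSolution.isWeakSolution {T : ℝ} {H : E →ₗ.[ℂ] E} {μ : E →L[ℂ] E}
    {a : Control T} {φ : ℝ → E} (h : IsSchrodingerSolution H μ a φ) : IsWeakSolution H μ a φ where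
  bounded := isCompact_Icc.exists_bound_of_continuousOn h.1
  continuousOn_inner _ := continuousOn_const.inner h.1
  eq := h.2

theorem integrableOn_control_mul {T : ℝ} (a : Control T) {f : ℝ → ℂ}
    (hf : ContinuousOn f (Icc 0 T)) : IntegrableOn (fun s => (a s : ℂ) * f s) (Icc 0 T) :=
  IntegrableOn.mul_continuousOn (control_integrableOn a).ofReal hf isCompact_Icc

/-- The bound depends on the control only through `‖a‖`, so a bounded family of controls gives an
equicontinuous family of solutions. -/
theorem norm_integral_inner_le {T : ℝ} (a : Control T) {φ : ℝ → E} {C : ℝ}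
    (hC : ∀ t ∈ Icc (0 : ℝ) T, ‖φ t‖ ≤ C) (x y : E) {s t : ℝ} (hs : s ∈ Icc 0 T)
    (ht : t ∈ Icc 0 T) :
    ‖∫ r in s..t, (⟪x, φ r⟫_ℂ - (a r : ℂ) * ⟪y, φ r⟫_ℂ)‖ ≤
      C * ‖x‖ * |t - s| + C * ‖y‖ * (‖a‖ * Real.sqrt |t - s|) := by
  have hC0 : 0 ≤ C := (norm_nonneg _).trans (hC s hs)
  have hsub : uIoc s t ⊆ Icc 0 T := uIoc_subset_uIcc.trans (uIcc_subset_Icc hs ht)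
  have hi : IntervalIntegrable (fun r => C * ‖x‖ + C * ‖y‖ * |a r|) volume s t :=
    intervalIntegrable_const.add ((control_intervalIntegrable a hs ht).abs.const_mul _)
  have h1 := intervalIntegral.norm_integral_le_abs_of_norm_le
    (f := fun r => ⟪x, φ r⟫_ℂ - (a r : ℂ) * ⟪y, φ r⟫_ℂ) (μ := volume)
    (ae_restrict_of_forall_mem measurableSet_uIoc fun r hr => by
      have hb : ∀ z : E, ‖⟪z, φ r⟫_ℂ‖ ≤ C * ‖z‖ := fun z =>
        (norm_inner_le_norm _ _).trans (by
          rw [mul_comm]; exact mul_le_mul_of_nonneg_right (hC r (hsub hr)) (norm_nonneg _))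
      calc ‖⟪x, φ r⟫_ℂ - (a r : ℂ) * ⟪y, φ r⟫_ℂ‖
          ≤ ‖⟪x, φ r⟫_ℂ‖ + ‖(a r : ℂ) * ⟪y, φ r⟫_ℂ‖ := norm_sub_le _ _
        _ ≤ C * ‖x‖ + C * ‖y‖ * |a r| := by
          rw [norm_mul, Complex.norm_real, Real.norm_eq_abs, mul_comm (|a r|)]
          exact add_le_add (hb x) (mul_le_mul_of_nonneg_right (hb y) (abs_nonneg _))) hi
  refine h1.trans ?_
  rw [intervalIntegral.integral_add intervalIntegrable_const
    ((control_intervalIntegrable a hs ht).abs.const_mul _), intervalIntegral.integral_const,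
    intervalIntegral.integral_const_mul]
  refine (abs_add_le _ _).trans (add_le_add ?_ ?_)
  · rw [smul_eq_mul, abs_mul, mul_comm, abs_of_nonneg (by positivity : 0 ≤ C * ‖x‖)]
  · rw [abs_mul, abs_of_nonneg (by positivity : 0 ≤ C * ‖y‖)]
    exact mul_le_mul_of_nonneg_left (intervalIntegral_abs_control_le a hs ht) (by positivity)

/-- The integral equation between two arbitrary times of `[0,T]`. -/
theorem integral_equation_sub {T : ℝ} {a : Control T} {φ : ℝ → E}
    (hφ : ∀ u, ContinuousOn (fun t => ⟪u, φ t⟫_ℂ) (Icc 0 T)) {z : ℂ} {f : ℝ → ℂ} {x y : E}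
    (heq : ∀ t ∈ Icc (0 : ℝ) T, f t =
      z - Complex.I * ∫ s in (0 : ℝ)..t, (⟪x, φ s⟫_ℂ - (a s : ℂ) * ⟪y, φ s⟫_ℂ))
    {s t : ℝ} (hs : s ∈ Icc 0 T) (ht : t ∈ Icc 0 T) :
    f t - f s = - Complex.I * ∫ r in s..t, (⟪x, φ r⟫_ℂ - (a r : ℂ) * ⟪y, φ r⟫_ℂ) := by
  have hint : IntegrableOn (fun r => ⟪x, φ r⟫_ℂ - (a r : ℂ) * ⟪y, φ r⟫_ℂ) (Icc 0 T) :=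
    ((hφ x).integrableOn_Icc).sub (integrableOn_control_mul a (hφ y))
  have h0 : (0 : ℝ) ∈ Icc 0 T := ⟨le_rfl, hs.1.trans hs.2⟩
  have hii : ∀ {p q : ℝ}, p ∈ Icc 0 T → q ∈ Icc 0 T →
      IntervalIntegrable (fun r => ⟪x, φ r⟫_ℂ - (a r : ℂ) * ⟪y, φ r⟫_ℂ) volume p q :=
    fun hp hq => (hint.mono_set (uIcc_subset_Icc hp hq)).intervalIntegrable
  rw [heq t ht, heq s hs, ← intervalIntegral.integral_add_adjacent_intervals (hii h0 hs) (hii hs ht)]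
  ring

theorem continuousOn_of_norm_sub_le {F : Type*} [NormedAddCommGroup F] {f : ℝ → F} {S : Set ℝ}
    {c d : ℝ} (h : ∀ s ∈ S, ∀ t ∈ S, ‖f t - f s‖ ≤ c * |t - s| + d * Real.sqrt |t - s|) :
    ContinuousOn f S := by
  intro s hs
  rw [ContinuousWithinAt, tendsto_iff_norm_sub_tendsto_zero]
  have h1 : Continuous fun t : ℝ => c * |t - s| + d * Real.sqrt |t - s| := by fun_prop
  have h2 : Tendsto (fun t : ℝ => c * |t - s| + d * Real.sqrt |t - s|) (𝓝[S] s) (𝓝 0) := by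
    simpa using (h1.tendsto s).mono_left nhdsWithin_le_nhds
  exact squeeze_zero' (Eventually.of_forall fun _ => norm_nonneg _)
    (eventually_mem_nhdsWithin.mono fun t ht => h s hs t ht) h2

theorem integrableOn_control_smul {T : ℝ} (a : Control T) {f : ℝ → E}
    (hf : AEStronglyMeasurable f (volume.restrict (Icc 0 T))) {C : ℝ}
    (hC : ∀ t ∈ Icc (0 : ℝ) T, ‖f t‖ ≤ C) :
    IntegrableOn (fun s => (a s : ℂ) • f s) (Icc 0 T) := by
  refine Integrable.mono' ((control_integrableOn a).abs.const_mul C)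
    ((control_integrableOn a).ofReal.1.smul hf)
    (ae_restrict_of_forall_mem measurableSet_Icc fun t ht => ?_)
  rw [norm_smul, Complex.norm_real, Real.norm_eq_abs, mul_comm]
  exact mul_le_mul_of_nonneg_right (hC t ht) (abs_nonneg _)

theorem integrableOn_of_norm_le {F : Type*} [NormedAddCommGroup F] {T : ℝ} {f : ℝ → F}
    (hf : AEStronglyMeasurable f (volume.restrict (Icc 0 T))) {C : ℝ}
    (hC : ∀ t ∈ Icc (0 : ℝ) T, ‖f t‖ ≤ C) : IntegrableOn f (Icc 0 T) :=
  Integrable.mono' (g := fun _ => C) (integrable_const C) hf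
    (ae_restrict_of_forall_mem measurableSet_Icc hC)

section Regularized
variable [CompleteSpace E] {T : ℝ} {H : E →ₗ.[ℂ] E} {μ : E →L[ℂ] E} {a b : Control T} {φ χ : ℝ → E}

theorem IsWeakSolution.inner_regularized_eq (hφ : IsWeakSolution H μ a φ) {J B : E →L[ℂ] E}
    (hJ : IsRegularizer H J B) (w : E) : ∀ t ∈ Icc (0 : ℝ) T, ⟪w, J (φ t)⟫_ℂ = ⟪w, J (φ 0)⟫_ℂ -
      Complex.I * ∫ s in (0 : ℝ)..t,
        (⟪B.adjoint w, φ s⟫_ℂ - (a s : ℂ) * ⟪μ (J.adjoint w), φ s⟫_ℂ) := by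
  intro t ht
  obtain ⟨v, h1, h2⟩ := hJ.exists_adjoint w
  have h := hφ.eq t ht v
  rw [h1, h2] at h
  simpa only [ContinuousLinearMap.adjoint_inner_left] using h

theorem IsWeakSolution.continuousOn_regularized (hφ : IsWeakSolution H μ a φ) {J B : E →L[ℂ] E}
    (hJ : IsRegularizer H J B) : ContinuousOn (fun t => J (φ t)) (Icc 0 T) := by
  obtain ⟨C, hC⟩ := hφ.bounded
  refine continuousOn_of_norm_sub_le (c := C * ‖B.adjoint‖) (d := C * (‖μ‖ * ‖J.adjoint‖) * ‖a‖)
    fun s hs t ht => ?_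
  have hC0 : 0 ≤ C := (norm_nonneg _).trans (hC s hs)
  -- The increment itself is the test vector; one factor `‖w‖` is cancelled at the end.
  set w := J (φ t) - J (φ s) with hw
  have h1 := integral_equation_sub hφ.continuousOn_inner (hφ.inner_regularized_eq hJ w) hs ht
  rw [← inner_sub_right, ← hw] at h1
  have h2 := norm_integral_inner_le a hC (B.adjoint w) (μ (J.adjoint w)) hs ht
  have h3 : ‖w‖ ^ 2 ≤ (C * ‖B.adjoint‖ * |t - s| +
      C * (‖μ‖ * ‖J.adjoint‖) * ‖a‖ * Real.sqrt |t - s|) * ‖w‖ := by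
    have h4 : ‖w‖ ^ 2 = ‖⟪w, w⟫_ℂ‖ := by rw [inner_self_eq_norm_sq_to_K]; simp
    rw [h4, h1, norm_mul, norm_neg, Complex.norm_I, one_mul]
    refine h2.trans ?_
    have h5 : ‖B.adjoint w‖ ≤ ‖B.adjoint‖ * ‖w‖ := ContinuousLinearMap.le_opNorm _ _
    have h6 : ‖μ (J.adjoint w)‖ ≤ ‖μ‖ * ‖J.adjoint‖ * ‖w‖ := by
      rw [mul_assoc]; exact μ.le_opNorm_of_le (ContinuousLinearMap.le_opNorm _ _)
    calc _ ≤ C * (‖B.adjoint‖ * ‖w‖) * |t - s| +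
          C * (‖μ‖ * ‖J.adjoint‖ * ‖w‖) * (‖a‖ * Real.sqrt |t - s|) := by gcongr
      _ = _ := by ring
  rcases (norm_nonneg w).eq_or_lt with h | h
  · rw [← h]; positivity
  · exact le_of_mul_le_mul_right (by rw [← pow_two]; exact h3) h

/-- Weak continuity alone does not give strong measurability in a nonseparable space; `φ` is instead
a pointwise limit of the norm-continuous functions `J n ∘ φ`. -/
theorem IsWeakSolution.aestronglyMeasurable (hH : IsSelfAdjoint H) (hφ : IsWeakSolution H μ a φ) :
    AEStronglyMeasurable φ (volume.restrict (Icc 0 T)) := by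
  obtain ⟨J, B, h1, -, h3, -⟩ := exists_seq_regularizer hH
  exact aestronglyMeasurable_of_tendsto_ae atTop
    (fun n => (hφ.continuousOn_regularized (h1 n)).aestronglyMeasurable measurableSet_Icc)
    (ae_of_all _ fun t => h3 (φ t))

/-- The time derivative of the regularized solution. -/
theorem IsWeakSolution.regularized_eq (hH : IsSelfAdjoint H) (hμ : IsSelfAdjoint μ)
    (hφ : IsWeakSolution H μ a φ) {J B : E →L[ℂ] E} (hJ : IsRegularizer H J B) :
    IntegrableOn (fun s => -Complex.I • (B (φ s) - (a s : ℂ) • J (μ (φ s)))) (Icc 0 T) ∧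
    ∀ t ∈ Icc (0 : ℝ) T, J (φ t) = J (φ 0) +
      ∫ s in (0 : ℝ)..t, -Complex.I • (B (φ s) - (a s : ℂ) • J (μ (φ s))) := by
  obtain ⟨C, hC⟩ := hφ.bounded
  have hm := hφ.aestronglyMeasurable hH
  have i1 : IntegrableOn (fun s => B (φ s)) (Icc 0 T) :=
    B.integrable_comp (integrableOn_of_norm_le hm hC)
  have i2 : IntegrableOn (fun s => (a s : ℂ) • J (μ (φ s))) (Icc 0 T) := by
    refine ((J.comp μ).integrable_comp (integrableOn_control_smul a hm hC)).congr
      (ae_of_all _ fun s => ?_)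
    simp
  have i3 : IntegrableOn (fun s => -Complex.I • (B (φ s) - (a s : ℂ) • J (μ (φ s)))) (Icc 0 T) :=
    (i1.sub i2).smul (-Complex.I)
  refine ⟨i3, fun t ht => ext_inner_left ℂ fun w => ?_⟩
  rw [hφ.inner_regularized_eq hJ w t ht, inner_add_right, intervalIntegral.integral_of_le ht.1,
    intervalIntegral.integral_of_le ht.1,
    ← integral_inner (i3.mono_set (Ioc_subset_Icc_self.trans (Icc_subset_Icc_right ht.2))),
    sub_eq_add_neg, ← neg_mul, ← integral_const_mul]
  congr 2
  ext s
  have hμs : ⟪μ (J.adjoint w), φ s⟫_ℂ = ⟪w, J (μ (φ s))⟫_ℂ := by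
    rw [← ContinuousLinearMap.adjoint_inner_left J]
    conv_lhs => rw [← ContinuousLinearMap.isSelfAdjoint_iff'.1 hμ]
    rw [ContinuousLinearMap.adjoint_inner_left]
  rw [inner_smul_right, inner_sub_right, inner_smul_right, hμs,
    ContinuousLinearMap.adjoint_inner_left]

/-- Integration by parts; the terms containing `H` cancel by the symmetry of `⟪J x, B y⟫`, and only
the control terms survive. -/
theorem IsWeakSolution.inner_regularized_inner (hH : IsSelfAdjoint H) (hμ : IsSelfAdjoint μ)
    (hχ : IsWeakSolution H μ b χ) (hφ : IsWeakSolution H μ a φ) {J B : E →L[ℂ] E}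
    (hJ : IsRegularizer H J B) {t : ℝ} (ht : t ∈ Icc (0 : ℝ) T) :
    ⟪J (χ t), J (φ t)⟫_ℂ = ⟪J (χ 0), J (φ 0)⟫_ℂ + ∫ s in (0 : ℝ)..t,
      Complex.I * ((a s : ℂ) * ⟪J (χ s), J (μ (φ s))⟫_ℂ
        - (b s : ℂ) * ⟪J (μ (χ s)), J (φ s)⟫_ℂ) := by
  obtain ⟨i1, e1⟩ := hχ.regularized_eq hH hμ hJ
  obtain ⟨i2, e2⟩ := hφ.regularized_eq hH hμ hJ
  have hsub : Ioc 0 t ⊆ Icc 0 T := Ioc_subset_Icc_self.trans (Icc_subset_Icc_right ht.2)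
  have h := inner_add_integral_add_integral ht.1 (i1.mono_set hsub) (i2.mono_set hsub)
    (J (χ 0)) (J (φ 0))
  rw [← e1 t ht, ← e2 t ht] at h
  rw [h]
  congr 1
  refine intervalIntegral.integral_congr fun s hs => ?_
  rw [uIcc_of_le ht.1] at hs
  have hs' : s ∈ Icc 0 T := ⟨hs.1, hs.2.trans ht.2⟩
  rw [← e1 s hs', ← e2 s hs']
  simp only [inner_smul_left, inner_smul_right, inner_sub_left, inner_sub_right, hJ.symm,
    Complex.conj_ofReal, map_neg, Complex.conj_I]
  ring

/-- Green's formula for two solutions driven by different controls. -/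
theorem IsWeakSolution.inner_eq (hH : IsSelfAdjoint H) (hμ : IsSelfAdjoint μ)
    (hχ : IsWeakSolution H μ b χ) (hφ : IsWeakSolution H μ a φ) {t : ℝ} (ht : t ∈ Icc (0 : ℝ) T) :
    ⟪χ t, φ t⟫_ℂ = ⟪χ 0, φ 0⟫_ℂ + ∫ s in (0 : ℝ)..t,
      Complex.I * (((a s - b s : ℝ) : ℂ) * ⟪χ s, μ (φ s)⟫_ℂ) := by
  obtain ⟨J, B, h1, -, h3, -⟩ := exists_seq_regularizer hH
  obtain ⟨C, hC⟩ := hφ.bounded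
  obtain ⟨D, hD⟩ := hχ.bounded
  have hm := hφ.aestronglyMeasurable hH
  have hm' := hχ.aestronglyMeasurable hH
  have hsub : uIoc 0 t ⊆ Icc 0 T := by
    rw [uIoc_of_le ht.1]; exact Ioc_subset_Icc_self.trans (Icc_subset_Icc_right ht.2)
  have ha := (control_integrableOn a).ofReal (𝕜 := ℂ) |>.1
  have hb := (control_integrableOn b).ofReal (𝕜 := ℂ) |>.1
  have h0 : (0 : ℝ) ∈ Icc 0 T := ⟨le_rfl, ht.1.trans ht.2⟩
  have hC0 : 0 ≤ C := (norm_nonneg _).trans (hC _ h0)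
  have hD0 : 0 ≤ D := (norm_nonneg _).trans (hD _ h0)
  have lim1 := ((h3 (χ t)).inner (𝕜 := ℂ) (h3 (φ t)))
  have lim2 := ((h3 (χ 0)).inner (𝕜 := ℂ) (h3 (φ 0)))
  -- The regularizers tend strongly to the identity; as they are contractions, an integrable
  -- multiple of `|a s| + |b s|` dominates.
  have lim3 : Tendsto (fun n => ∫ s in (0 : ℝ)..t,
      Complex.I * ((a s : ℂ) * ⟪J n (χ s), J n (μ (φ s))⟫_ℂ
        - (b s : ℂ) * ⟪J n (μ (χ s)), J n (φ s)⟫_ℂ)) atTop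
      (𝓝 (∫ s in (0 : ℝ)..t, Complex.I * ((a s : ℂ) * ⟪χ s, μ (φ s)⟫_ℂ
        - (b s : ℂ) * ⟪μ (χ s), φ s⟫_ℂ))) := by
    refine intervalIntegral.tendsto_integral_filter_of_dominated_convergence
      (fun s => (|a s| + |b s|) * (D * (‖μ‖ * C))) (Eventually.of_forall fun n => ?_)
      (Eventually.of_forall fun n => ae_of_all _ fun s hs => ?_) ?_
      (ae_of_all _ fun s _ => ?_)
    · refine AEStronglyMeasurable.mono_set hsub (AEStronglyMeasurable.const_mul ?_ _)
      have m1 := (J n).continuous.comp_aestronglyMeasurable hm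
      have m2 := (J n).continuous.comp_aestronglyMeasurable hm'
      have m3 := ((J n).comp μ).continuous.comp_aestronglyMeasurable hm
      have m4 := ((J n).comp μ).continuous.comp_aestronglyMeasurable hm'
      exact (ha.mul (m2.inner m3)).sub (hb.mul (m4.inner m1))
    · have hs' := hsub hs
      rw [norm_mul, Complex.norm_I, one_mul]
      refine (norm_sub_le _ _).trans ?_
      rw [add_mul, norm_mul, norm_mul, Complex.norm_real, Complex.norm_real, Real.norm_eq_abs,
        Real.norm_eq_abs]
      have k1 : ‖J n (φ s)‖ ≤ C := ((h1 n).norm_le _).trans (hC s hs')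
      have k2 : ‖J n (χ s)‖ ≤ D := ((h1 n).norm_le _).trans (hD s hs')
      have k3 : ‖J n (μ (φ s))‖ ≤ ‖μ‖ * C :=
        ((h1 n).norm_le _).trans (μ.le_opNorm_of_le (hC s hs'))
      have k4 : ‖J n (μ (χ s))‖ ≤ ‖μ‖ * D :=
        ((h1 n).norm_le _).trans (μ.le_opNorm_of_le (hD s hs'))
      refine add_le_add (mul_le_mul_of_nonneg_left ?_ (abs_nonneg _))
        (mul_le_mul_of_nonneg_left ?_ (abs_nonneg _))
      · exact (norm_inner_le_norm _ _).trans (mul_le_mul k2 k3 (norm_nonneg _) hD0)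
      · refine (norm_inner_le_norm _ _).trans
          ((mul_le_mul k4 k1 (norm_nonneg _) (by positivity)).trans_eq (by ring))
    · have hi : IntegrableOn (fun s => (|a s| + |b s|) * (D * (‖μ‖ * C))) (Icc 0 T) :=
        ((control_integrableOn a).abs.add (control_integrableOn b).abs).mul_const _
      exact (hi.mono_set (uIcc_subset_Icc h0 ht)).intervalIntegrable
    · refine Tendsto.const_mul _ (Tendsto.sub ?_ ?_)
      · exact ((h3 _).inner (h3 _)).const_mul _
      · exact ((h3 _).inner (h3 _)).const_mul _
  have heq := tendsto_nhds_unique lim1 ((lim2.add lim3).congr fun n =>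
    (hχ.inner_regularized_inner hH hμ hφ (h1 n) ht).symm)
  rw [heq]
  congr 2
  ext s
  have hμs : ⟪μ (χ s), φ s⟫_ℂ = ⟪χ s, μ (φ s)⟫_ℂ := by
    conv_lhs => rw [← ContinuousLinearMap.isSelfAdjoint_iff'.1 hμ]
    rw [ContinuousLinearMap.adjoint_inner_left]
  rw [hμs]; push_cast; ring

theorem IsWeakSolution.inner_eq_of_same_control (hH : IsSelfAdjoint H) (hμ : IsSelfAdjoint μ)
    (hχ : IsWeakSolution H μ a χ) (hφ : IsWeakSolution H μ a φ) {s t : ℝ} (hs : s ∈ Icc (0 : ℝ) T)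
    (ht : t ∈ Icc (0 : ℝ) T) : ⟪χ t, φ t⟫_ℂ = ⟪χ s, φ s⟫_ℂ := by
  rw [hχ.inner_eq hH hμ hφ ht, hχ.inner_eq hH hμ hφ hs]
  simp

theorem IsWeakSolution.norm_eq (hH : IsSelfAdjoint H) (hμ : IsSelfAdjoint μ)
    (hφ : IsWeakSolution H μ a φ) {s t : ℝ} (hs : s ∈ Icc (0 : ℝ) T)
    (ht : t ∈ Icc (0 : ℝ) T) : ‖φ t‖ = ‖φ s‖ := by
  have h := hφ.inner_eq_of_same_control hH hμ hφ hs ht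
  rw [inner_self_eq_norm_sq_to_K, inner_self_eq_norm_sq_to_K] at h
  exact (sq_eq_sq₀ (norm_nonneg _) (norm_nonneg _)).1 (by exact_mod_cast h)

/-- Weak continuity and a constant norm give `‖φ t - φ s‖² = 2 ‖φ s‖² - 2 Re ⟪φ s, φ t⟫ → 0`, hence
continuity in norm. -/
theorem IsWeakSolution.isSchrodingerSolution (hH : IsSelfAdjoint H) (hμ : IsSelfAdjoint μ)
    (hφ : IsWeakSolution H μ a φ) : IsSchrodingerSolution H μ a φ := by
  refine ⟨fun s hs => ?_, hφ.eq⟩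
  rw [ContinuousWithinAt, tendsto_iff_norm_sub_tendsto_zero]
  have h1 : Tendsto (fun t => ⟪φ s, φ t⟫_ℂ) (𝓝[Icc 0 T] s) (𝓝 ⟪φ s, φ s⟫_ℂ) :=
    hφ.continuousOn_inner (φ s) s hs
  have h2 : Tendsto (fun t => Real.sqrt (2 * ‖φ s‖ ^ 2 - 2 * (⟪φ s, φ t⟫_ℂ).re))
      (𝓝[Icc 0 T] s) (𝓝 0) := by
    have := (((Complex.continuous_re.tendsto _).comp h1).const_mul 2).const_sub (2 * ‖φ s‖ ^ 2)
    have := (Real.continuous_sqrt.tendsto _).comp this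
    have hself : (⟪φ s, φ s⟫_ℂ).re = ‖φ s‖ ^ 2 := by
      simpa using inner_self_eq_norm_sq (𝕜 := ℂ) (φ s)
    rw [hself, sub_self, Real.sqrt_zero] at this
    exact this
  refine h2.congr' (eventually_mem_nhdsWithin.mono fun t ht => ?_)
  have h3 := @norm_sub_sq ℂ _ _ _ _ (φ t) (φ s)
  rw [hφ.norm_eq hH hμ hs ht, inner_re_symm] at h3
  change _ = ‖φ t - φ s‖
  rw [← Real.sqrt_sq (norm_nonneg (φ t - φ s)), h3]
  congr 1
  simp only [RCLike.re_to_complex]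
  ring

end Regularized

/-! ### Weak and strong limits of solutions along ultrafilters -/

/-- Bounded families in a Hilbert space converge weakly along ultrafilters. -/
theorem exists_weak_limit {𝕜 F : Type*} [RCLike 𝕜] [NormedAddCommGroup F] [InnerProductSpace 𝕜 F]
    [CompleteSpace F] {ι : Type*} (l : Ultrafilter ι) {x : ι → F} {C : ℝ} (hx : ∀ i, ‖x i‖ ≤ C) :
    ∃ y : F, ‖y‖ ≤ C ∧ ∀ u : F, Tendsto (fun i => ⟪u, x i⟫_𝕜) l (𝓝 ⟪u, y⟫_𝕜) := by
  -- Banach–Alaoglu is transported by the Riesz isomorphism; its conjugate-linearity explains the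
  -- conjugation at the end.
  let f : ι → WeakDual 𝕜 F := fun i =>
    StrongDual.toWeakDual (InnerProductSpace.toDual 𝕜 F (x i))
  have hmem : ∀ i, f i ∈ WeakDual.toStrongDual ⁻¹' Metric.closedBall (0 : StrongDual 𝕜 F) C := by
    intro i
    rw [mem_preimage, mem_closedBall_zero_iff]
    change ‖InnerProductSpace.toDual 𝕜 F (x i)‖ ≤ C
    rw [LinearIsometryEquiv.norm_map]; exact hx i
  obtain ⟨y, hy, hlim⟩ := (WeakDual.isCompact_closedBall (0 : StrongDual 𝕜 F) C).ultrafilter_le_nhds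
    (l.map f) (by rw [Ultrafilter.coe_map, le_principal_iff, mem_map]; exact univ_mem' hmem)
  refine ⟨(InnerProductSpace.toDual 𝕜 F).symm (WeakDual.toStrongDual y), ?_, fun u => ?_⟩
  · rw [LinearIsometryEquiv.norm_map]
    simpa using hy
  · have h1 : Tendsto (fun i => f i u) l (𝓝 (y u)) :=
      ((WeakDual.eval_continuous u).tendsto y).comp hlim
    have h2 := ((RCLike.continuous_conj (K := 𝕜)).tendsto _).comp h1
    have h3 : y u = ⟪(InnerProductSpace.toDual 𝕜 F).symm (WeakDual.toStrongDual y), u⟫_𝕜 := by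
      rw [InnerProductSpace.toDual_symm_apply]; rfl
    rw [h3, inner_conj_symm] at h2
    refine h2.congr fun i => ?_
    rw [← inner_conj_symm]
    rfl

/-- The easy half of Arzelà–Ascoli: the common modulus passes to the limit, and compactness of
`[0,T]` turns local uniformity into uniformity. -/
theorem tendstoUniformlyOn_of_equicontinuous {ι : Type*} {l : Filter ι} [l.NeBot] {T c d : ℝ}
    {f : ι → ℝ → ℂ} {g : ℝ → ℂ}
    (h : ∀ᶠ i in l, ∀ s ∈ Icc 0 T, ∀ t ∈ Icc 0 T,
      ‖f i t - f i s‖ ≤ c * |t - s| + d * Real.sqrt |t - s|)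
    (hlim : ∀ t ∈ Icc 0 T, Tendsto (fun i => f i t) l (𝓝 (g t))) :
    TendstoUniformlyOn f g l (Icc 0 T) := by
  have hg : ∀ s ∈ Icc 0 T, ∀ t ∈ Icc 0 T, ‖g t - g s‖ ≤ c * |t - s| + d * Real.sqrt |t - s| :=
    fun s hs t ht => le_of_tendsto ((hlim t ht).sub (hlim s hs)).norm
      (h.mono fun i hi => hi s hs t ht)
  rw [← tendstoLocallyUniformlyOn_iff_tendstoUniformlyOn_of_compact isCompact_Icc,
    Metric.tendstoLocallyUniformlyOn_iff]
  intro ε hε s hs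
  have h1 : Continuous fun t : ℝ => c * |t - s| + d * Real.sqrt |t - s| := by fun_prop
  have h2 : ∀ᶠ t in 𝓝[Icc 0 T] s, c * |t - s| + d * Real.sqrt |t - s| < ε / 3 :=
    (h1.tendsto s).mono_left nhdsWithin_le_nhds |>.eventually_lt_const (by simpa using hε)
  refine ⟨_, h2.and eventually_mem_nhdsWithin, ?_⟩
  filter_upwards [h, Metric.tendsto_nhds.1 (hlim s hs) (ε / 3) (by positivity)] with i hi1 hi2
  rintro t ⟨ht1, ht2⟩
  have k1 := hi1 s hs t ht2
  have k2 := hg s hs t ht2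
  rw [dist_comm, dist_eq_norm] at *
  calc ‖f i t - g t‖ = ‖(f i t - f i s) + (f i s - g s) - (g t - g s)‖ := by congr 1; ring
    _ ≤ ‖f i t - f i s‖ + ‖f i s - g s‖ + ‖g t - g s‖ :=
      (norm_sub_le _ _).trans (add_le_add_left (norm_add_le _ _) _)
    _ < ε := by rw [norm_sub_rev (f i s) (g s)] at *; linarith

theorem tendsto_integral_of_tendstoUniformlyOn {ι : Type*} {l : Filter ι} {T t : ℝ} {f : ι → ℝ → ℂ}
    {g : ℝ → ℂ} (h : TendstoUniformlyOn f g l (Icc 0 T)) (hf : ∀ i, ContinuousOn (f i) (Icc 0 T))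
    (hg : ContinuousOn g (Icc 0 T)) (ht : t ∈ Icc 0 T) :
    Tendsto (fun i => ∫ s in (0 : ℝ)..t, f i s) l (𝓝 (∫ s in (0 : ℝ)..t, g s)) := by
  have h0 : (0 : ℝ) ∈ Icc 0 T := ⟨le_rfl, ht.1.trans ht.2⟩
  have hsub : uIcc 0 t ⊆ Icc 0 T := uIcc_subset_Icc h0 ht
  rw [Metric.tendsto_nhds]
  intro ε hε
  have hδ : 0 < ε / (t + 1) := div_pos hε (by linarith [ht.1])
  filter_upwards [Metric.tendstoUniformlyOn_iff.1 h _ hδ] with i hi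
  rw [dist_eq_norm, ← intervalIntegral.integral_sub ((hf i).mono hsub).intervalIntegrable
    (hg.mono hsub).intervalIntegrable]
  have := intervalIntegral.norm_integral_le_of_norm_le_const (a := 0) (b := t)
    (f := fun s => f i s - g s) (C := ε / (t + 1)) fun s hs => by
      have := hi s (hsub (uIoc_subset_uIcc hs))
      rw [dist_comm, dist_eq_norm] at this
      exact this.le
  refine this.trans_lt ?_
  rw [sub_zero, abs_of_nonneg ht.1, div_mul_eq_mul_div, div_lt_iff₀ (by linarith [ht.1])]
  nlinarith [ht.1]

theorem memLp_of_continuousOn {T : ℝ} {f : ℝ → ℝ} (hf : ContinuousOn f (Icc 0 T)) :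
    MemLp f 2 (volume.restrict (Icc 0 T)) := by
  obtain ⟨C, hC⟩ := isCompact_Icc.exists_bound_of_continuousOn hf
  exact MemLp.of_bound (hf.aestronglyMeasurable measurableSet_Icc) C
    (ae_restrict_of_forall_mem measurableSet_Icc hC)

/-- The integral is the inner product of the control with the truncation of `f` to `(0,t]`, an
element of `L²`. -/
theorem tendsto_integral_mul_of_weak {ι : Type*} {l : Filter ι} {T t : ℝ} {a : ι → Control T}
    {e : Control T} (hweak : ∀ g : Control T, Tendsto (fun i => ⟪g, a i⟫_ℝ) l (𝓝 ⟪g, e⟫_ℝ))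
    {f : ℝ → ℝ} (hf : ContinuousOn f (Icc 0 T)) (ht : t ∈ Icc 0 T) :
    Tendsto (fun i => ∫ s in (0 : ℝ)..t, a i s * f s) l (𝓝 (∫ s in (0 : ℝ)..t, e s * f s)) := by
  have hm : MemLp ((Ioc 0 t).indicator f) 2 (volume.restrict (Icc 0 T)) :=
    (memLp_of_continuousOn hf).indicator measurableSet_Ioc
  have key : ∀ b : Control T, ⟪hm.toLp, b⟫_ℝ = ∫ s in (0 : ℝ)..t, b s * f s := fun b => by
    rw [L2.inner_def, intervalIntegral.integral_of_le ht.1]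
    have hsub : Ioc 0 t ⊆ Icc 0 T := Ioc_subset_Icc_self.trans (Icc_subset_Icc_right ht.2)
    have h1 : ∫ s in Ioc 0 t, b s * f s =
        ∫ s in Icc 0 T, (Ioc 0 t).indicator (fun s => b s * f s) s := by
      rw [integral_indicator measurableSet_Ioc, Measure.restrict_restrict measurableSet_Ioc,
        inter_eq_left.2 hsub]
    rw [h1]
    refine integral_congr_ae ?_
    filter_upwards [hm.coeFn_toLp] with s hs
    rw [hs]
    by_cases h : s ∈ Ioc 0 t <;> simp [h]
  simpa only [key] using hweak hm.toLp

/-- Weak times strong: `a i * f i = a i * (f i - g) + a i * g`, where the first part is small since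
the controls are bounded and the second is the fixed-function case. -/
theorem tendsto_integral_control_mul {ι : Type*} {l : Filter ι} {T t A : ℝ}
    {f : ι → ℝ → ℂ} {g : ℝ → ℂ} (h : TendstoUniformlyOn f g l (Icc 0 T))
    (hf : ∀ i, ContinuousOn (f i) (Icc 0 T)) (hg : ContinuousOn g (Icc 0 T)) {a : ι → Control T}
    {e : Control T} (hA : ∀ i, ‖a i‖ ≤ A)
    (hweak : ∀ g : Control T, Tendsto (fun i => ⟪g, a i⟫_ℝ) l (𝓝 ⟪g, e⟫_ℝ)) (ht : t ∈ Icc 0 T) :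
    Tendsto (fun i => ∫ s in (0 : ℝ)..t, (a i s : ℂ) * f i s) l
      (𝓝 (∫ s in (0 : ℝ)..t, (e s : ℂ) * g s)) := by
  have h0 : (0 : ℝ) ∈ Icc 0 T := ⟨le_rfl, ht.1.trans ht.2⟩
  have hsub : uIcc 0 t ⊆ Icc 0 T := uIcc_subset_Icc h0 ht
  have hint : ∀ (b : Control T) {k : ℝ → ℂ}, ContinuousOn k (Icc 0 T) →
      IntervalIntegrable (fun s => (b s : ℂ) * k s) volume 0 t := fun b k hk =>
    ((integrableOn_control_mul b hk).mono_set hsub).intervalIntegrable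
  have h1 : Tendsto (fun i => ∫ s in (0 : ℝ)..t, (a i s : ℂ) * g s) l
      (𝓝 (∫ s in (0 : ℝ)..t, (e s : ℂ) * g s)) := by
    have hre := tendsto_integral_mul_of_weak hweak (Complex.continuous_re.comp_continuousOn hg) ht
    have him := tendsto_integral_mul_of_weak hweak (Complex.continuous_im.comp_continuousOn hg) ht
    have key : ∀ b : Control T, ∫ s in (0 : ℝ)..t, (b s : ℂ) * g s =
        ((∫ s in (0 : ℝ)..t, b s * (Complex.re ∘ g) s : ℝ) : ℂ) +
        ((∫ s in (0 : ℝ)..t, b s * (Complex.im ∘ g) s : ℝ) : ℂ) * Complex.I := fun b => by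
      rw [← intervalIntegral.integral_ofReal, ← intervalIntegral.integral_ofReal,
        ← intervalIntegral.integral_mul_const, ← intervalIntegral.integral_add]
      · congr 1
        ext s
        push_cast
        simp only [Function.comp]
        nth_rw 1 [← Complex.re_add_im (g s)]
        ring
      · simpa using hint b
          (Complex.continuous_ofReal.comp_continuousOn (Complex.continuous_re.comp_continuousOn hg))
      · simpa using (hint b (Complex.continuous_ofReal.comp_continuousOn
          (Complex.continuous_im.comp_continuousOn hg))).mul_const Complex.I
    simp only [key]
    exact ((Complex.continuous_ofReal.tendsto _).comp hre).add
      (((Complex.continuous_ofReal.tendsto _).comp him).mul_const _)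
  have h2 : Tendsto (fun i => ∫ s in (0 : ℝ)..t, (a i s : ℂ) * (f i s - g s)) l (𝓝 0) := by
    rw [Metric.tendsto_nhds]
    intro ε hε
    rcases isEmpty_or_nonempty ι with hι | ⟨⟨i₀⟩⟩
    · exact Eventually.of_forall fun i => hι.elim i
    have hA0 : 0 ≤ A := (norm_nonneg _).trans (hA i₀)
    set K := A * Real.sqrt t + 1 with hK
    have hKpos : 0 < K := by positivity
    filter_upwards [Metric.tendstoUniformlyOn_iff.1 h (ε / K) (by positivity)] with i hi
    rw [dist_zero_right]
    have hb := intervalIntegral.norm_integral_le_abs_of_norm_le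
      (f := fun s => (a i s : ℂ) * (f i s - g s)) (g := fun s => |a i s| * (ε / K))
      (a := 0) (b := t) (μ := volume)
      (ae_restrict_of_forall_mem measurableSet_uIoc fun s hs => by
        rw [norm_mul, Complex.norm_real, Real.norm_eq_abs]
        have := hi s (hsub (uIoc_subset_uIcc hs))
        rw [dist_comm, dist_eq_norm] at this
        exact mul_le_mul_of_nonneg_left this.le (abs_nonneg _))
      ((control_intervalIntegrable (a i) h0 ht).abs.mul_const _)
    refine hb.trans_lt ?_
    rw [intervalIntegral.integral_mul_const, abs_mul, abs_of_pos (by positivity : 0 < ε / K)]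
    have hc := intervalIntegral_abs_control_le (a i) h0 ht
    rw [sub_zero, abs_of_nonneg ht.1] at hc
    calc _ ≤ (A * Real.sqrt t) * (ε / K) := by
          refine mul_le_mul_of_nonneg_right (hc.trans ?_) (by positivity)
          exact mul_le_mul_of_nonneg_right (hA i) (Real.sqrt_nonneg _)
      _ < K * (ε / K) := by
          refine mul_lt_mul_of_pos_right ?_ (by positivity)
          rw [hK]; linarith
      _ = ε := by field_simp
  have h3 := h2.add h1
  rw [zero_add] at h3
  refine h3.congr fun i => ?_
  have hi : IntervalIntegrable (fun s => (a i s : ℂ) * (f i s - g s)) volume 0 t :=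
    hint _ ((hf i).sub hg)
  rw [← intervalIntegral.integral_add hi (hint _ hg)]
  congr 1
  ext s
  ring

/-- Weak limits of solutions along an ultrafilter: both the operators (strongly on the domain of
`H`) and the controls (weakly) may vary. -/
theorem exists_limit_solution [CompleteSpace E] {T : ℝ} {H : E →ₗ.[ℂ] E} (hH : IsSelfAdjoint H)
    {μ : E →L[ℂ] E} (hμ : IsSelfAdjoint μ) {ι : Type*} (l : Ultrafilter ι) {h : ι → H.domain → E}
    (hh : ∀ v, Tendsto (fun i => h i v) l (𝓝 (H v))) {a : ι → Control T} {e : Control T} {A : ℝ}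
    (hA : ∀ i, ‖a i‖ ≤ A)
    (hweak : ∀ g : Control T, Tendsto (fun i => ⟪g, a i⟫_ℝ) l (𝓝 ⟪g, e⟫_ℝ)) {φ : ι → ℝ → E}
    {C : ℝ} (hC : ∀ i, ∀ t ∈ Icc (0 : ℝ) T, ‖φ i t‖ ≤ C)
    (hcont : ∀ i u, ContinuousOn (fun t => ⟪u, φ i t⟫_ℂ) (Icc 0 T))
    (heq : ∀ i, ∀ t ∈ Icc (0 : ℝ) T, ∀ v : H.domain, ⟪(v : E), φ i t⟫_ℂ = ⟪(v : E), φ i 0⟫_ℂ -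
      Complex.I * ∫ s in (0 : ℝ)..t, (⟪h i v, φ i s⟫_ℂ - (a i s : ℂ) * ⟪μ (v : E), φ i s⟫_ℂ)) :
    ∃ φ' : ℝ → E, IsSchrodingerSolution H μ e φ' ∧
      ∀ u, TendstoUniformlyOn (fun i t => ⟪u, φ i t⟫_ℂ) (fun t => ⟪u, φ' t⟫_ℂ) l (Icc 0 T) := by
  have hex : ∀ t, ∃ y : E, t ∈ Icc 0 T →
      ‖y‖ ≤ C ∧ ∀ u : E, Tendsto (fun i => ⟪u, φ i t⟫_ℂ) l (𝓝 ⟪u, y⟫_ℂ) := fun t => by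
    by_cases ht : t ∈ Icc 0 T
    · obtain ⟨y, hy⟩ := exists_weak_limit (𝕜 := ℂ) l (fun i => hC i t ht)
      exact ⟨y, fun _ => hy⟩
    · exact ⟨0, fun h => absurd h ht⟩
  choose φ' hφ' using hex
  -- For test vectors in the domain the equation gives a modulus of continuity independent of `i`,
  -- once `‖h i v‖ ≤ ‖H v‖ + 1`. Other test vectors follow by density and the bound `C`.
  have hdom : ∀ v : H.domain, TendstoUniformlyOn (fun i t => ⟪(v : E), φ i t⟫_ℂ)
      (fun t => ⟪(v : E), φ' t⟫_ℂ) l (Icc 0 T) := by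
    intro v
    refine tendstoUniformlyOn_of_equicontinuous (c := C * (‖H v‖ + 1)) (d := C * ‖μ v‖ * A) ?_
      fun t ht => (hφ' t ht).2 v
    filter_upwards [(hh v).norm.eventually_le_const (lt_add_one ‖H v‖)] with i hi s hs t ht
    have hC0 : 0 ≤ C := (norm_nonneg _).trans (hC i s hs)
    rw [integral_equation_sub (hcont i) (fun t ht => heq i t ht v) hs ht, norm_mul, norm_neg,
      Complex.norm_I, one_mul]
    refine (norm_integral_inner_le (a i) (hC i) _ _ hs ht).trans ?_
    have := hA i
    rw [← mul_assoc (C * ‖μ v‖)]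
    gcongr
  have hunif : ∀ u, TendstoUniformlyOn (fun i t => ⟪u, φ i t⟫_ℂ) (fun t => ⟪u, φ' t⟫_ℂ) l
      (Icc 0 T) := by
    intro u
    rw [Metric.tendstoUniformlyOn_iff]
    intro ε hε
    have hδ : 0 < ε / (3 * (|C| + 1)) := by positivity
    obtain ⟨v, hv, huv⟩ := Metric.mem_closure_iff.1 (hH.dense_domain u) _ hδ
    rw [dist_eq_norm] at huv
    have hb : ∀ y : E, ‖y‖ ≤ C → ‖⟪u - v, y⟫_ℂ‖ ≤ ε / 3 := fun y hy => by
      refine (norm_inner_le_norm _ _).trans ?_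
      calc _ ≤ ε / (3 * (|C| + 1)) * (|C| + 1) :=
            mul_le_mul huv.le (by linarith [le_abs_self C]) (norm_nonneg _) hδ.le
        _ = ε / 3 := by field_simp
    filter_upwards [Metric.tendstoUniformlyOn_iff.1 (hdom ⟨v, hv⟩) (ε / 3) (by positivity)]
      with i hi t ht
    have k1 := hi t ht
    have k2 := hb _ (hC i t ht)
    have k3 := hb _ (hφ' t ht).1
    rw [dist_eq_norm] at k1 ⊢
    have : ⟪u, φ' t⟫_ℂ - ⟪u, φ i t⟫_ℂ =
        ⟪u - v, φ' t⟫_ℂ - ⟪u - v, φ i t⟫_ℂ + (⟪v, φ' t⟫_ℂ - ⟪v, φ i t⟫_ℂ) := by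
      simp only [inner_sub_left]; ring
    rw [this]
    refine (norm_add_le _ _).trans_lt ?_
    have := norm_sub_le ⟪u - v, φ' t⟫_ℂ ⟪u - v, φ i t⟫_ℂ
    change ‖⟪v, φ' t⟫_ℂ - ⟪v, φ i t⟫_ℂ‖ < ε / 3 at k1
    linarith
  have hcont' : ∀ u, ContinuousOn (fun t => ⟪u, φ' t⟫_ℂ) (Icc 0 T) := fun u =>
    (hunif u).continuousOn (Eventually.of_forall fun i => hcont i u).frequently
  have hweaksol : IsWeakSolution H μ e φ' := by
    refine ⟨⟨C, fun t ht => (hφ' t ht).1⟩, hcont', fun t ht v => ?_⟩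
    have h0 : (0 : ℝ) ∈ Icc 0 T := ⟨le_rfl, ht.1.trans ht.2⟩
    have hHv : TendstoUniformlyOn (fun i t => ⟪h i v, φ i t⟫_ℂ) (fun t => ⟪H v, φ' t⟫_ℂ) l
        (Icc 0 T) := by
      have hz : TendstoUniformlyOn (fun i t => ⟪h i v - H v, φ i t⟫_ℂ) (fun _ => (0 : ℂ)) l
          (Icc 0 T) := by
        rw [Metric.tendstoUniformlyOn_iff]
        intro ε hε
        have hδ : 0 < ε / (|C| + 1) := by positivity
        filter_upwards [Metric.tendsto_nhds.1 (hh v) _ hδ] with i hi t ht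
        rw [dist_zero_left]
        rw [dist_eq_norm] at hi
        refine (norm_inner_le_norm _ _).trans_lt ?_
        calc _ ≤ ‖h i v - H v‖ * (|C| + 1) := mul_le_mul_of_nonneg_left
              (by linarith [le_abs_self C, hC i t ht]) (norm_nonneg _)
          _ < ε / (|C| + 1) * (|C| + 1) := mul_lt_mul_of_pos_right hi (by positivity)
          _ = ε := by field_simp
      refine ((hz.add (hunif (H v))).congr (Eventually.of_forall fun i t _ => ?_)).congr_right
        fun t _ => ?_
      · simp
      · simp
    have l1 := tendsto_integral_of_tendstoUniformlyOn hHv (fun i => hcont i _) (hcont' _) ht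
    have l2 := tendsto_integral_control_mul (hunif (μ v)) (fun i => hcont i _) (hcont' _) hA
      hweak ht
    have l3 := ((hφ' 0 h0).2 v).sub ((l1.sub l2).const_mul Complex.I)
    have split : ∀ (x y : E) (b : Control T) (f : ℝ → E),
        (∀ u, ContinuousOn (fun t => ⟪u, f t⟫_ℂ) (Icc 0 T)) →
        ∫ s in (0 : ℝ)..t, (⟪x, f s⟫_ℂ - (b s : ℂ) * ⟪y, f s⟫_ℂ) =
          (∫ s in (0 : ℝ)..t, ⟪x, f s⟫_ℂ) - ∫ s in (0 : ℝ)..t, (b s : ℂ) * ⟪y, f s⟫_ℂ := by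
      intro x y b f hf
      exact intervalIntegral.integral_sub
        ((hf x).mono (uIcc_subset_Icc h0 ht)).intervalIntegrable
        ((integrableOn_control_mul b (hf y)).mono_set (uIcc_subset_Icc h0 ht)).intervalIntegrable
    rw [split _ _ _ _ hcont']
    refine tendsto_nhds_unique ((hφ' t ht).2 v) (l3.congr fun i => ?_)
    rw [heq i t ht v, split _ _ _ _ (hcont i)]
  exact ⟨φ', hweaksol.isSchrodingerSolution hH hμ, hunif⟩

/-- If solutions converge weakly, uniformly in time, and strongly at one time, then they converge
in norm, uniformly in time. -/
theorem tendstoUniformlyOn_of_weak [CompleteSpace E] {T : ℝ} {H : E →ₗ.[ℂ] E}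
    (hH : IsSelfAdjoint H) {μ : E →L[ℂ] E} (hμ : IsSelfAdjoint μ) {ι : Type*} {l : Filter ι}
    [l.NeBot] {a : ι → Control T} {e : Control T} {φ : ι → ℝ → E} {φ' : ℝ → E}
    (hφ : ∀ i, IsSchrodingerSolution H μ (a i) (φ i)) (hφ' : IsSchrodingerSolution H μ e φ')
    (hw : ∀ u, TendstoUniformlyOn (fun i t => ⟪u, φ i t⟫_ℂ) (fun t => ⟪u, φ' t⟫_ℂ) l (Icc 0 T))
    {t₀ : ℝ} (ht₀ : t₀ ∈ Icc 0 T) {x : E} (hx : Tendsto (fun i => φ i t₀) l (𝓝 x)) :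
    φ' t₀ = x ∧ TendstoUniformlyOn φ φ' l (Icc 0 T) := by
  have hxeq : φ' t₀ = x := by
    refine ext_inner_left ℂ fun u => ?_
    exact tendsto_nhds_unique ((hw u).tendsto_at ht₀) (tendsto_const_nhds.inner hx)
  refine ⟨hxeq, ?_⟩
  have hn : ∀ i, ∀ t ∈ Icc 0 T, ‖φ i t‖ = ‖φ i t₀‖ := fun i t ht =>
    (hφ i).isWeakSolution.norm_eq hH hμ ht₀ ht
  have hn' : ∀ t ∈ Icc 0 T, ‖φ' t‖ = ‖x‖ := fun t ht => by
    rw [← hxeq]; exact hφ'.isWeakSolution.norm_eq hH hμ ht₀ ht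
  have hlim : Tendsto (fun i => ‖φ i t₀‖) l (𝓝 ‖x‖) := hx.norm
  rw [← tendstoLocallyUniformlyOn_iff_tendstoUniformlyOn_of_compact isCompact_Icc,
    Metric.tendstoLocallyUniformlyOn_iff]
  intro ε hε s hs
  -- Chosen so that three terms of size at most `ε² / 8` bound the inner product in `h7`; doubled
  -- and added to the `ε² / 4` from the norms, they give `ε²`.
  set δ : ℝ := ε ^ 2 / (8 * (‖x‖ + 1)) with hδ
  have hδ0 : 0 < δ := by positivity
  have hc : ∀ᶠ t in 𝓝[Icc 0 T] s, ‖φ' t - φ' s‖ < δ := by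
    simpa [dist_eq_norm] using Metric.tendsto_nhds.1 (hφ'.1 s hs) δ hδ0
  refine ⟨_, hc.and eventually_mem_nhdsWithin, ?_⟩
  have hlim2 : Tendsto (fun i => ‖φ i t₀‖ ^ 2 - ‖x‖ ^ 2) l (𝓝 0) := by
    exact tendsto_sub_nhds_zero_iff.2 (hlim.pow 2)
  filter_upwards [hlim.eventually_le_const (lt_add_one ‖x‖),
    hlim2.eventually_lt_const (by positivity : 0 < ε ^ 2 / 4),
    Metric.tendstoUniformlyOn_iff.1 (hw (φ' s)) (ε ^ 2 / 8) (by positivity)] with i h1 h2 h3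
  rintro t ⟨ht1, ht2⟩
  have h4 := h3 t ht2
  rw [dist_eq_norm, ← inner_sub_right] at h4
  rw [dist_comm, dist_eq_norm]
  have h5 : ‖φ i t - φ' t‖ ^ 2 = ‖φ i t₀‖ ^ 2 - ‖x‖ ^ 2 + 2 * (⟪φ' t, φ' t - φ i t⟫_ℂ).re := by
    have k1 := @norm_sub_sq ℂ _ _ _ _ (φ i t) (φ' t)
    have k2 : (⟪φ' t, φ' t⟫_ℂ).re = ‖φ' t‖ ^ 2 := by
      simpa using inner_self_eq_norm_sq (𝕜 := ℂ) (φ' t)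
    rw [inner_re_symm] at k1
    rw [k1, hn i t ht2, inner_sub_right, Complex.sub_re, k2, hn' t ht2, RCLike.re_to_complex]
    ring
  -- Weak convergence is uniform in time only against a fixed vector, so `φ' t` is replaced by `φ'
  -- s` for `t` near `s`.
  have h6 : ⟪φ' t, φ' t - φ i t⟫_ℂ = ⟪φ' t - φ' s, φ' t⟫_ℂ - ⟪φ' t - φ' s, φ i t⟫_ℂ +
      ⟪φ' s, φ' t - φ i t⟫_ℂ := by
    simp only [inner_sub_left, inner_sub_right]; ring
  have h7 : ‖⟪φ' t, φ' t - φ i t⟫_ℂ‖ < δ * ‖x‖ + δ * (‖x‖ + 1) + ε ^ 2 / 8 := by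
    rw [h6]
    have b1 : ‖⟪φ' t - φ' s, φ' t⟫_ℂ‖ ≤ δ * ‖x‖ := (norm_inner_le_norm _ _).trans
      (by rw [hn' t ht2]; exact mul_le_mul_of_nonneg_right ht1.le (norm_nonneg _))
    have b2 : ‖⟪φ' t - φ' s, φ i t⟫_ℂ‖ ≤ δ * (‖x‖ + 1) := (norm_inner_le_norm _ _).trans
      (mul_le_mul ht1.le (by rw [hn i t ht2]; exact h1) (norm_nonneg _) hδ0.le)
    refine (norm_add_le _ _).trans_lt ?_
    have := norm_sub_le ⟪φ' t - φ' s, φ' t⟫_ℂ ⟪φ' t - φ' s, φ i t⟫_ℂ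
    linarith
  have h8 := Complex.re_le_norm ⟪φ' t, φ' t - φ i t⟫_ℂ
  have h9 : δ * (‖x‖ + 1) = ε ^ 2 / 8 := by rw [hδ]; field_simp
  have h10 : ‖φ i t - φ' t‖ ^ 2 < ε ^ 2 := by
    rw [h5]
    nlinarith [sq_nonneg ε]
  exact lt_of_pow_lt_pow_left₀ 2 hε.le h10

/-! ### Existence of solutions -/

/-- The radial truncation at radius `R`. -/
def radialTruncation (R : ℝ) (x : E) : E := ((R / max R ‖x‖ : ℝ) : ℂ) • x

theorem norm_radialTruncation_le {R : ℝ} (hR : 0 < R) (x : E) : ‖radialTruncation R x‖ ≤ R := by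
  have hm : 0 < max R ‖x‖ := lt_max_of_lt_left hR
  rw [radialTruncation, norm_smul, Complex.norm_real, Real.norm_eq_abs,
    abs_of_pos (div_pos hR hm), div_mul_eq_mul_div, div_le_iff₀ hm]
  exact mul_le_mul_of_nonneg_left (le_max_right _ _) hR.le

theorem radialTruncation_of_norm_le {R : ℝ} (hR : 0 < R) {x : E} (hx : ‖x‖ ≤ R) :
    radialTruncation R x = x := by
  rw [radialTruncation, max_eq_left hx, div_self hR.ne', Complex.ofReal_one, one_smul]

theorem norm_radialTruncation_sub_le {R : ℝ} (hR : 0 < R) (x y : E) :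
    ‖radialTruncation R x - radialTruncation R y‖ ≤ 2 * ‖x - y‖ := by
  have hx : 0 < max R ‖x‖ := lt_max_of_lt_left hR
  have hy : 0 < max R ‖y‖ := lt_max_of_lt_left hR
  have h1 : radialTruncation R x - radialTruncation R y = ((R / max R ‖x‖ : ℝ) : ℂ) • (x - y) +
      ((R / max R ‖x‖ - R / max R ‖y‖ : ℝ) : ℂ) • y := by
    simp only [radialTruncation, smul_sub]
    push_cast
    rw [sub_smul]
    abel
  have h2 : R / max R ‖x‖ ≤ 1 := (div_le_one hx).2 (le_max_left _ _)
  have h3 : |max R ‖y‖ - max R ‖x‖| ≤ ‖x - y‖ := by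
    refine (abs_max_sub_max_le_max R ‖y‖ R ‖x‖).trans ?_
    rw [sub_self, abs_zero, max_eq_right (abs_nonneg _), norm_sub_rev]
    exact abs_norm_sub_norm_le _ _
  have h4 : |R / max R ‖x‖ - R / max R ‖y‖| * ‖y‖ ≤ ‖x - y‖ := by
    have e : R / max R ‖x‖ - R / max R ‖y‖ =
        (R / max R ‖x‖) * ((max R ‖y‖ - max R ‖x‖) / max R ‖y‖) := by field_simp
    rw [e, abs_mul, abs_of_pos (div_pos hR hx), abs_div, abs_of_pos hy, mul_assoc]
    have h5 : |max R ‖y‖ - max R ‖x‖| / max R ‖y‖ * ‖y‖ ≤ ‖x - y‖ := by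
      rw [div_mul_eq_mul_div, div_le_iff₀ hy]
      exact mul_le_mul h3 (le_max_right _ _) (norm_nonneg _) (norm_nonneg _)
    calc _ ≤ 1 * ‖x - y‖ := mul_le_mul h2 h5 (by positivity) zero_le_one
      _ = _ := one_mul _
  rw [h1]
  refine (norm_add_le _ _).trans ?_
  rw [norm_smul, norm_smul, Complex.norm_real, Complex.norm_real, Real.norm_eq_abs,
    Real.norm_eq_abs, abs_of_pos (div_pos hR hx), two_mul]
  exact add_le_add ((mul_le_mul_of_nonneg_right h2 (norm_nonneg _)).trans_eq (one_mul _)) h4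

theorem inner_self_map_im [CompleteSpace E] {A : E →L[ℂ] E} (hA : IsSelfAdjoint A) (x : E) :
    (⟪x, A x⟫_ℂ).im = 0 := by
  rw [← Complex.conj_eq_iff_im, inner_conj_symm]
  conv_lhs => rw [← ContinuousLinearMap.isSelfAdjoint_iff'.1 hA]
  rw [ContinuousLinearMap.adjoint_inner_left]

/-- Global solutions for bounded self-adjoint generators and continuous controls. -/
theorem exists_solution_of_bounded [CompleteSpace E] {A B : E →L[ℂ] E} (hA : IsSelfAdjoint A)
    (hB : IsSelfAdjoint B) {T : ℝ} (hT : 0 ≤ T) {g : ℝ → ℝ} (hg : Continuous g) (x : E) :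
    ∃ φ : ℝ → E, φ 0 = x ∧ (∀ t ∈ Icc 0 T, ‖φ t‖ = ‖x‖) ∧ ∀ t ∈ Icc 0 T,
      HasDerivWithinAt φ (-Complex.I • (A (φ t) - (g t : ℂ) • B (φ t))) (Icc 0 T) t := by
  obtain ⟨G, hG⟩ := isCompact_Icc.exists_bound_of_continuousOn (hg.continuousOn (s := Icc 0 T))
  have h0 : (0 : ℝ) ∈ Icc 0 T := ⟨le_rfl, hT⟩
  have hG0 : 0 ≤ G := (norm_nonneg _).trans (hG 0 h0)
  set M : ℝ := ‖A‖ + G * ‖B‖ with hM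
  have hM0 : 0 ≤ M := by positivity
  set R : ℝ := ‖x‖ + 1 with hR
  have hR0 : 0 < R := by positivity
  let F : ℝ → E → E := fun t y => -Complex.I • (A y - (g t : ℂ) • B y)
  have hF : ∀ t ∈ Icc 0 T, ∀ y, ‖F t y‖ ≤ M * ‖y‖ := fun t ht y => by
    simp only [F]
    rw [norm_smul, norm_neg, Complex.norm_I, one_mul]
    refine (norm_sub_le _ _).trans ?_
    rw [norm_smul, Complex.norm_real, hM, add_mul, mul_assoc]
    exact add_le_add (A.le_opNorm y) (mul_le_mul (hG t ht) (B.le_opNorm y) (norm_nonneg _) hG0)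
  have hFsub : ∀ t y z, F t y - F t z = F t (y - z) := fun t y z => by
    simp only [F, map_sub, smul_sub]; abel
  -- Truncating the state bounds the vector field by `M * R`, so the ball of radius `M * R * T` is
  -- never left and Picard–Lindelöf covers all of `[0,T]` at once. The Lipschitz constant `M * 2`
  -- carries the factor 2 of the truncation.
  have hPL : IsPicardLindelof (fun t y => F t (radialTruncation R y)) (⟨0, h0⟩ : Icc 0 T) x
      ⟨M * R * T, by positivity⟩ 0 ⟨M * R, by positivity⟩ ⟨M * 2, by positivity⟩ := by
    refine ⟨fun t ht => LipschitzOnWith.of_dist_le_mul fun y _ z _ => ?_, fun y _ => ?_,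
      fun t ht y _ => ?_, ?_⟩
    · rw [dist_eq_norm, dist_eq_norm, hFsub]
      refine (hF t ht _).trans ?_
      change _ ≤ M * 2 * _
      rw [mul_assoc]
      exact mul_le_mul_of_nonneg_left (norm_radialTruncation_sub_le hR0 y z) hM0
    · exact Continuous.continuousOn (by simp only [F]; fun_prop)
    · exact (hF t ht _).trans (mul_le_mul_of_nonneg_left (norm_radialTruncation_le hR0 y) hM0)
    · change M * R * max (T - 0) (0 - 0) ≤ M * R * T - 0
      simp [hT]
  obtain ⟨φ, hφ0, hφ⟩ := hPL.exists_eq_forall_mem_Icc_hasDerivWithinAt₀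
  -- The truncation multiplies by a real scalar, so the truncated field is still orthogonal to `φ`
  -- in real part. The norm stays `‖x‖ < R`, and the truncation was never active.
  have hinner : ∀ t ∈ Icc 0 T,
      HasDerivWithinAt (fun t => ⟪φ t, φ t⟫_ℂ) 0 (Icc 0 T) t := fun t ht => by
    have h := (hφ t ht).inner ℂ (hφ t ht)
    have i1 := inner_self_map_im hA (φ t)
    have i2 := inner_self_map_im hB (φ t)
    have key : (⟪φ t, F t (radialTruncation R (φ t))⟫_ℂ).re = 0 := by
      simp only [F, radialTruncation, map_smul, inner_smul_right, inner_sub_right]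
      simp [i1, i2]
    have hz : ⟪φ t, F t (radialTruncation R (φ t))⟫_ℂ +
        ⟪F t (radialTruncation R (φ t)), φ t⟫_ℂ = 0 := by
      rw [← inner_conj_symm (F t (radialTruncation R (φ t))) (φ t), Complex.add_conj, key]
      simp
    exact hz ▸ h
  have hconst := constant_of_derivWithin_zero
    (fun t ht => (hinner t ht).differentiableWithinAt) fun t ht =>
      (hinner t (Ico_subset_Icc_self ht)).derivWithin
        (uniqueDiffOn_Icc (ht.1.trans_lt ht.2) t (Ico_subset_Icc_self ht))
  have hnorm : ∀ t ∈ Icc 0 T, ‖φ t‖ = ‖x‖ := fun t ht => by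
    have h := hconst t ht
    change φ 0 = x at hφ0
    rw [inner_self_eq_norm_sq_to_K, inner_self_eq_norm_sq_to_K, hφ0] at h
    exact (sq_eq_sq₀ (norm_nonneg _) (norm_nonneg _)).1 (by exact_mod_cast h)
  refine ⟨φ, hφ0, hnorm, fun t ht => ?_⟩
  have h := hφ t ht
  rw [radialTruncation_of_norm_le hR0 (by rw [hnorm t ht, hR]; linarith)] at h
  exact h

/-- `J* B = J* H J` is the bounded self-adjoint substitute for `H` in the approximation of
solutions. -/
theorem IsRegularizer.isSelfAdjoint_adjoint_comp [CompleteSpace E] {H : E →ₗ.[ℂ] E}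
    {J B : E →L[ℂ] E} (h : IsRegularizer H J B) : IsSelfAdjoint (J.adjoint.comp B) := by
  rw [ContinuousLinearMap.isSelfAdjoint_iff', ContinuousLinearMap.adjoint_comp,
    ContinuousLinearMap.adjoint_adjoint]
  ext y
  refine ext_inner_left ℂ fun x => ?_
  simp only [ContinuousLinearMap.comp_apply, ContinuousLinearMap.adjoint_inner_right, h.symm]

/-- The weak form of the equation for bounded generators and continuous controls. -/
theorem inner_eq_of_hasDerivWithinAt [CompleteSpace E] {A B : E →L[ℂ] E} (hA : IsSelfAdjoint A)
    (hB : IsSelfAdjoint B) {T : ℝ} {g : ℝ → ℝ} (hg : Continuous g) {φ : ℝ → E}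
    (hφ : ∀ t ∈ Icc 0 T,
      HasDerivWithinAt φ (-Complex.I • (A (φ t) - (g t : ℂ) • B (φ t))) (Icc 0 T) t)
    {t : ℝ} (ht : t ∈ Icc 0 T) (v : E) :
    ⟪v, φ t⟫_ℂ = ⟪v, φ 0⟫_ℂ -
      Complex.I * ∫ s in (0 : ℝ)..t, (⟪A v, φ s⟫_ℂ - (g s : ℂ) * ⟪B v, φ s⟫_ℂ) := by
  have h0 : (0 : ℝ) ∈ Icc 0 T := ⟨le_rfl, ht.1.trans ht.2⟩
  have hsub : uIcc 0 t ⊆ Icc 0 T := uIcc_subset_Icc h0 ht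
  have hc : ContinuousOn φ (Icc 0 T) := fun t ht => (hφ t ht).continuousWithinAt
  have hself : ∀ {S : E →L[ℂ] E}, IsSelfAdjoint S → ∀ x y, ⟪x, S y⟫_ℂ = ⟪S x, y⟫_ℂ := by
    intro S hS x y
    conv_rhs => rw [← ContinuousLinearMap.isSelfAdjoint_iff'.1 hS]
    rw [ContinuousLinearMap.adjoint_inner_left]
  have hd : ∀ s ∈ Icc 0 T, HasDerivWithinAt (fun s => ⟪v, φ s⟫_ℂ)
      (-Complex.I * (⟪A v, φ s⟫_ℂ - (g s : ℂ) * ⟪B v, φ s⟫_ℂ)) (Icc 0 T) s := fun s hs => by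
    have h := (hasDerivWithinAt_const s (Icc 0 T) v).inner ℂ (hφ s hs)
    rw [inner_zero_left, add_zero, inner_smul_right, inner_sub_right, inner_smul_right, hself hA,
      hself hB] at h
    exact h
  have hftc := intervalIntegral.integral_eq_sub_of_hasDeriv_right
    (a := 0) (b := t) (f := fun s => ⟪v, φ s⟫_ℂ)
    (f' := fun s => -Complex.I * (⟪A v, φ s⟫_ℂ - (g s : ℂ) * ⟪B v, φ s⟫_ℂ))
    (continuousOn_const.inner (hc.mono hsub))
    (fun s hs => by
      rw [min_eq_left ht.1, max_eq_right ht.1] at hs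
      have hs' : s ∈ Ioo 0 T := ⟨hs.1, hs.2.trans_le ht.2⟩
      exact ((hd s (Ioo_subset_Icc_self hs')).hasDerivAt
        (Icc_mem_nhds hs'.1 hs'.2)).hasDerivWithinAt)
    (ContinuousOn.intervalIntegrable (continuousOn_const.mul
      ((continuousOn_const.inner (hc.mono hsub)).sub
        ((Complex.continuous_ofReal.comp hg).continuousOn.mul
          (continuousOn_const.inner (hc.mono hsub))))))
  rw [intervalIntegral.integral_const_mul] at hftc
  linear_combination -hftc

/-- Existence of the state driven by an arbitrary control. -/
theorem exists_isState [CompleteSpace E] {H : E →ₗ.[ℂ] E} (hH : IsSelfAdjoint H) {μ : E →L[ℂ] E}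
    (hμ : IsSelfAdjoint μ) {T : ℝ} (hT : 0 ≤ T) (a : Control T) (x : E) :
    ∃ φ : ℝ → E, IsState H μ x a φ := by
  obtain ⟨J, B, hJ, hJadj, hlim, hlimadj⟩ := exists_seq_regularizer hH
  have happrox : ∀ n : ℕ, ∃ g : BoundedContinuousFunction ℝ ℝ,
      dist a (BoundedContinuousFunction.toLp 2 (volume.restrict (Icc 0 T)) ℝ g) <
        1 / ((n : ℝ) + 1) := fun n =>
    (BoundedContinuousFunction.toLp_denseRange (p := 2) ℝ _ ℝ ENNReal.ofNat_ne_top).exists_dist_lt a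
      (by positivity)
  choose g hg using happrox
  let b : ℕ → Control T := fun n =>
    BoundedContinuousFunction.toLp 2 (volume.restrict (Icc 0 T)) ℝ (g n)
  have hb : Tendsto b atTop (𝓝 a) := by
    rw [tendsto_iff_dist_tendsto_zero]
    refine squeeze_zero (fun _ => dist_nonneg) (fun n => ?_)
      (tendsto_one_div_add_atTop_nhds_zero_nat (𝕜 := ℝ))
    rw [dist_comm]; exact (hg n).le
  have hbdd : ∀ n, ‖b n‖ ≤ ‖a‖ + 1 := fun n => by
    have h1 := hg n
    have h2 : 1 / ((n : ℝ) + 1) ≤ 1 := by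
      rw [div_le_one (by positivity)]; linarith [Nat.cast_nonneg (α := ℝ) n]
    rw [dist_eq_norm] at h1
    have h3 := norm_sub_norm_le (b n) a
    rw [norm_sub_rev] at h3
    have h4 : ‖a - b n‖ < 1 / ((n : ℝ) + 1) := h1
    linarith
  choose φ hφ0 hφn hφd using fun n => exists_solution_of_bounded
    (hJ n).isSelfAdjoint_adjoint_comp hμ hT (g n).continuous x
  let l : Ultrafilter ℕ := hyperfilter ℕ
  have hl : (l : Filter ℕ) ≤ atTop := Nat.hyperfilter_le_atTop
  -- On the domain `J* B v = J* J (H v)`, and both factors are contractions tending strongly to the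
  -- identity.
  have hstrong : ∀ v : H.domain,
      Tendsto (fun n => ((J n).adjoint.comp (B n)) v) l (𝓝 (H v)) := fun v => by
    refine Tendsto.mono_left ?_ hl
    have h1 : ∀ n, ((J n).adjoint.comp (B n)) v =
        (J n).adjoint (J n (H v) - H v) + (J n).adjoint (H v) := fun n => by
      rw [ContinuousLinearMap.comp_apply, (hJ n).comm v, ← map_add, sub_add_cancel]
    simp only [h1]
    have h2 : Tendsto (fun n => (J n).adjoint (J n (H v) - H v)) atTop (𝓝 0) :=
      squeeze_zero_norm (fun n => hJadj n _)
        ((tendsto_iff_norm_sub_tendsto_zero.1 (hlim (H v))))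
    simpa using h2.add (hlimadj (H v))
  have heq : ∀ n, ∀ t ∈ Icc (0 : ℝ) T, ∀ v : H.domain, ⟪(v : E), φ n t⟫_ℂ = ⟪(v : E), φ n 0⟫_ℂ -
      Complex.I * ∫ s in (0 : ℝ)..t, (⟪((J n).adjoint.comp (B n)) v, φ n s⟫_ℂ -
        (b n s : ℂ) * ⟪μ (v : E), φ n s⟫_ℂ) := fun n t ht v => by
    rw [inner_eq_of_hasDerivWithinAt (hJ n).isSelfAdjoint_adjoint_comp hμ (g n).continuous
      (hφd n) ht (v : E)]
    congr 2
    refine intervalIntegral.integral_congr_ae ?_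
    have h := BoundedContinuousFunction.coeFn_toLp 2 (volume.restrict (Icc 0 T)) ℝ (g n)
    have hsub : uIoc 0 t ⊆ Icc 0 T := by
      rw [uIoc_of_le ht.1]; exact Ioc_subset_Icc_self.trans (Icc_subset_Icc_right ht.2)
    have h' := (ae_restrict_iff' measurableSet_uIoc).1
      (ae_restrict_of_ae_restrict_of_subset hsub h)
    filter_upwards [h'] with s hs hst
    rw [hs hst]
  obtain ⟨ψ, hψ, hψlim⟩ := exists_limit_solution (T := T) hH hμ l
    (h := fun n v => ((J n).adjoint.comp (B n)) v) (a := b) (e := a) (A := ‖a‖ + 1) (φ := φ)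
    (C := ‖x‖) hstrong hbdd (fun f => tendsto_const_nhds.inner (hb.mono_left hl))
    (fun n t ht => (hφn n t ht).le)
    (fun n u => continuousOn_const.inner fun t ht => (hφd n t ht).continuousWithinAt)
    heq
  refine ⟨ψ, hψ, ext_inner_left ℂ fun u => ?_⟩
  have h := (hψlim u).tendsto_at (⟨le_rfl, hT⟩ : (0 : ℝ) ∈ Icc 0 T)
  simp only [hφ0] at h
  exact tendsto_nhds_unique h tendsto_const_nhds |>.symm ▸ rfl

/-! ### Uniqueness and dependence on the control -/

/-- A nonnegative version of Grönwall's lemma. -/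
theorem eq_zero_of_le_integral {T C : ℝ} {u : ℝ → ℝ} (hu : ContinuousOn u (Icc 0 T))
    (h0 : ∀ t ∈ Icc 0 T, 0 ≤ u t) (h : ∀ t ∈ Icc 0 T, u t ≤ C * ∫ s in (0 : ℝ)..t, u s) :
    ∀ t ∈ Icc 0 T, u t = 0 := by
  intro t ht
  have hT : 0 ≤ T := ht.1.trans ht.2
  -- Clamping the argument makes the integrand continuous on all of `ℝ`, so that its primitive is
  -- differentiable everywhere, endpoints included.
  let U : ℝ → ℝ := fun t => u (max 0 (min t T))
  have hU : Continuous U := hu.comp_continuous (by fun_prop)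
    fun t => ⟨le_max_left _ _, max_le hT (min_le_right _ _)⟩
  have hUu : ∀ t ∈ Icc 0 T, U t = u t := fun t ht => by
    simp only [U]; rw [min_eq_left ht.2, max_eq_right ht.1]
  have hint : ∀ t ∈ Icc 0 T, ∫ s in (0 : ℝ)..t, U s = ∫ s in (0 : ℝ)..t, u s := fun t ht =>
    intervalIntegral.integral_congr fun s hs => by
      rw [uIcc_of_le ht.1] at hs; exact hUu s ⟨hs.1, hs.2.trans ht.2⟩
  have hG := eq_zero_of_abs_deriv_le_mul_abs_self_of_eq_zero_right (K := C) (a := 0) (b := T)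
    (f := fun t => ∫ s in (0 : ℝ)..t, U s) (f' := U)
    (fun t _ => (hU.integral_hasStrictDerivAt 0 t).hasDerivAt.continuousAt.continuousWithinAt)
    (fun t _ => (hU.integral_hasStrictDerivAt 0 t).hasDerivAt.hasDerivWithinAt)
    intervalIntegral.integral_same (fun t ht => by
      have ht' := Ico_subset_Icc_self ht
      have hnn : 0 ≤ ∫ s in (0 : ℝ)..t, u s := intervalIntegral.integral_nonneg ht.1
        fun s hs => h0 s ⟨hs.1, hs.2.trans ht'.2⟩
      rw [hUu t ht', hint t ht', Real.norm_of_nonneg (h0 t ht'), Real.norm_of_nonneg hnn]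
      exact h t ht')
  have h1 := h t ht
  rw [← hint t ht, hG t ht, mul_zero] at h1
  exact le_antisymm h1 (h0 t ht)

theorem eq_zero_of_le_integral_right {T C : ℝ} {u : ℝ → ℝ} (hu : ContinuousOn u (Icc 0 T))
    (h0 : ∀ t ∈ Icc 0 T, 0 ≤ u t) (h : ∀ t ∈ Icc 0 T, u t ≤ C * ∫ s in t..T, u s) :
    ∀ t ∈ Icc 0 T, u t = 0 := by
  have hmem : ∀ t ∈ Icc 0 T, T - t ∈ Icc 0 T := fun t ht =>
    ⟨sub_nonneg.2 ht.2, sub_le_self _ ht.1⟩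
  intro t ht
  have := eq_zero_of_le_integral (u := fun t => u (T - t)) (C := C)
    (hu.comp (by fun_prop) hmem) (fun t ht => h0 _ (hmem t ht)) (fun t ht => by
      rw [intervalIntegral.integral_comp_sub_left (fun s => u s), sub_zero]
      exact h _ (hmem t ht)) (T - t) (hmem t ht)
  simpa using this

section
variable [CompleteSpace E] {T : ℝ} {H : E →ₗ.[ℂ] E} {μ : E →L[ℂ] E} {a b : Control T} {φ ψ χ : ℝ → E}

omit [CompleteSpace E] in
theorem continuousOn_im_inner (hχ : ContinuousOn χ (Icc 0 T)) (hψ : ContinuousOn ψ (Icc 0 T)) :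
    ContinuousOn (fun t => (⟪χ t, μ (ψ t)⟫_ℂ).im) (Icc 0 T) :=
  Complex.continuous_im.comp_continuousOn (hχ.inner (μ.continuous.comp_continuousOn hψ))

theorem intervalIntegrable_control_mul (a : Control T) {f : ℝ → ℝ} (hf : ContinuousOn f (Icc 0 T))
    {s t : ℝ} (hs : s ∈ Icc 0 T) (ht : t ∈ Icc 0 T) :
    IntervalIntegrable (fun r => a r * f r) volume s t :=
  (((control_integrableOn a).mul_continuousOn hf isCompact_Icc).mono_set
    (uIcc_subset_Icc hs ht)).intervalIntegrable

/-- Real part of Green's formula between two times. -/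
theorem re_inner_eq (hH : IsSelfAdjoint H) (hμ : IsSelfAdjoint μ)
    (hχ : IsSchrodingerSolution H μ b χ) (hφ : IsSchrodingerSolution H μ a φ) {s t : ℝ}
    (hs : s ∈ Icc 0 T) (ht : t ∈ Icc 0 T) :
    (⟪χ t, φ t⟫_ℂ).re = (⟪χ s, φ s⟫_ℂ).re -
      ∫ r in s..t, (a r - b r) * (⟪χ r, μ (φ r)⟫_ℂ).im := by
  have h0 : (0 : ℝ) ∈ Icc 0 T := ⟨le_rfl, hs.1.trans hs.2⟩
  have hc : ContinuousOn (fun r => ⟪χ r, μ (φ r)⟫_ℂ) (Icc 0 T) :=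
    hχ.1.inner (μ.continuous.comp_continuousOn hφ.1)
  have hint : ∀ {p q}, p ∈ Icc 0 T → q ∈ Icc 0 T → IntervalIntegrable
      (fun r => (a r - b r) * (⟪χ r, μ (φ r)⟫_ℂ).im) volume p q := fun hp hq => by
    simpa only [sub_mul] using
      (intervalIntegrable_control_mul a (continuousOn_im_inner hχ.1 hφ.1) hp hq).sub
        (intervalIntegrable_control_mul b (continuousOn_im_inner hχ.1 hφ.1) hp hq)
  have key : ∀ t ∈ Icc 0 T, (⟪χ t, φ t⟫_ℂ).re = (⟪χ 0, φ 0⟫_ℂ).re -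
      ∫ r in (0 : ℝ)..t, (a r - b r) * (⟪χ r, μ (φ r)⟫_ℂ).im := fun t ht => by
    rw [hχ.isWeakSolution.inner_eq hH hμ hφ.isWeakSolution ht, Complex.add_re, sub_eq_add_neg,
      ← intervalIntegral.integral_neg]
    congr 1
    have hi : IntervalIntegrable (fun s => Complex.I * (((a s - b s : ℝ) : ℂ) * ⟪χ s, μ (φ s)⟫_ℂ))
        volume 0 t := by
      refine IntervalIntegrable.const_mul ?_ _
      have := ((integrableOn_control_mul a hc).sub (integrableOn_control_mul b hc)).mono_set
        (uIcc_subset_Icc h0 ht)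
      refine IntegrableOn.intervalIntegrable (this.congr (ae_of_all _ fun r => ?_))
      simp [sub_mul]
    have := Complex.reCLM.intervalIntegral_comp_comm hi
    simp only [Complex.reCLM_apply] at this
    rw [← this]
    congr 1
    ext r
    simp
  rw [key t ht, key s hs, ← intervalIntegral.integral_add_adjacent_intervals (hint h0 hs)
    (hint hs ht)]
  ring

/-- The norms are conserved, so only `Re ⟪ψ, φ⟫` varies. Since `⟪ψ, μ ψ⟫` is real, `φ` may be
replaced by `φ - ψ` in the integrand; this extra small factor drives both the Lipschitz estimate and
uniqueness. -/
theorem norm_sub_sq_eq (hH : IsSelfAdjoint H) (hμ : IsSelfAdjoint μ)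
    (hφ : IsSchrodingerSolution H μ a φ) (hψ : IsSchrodingerSolution H μ b ψ) {s t : ℝ}
    (hs : s ∈ Icc 0 T) (ht : t ∈ Icc 0 T) :
    ‖φ t - ψ t‖ ^ 2 = ‖φ s - ψ s‖ ^ 2 +
      2 * ∫ r in s..t, (a r - b r) * (⟪ψ r, μ (φ r - ψ r)⟫_ℂ).im := by
  have h1 := re_inner_eq hH hμ hψ hφ hs ht
  have h2 : ∀ r, (⟪ψ r, μ (φ r - ψ r)⟫_ℂ).im = (⟪ψ r, μ (φ r)⟫_ℂ).im := fun r => by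
    rw [map_sub, inner_sub_right, Complex.sub_im, inner_self_map_im hμ, sub_zero]
  have h3 : ∀ r, ‖φ r - ψ r‖ ^ 2 = ‖φ r‖ ^ 2 - 2 * (⟪ψ r, φ r⟫_ℂ).re + ‖ψ r‖ ^ 2 := fun r => by
    rw [@norm_sub_sq ℂ, inner_re_symm, RCLike.re_to_complex]
  simp only [h2]
  rw [h3, h3, h1, hφ.isWeakSolution.norm_eq hH hμ hs ht, hψ.isWeakSolution.norm_eq hH hμ hs ht]
  ring

omit [CompleteSpace E] in
theorem abs_im_inner_map_le (x y : E) : |(⟪x, μ y⟫_ℂ).im| ≤ ‖x‖ * (‖μ‖ * ‖y‖) :=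
  (Complex.abs_im_le_norm _).trans ((norm_inner_le_norm _ _).trans
    (mul_le_mul_of_nonneg_left (μ.le_opNorm y) (norm_nonneg _)))

/-- Lipschitz dependence of the state on the control. -/
theorem norm_sub_le_of_controls (hH : IsSelfAdjoint H) (hμ : IsSelfAdjoint μ)
    (hφ : IsSchrodingerSolution H μ a φ) (hψ : IsSchrodingerSolution H μ b ψ) (h0 : φ 0 = ψ 0)
    {t : ℝ} (ht : t ∈ Icc 0 T) :
    ‖φ t - ψ t‖ ≤ 2 * (‖ψ 0‖ * ‖μ‖ * Real.sqrt T) * ‖a - b‖ := by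
  have hz : (0 : ℝ) ∈ Icc 0 T := ⟨le_rfl, ht.1.trans ht.2⟩
  -- At a time where the difference is maximal, equal to `M`, the identity reads `M² ≤ const * ‖a -
  -- b‖ * M`, and one factor `M` cancels.
  obtain ⟨m, hm, hmax⟩ := isCompact_Icc.exists_isMaxOn ⟨t, ht⟩ (hφ.1.sub hψ.1).norm
  have hmax' : ∀ r ∈ Icc 0 T, ‖φ r - ψ r‖ ≤ ‖φ m - ψ m‖ := fun r hr => hmax hr
  refine (hmax' t ht).trans ?_
  set M := ‖φ m - ψ m‖ with hM
  have hsq := norm_sub_sq_eq hH hμ hφ hψ hz hm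
  have hsub : uIoc 0 m ⊆ Icc 0 T := uIoc_subset_uIcc.trans (uIcc_subset_Icc hz hm)
  have hae : ∀ᵐ r ∂volume.restrict (uIoc 0 m), (a - b : Control T) r = a r - b r :=
    ae_restrict_of_ae_restrict_of_subset hsub (Lp.coeFn_sub a b)
  have hb := intervalIntegral.norm_integral_le_abs_of_norm_le (a := 0) (b := m) (μ := volume)
    (f := fun r => (a r - b r) * (⟪ψ r, μ (φ r - ψ r)⟫_ℂ).im)
    (g := fun r => |(a - b : Control T) r| * (‖ψ 0‖ * (‖μ‖ * M))) (by
      filter_upwards [hae, ae_restrict_mem measurableSet_uIoc] with r hr hrm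
      rw [hr, Real.norm_eq_abs, abs_mul]
      refine mul_le_mul_of_nonneg_left ((abs_im_inner_map_le _ _).trans ?_) (abs_nonneg _)
      rw [hψ.isWeakSolution.norm_eq hH hμ hz (hsub hrm)]
      gcongr
      exact hmax' r (hsub hrm))
    ((control_intervalIntegrable (a - b) hz hm).abs.mul_const _)
  have hc := intervalIntegral_abs_control_le (a - b) hz hm
  rw [intervalIntegral.integral_mul_const, abs_mul, abs_of_nonneg
    (by positivity : 0 ≤ ‖ψ 0‖ * (‖μ‖ * M))] at hb
  have hroot : Real.sqrt |m - 0| ≤ Real.sqrt T := by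
    rw [sub_zero, abs_of_nonneg hm.1]; exact Real.sqrt_le_sqrt hm.2
  rw [h0, sub_self, norm_zero] at hsq
  have h1 : M ^ 2 ≤ (2 * (‖ψ 0‖ * ‖μ‖ * Real.sqrt T) * ‖a - b‖) * M := by
    rw [hsq]
    have h2 := le_abs_self (∫ r in (0 : ℝ)..m, (a r - b r) * (⟪ψ r, μ (φ r - ψ r)⟫_ℂ).im)
    have h3 : |(∫ r in (0 : ℝ)..m, |(a - b : Control T) r|)| * (‖ψ 0‖ * (‖μ‖ * M)) ≤
        (‖a - b‖ * Real.sqrt T) * (‖ψ 0‖ * (‖μ‖ * M)) := by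
      refine mul_le_mul_of_nonneg_right (hc.trans ?_) (by positivity)
      gcongr
    rw [Real.norm_eq_abs] at hb
    nlinarith
  rcases (norm_nonneg (φ m - ψ m)).eq_or_lt with h | h
  · rw [hM, ← h]; positivity
  · exact le_of_mul_le_mul_right (by rw [← pow_two]; exact h1) h

/-- Two solutions whose controls differ by at most a multiple of their distance (as for feedback
controls) coincide if they coincide at the initial or the final time. -/
theorem eqOn_of_feedback (hH : IsSelfAdjoint H) (hμ : IsSelfAdjoint μ)
    (hφ : IsSchrodingerSolution H μ a φ) (hψ : IsSchrodingerSolution H μ b ψ) {K : ℝ}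
    (hK : ∀ᵐ r ∂volume.restrict (Icc 0 T), |a r - b r| ≤ K * ‖φ r - ψ r‖) {t₀ : ℝ}
    (ht₀ : t₀ = 0 ∨ t₀ = T) (h : φ t₀ = ψ t₀) : EqOn φ ψ (Icc 0 T) := by
  intro t ht
  have hT : 0 ≤ T := ht.1.trans ht.2
  have hz : (0 : ℝ) ∈ Icc 0 T := ⟨le_rfl, hT⟩
  have ht₀' : t₀ ∈ Icc 0 T := by
    rcases ht₀ with rfl | rfl
    exacts [hz, ⟨hT, le_rfl⟩]
  have hc : ContinuousOn (fun t => ‖φ t - ψ t‖ ^ 2) (Icc 0 T) := (hφ.1.sub hψ.1).norm.pow 2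
  set C := 2 * (|K| * (‖ψ 0‖ * ‖μ‖)) with hC
  -- The hypothesis on the controls makes the integrand quadratic in the difference, so Grönwall
  -- applies to its square.
  have key : ∀ t ∈ Icc 0 T, ‖φ t - ψ t‖ ^ 2 ≤ C * |∫ r in t₀..t, ‖φ r - ψ r‖ ^ 2| := by
    intro t ht
    have hsub : uIoc t₀ t ⊆ Icc 0 T := uIoc_subset_uIcc.trans (uIcc_subset_Icc ht₀' ht)
    have hb := intervalIntegral.norm_integral_le_abs_of_norm_le (a := t₀) (b := t) (μ := volume)
      (f := fun r => (a r - b r) * (⟪ψ r, μ (φ r - ψ r)⟫_ℂ).im)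
      (g := fun r => K * (‖ψ 0‖ * ‖μ‖) * ‖φ r - ψ r‖ ^ 2) (by
        filter_upwards [ae_restrict_of_ae_restrict_of_subset hsub hK,
          ae_restrict_mem measurableSet_uIoc] with r hr hrm
        rw [Real.norm_eq_abs, abs_mul]
        have h1 := abs_im_inner_map_le (μ := μ) (ψ r) (φ r - ψ r)
        rw [hψ.isWeakSolution.norm_eq hH hμ hz (hsub hrm)] at h1
        calc _ ≤ K * ‖φ r - ψ r‖ * (‖ψ 0‖ * (‖μ‖ * ‖φ r - ψ r‖)) :=
              mul_le_mul hr h1 (abs_nonneg _) ((abs_nonneg _).trans hr)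
          _ = _ := by ring)
      ((hc.mono (uIcc_subset_Icc ht₀' ht)).intervalIntegrable.const_mul _)
    rw [norm_sub_sq_eq hH hμ hφ hψ ht₀' ht, h, sub_self, norm_zero]
    rw [intervalIntegral.integral_const_mul, Real.norm_eq_abs] at hb
    have h2 := le_abs_self (∫ r in t₀..t, (a r - b r) * (⟪ψ r, μ (φ r - ψ r)⟫_ℂ).im)
    have h3 : |K * (‖ψ 0‖ * ‖μ‖) * ∫ r in t₀..t, ‖φ r - ψ r‖ ^ 2| ≤
        |K| * (‖ψ 0‖ * ‖μ‖) * |∫ r in t₀..t, ‖φ r - ψ r‖ ^ 2| := by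
      rw [abs_mul, abs_mul, abs_of_nonneg (by positivity : 0 ≤ ‖ψ 0‖ * ‖μ‖)]
    rw [hC]
    nlinarith
  have hzero : ∀ t ∈ Icc 0 T, ‖φ t - ψ t‖ ^ 2 = 0 := by
    rcases ht₀ with rfl | rfl
    · refine eq_zero_of_le_integral (C := C) hc (fun _ _ => by positivity) fun t ht => ?_
      have := key t ht
      rwa [abs_of_nonneg (intervalIntegral.integral_nonneg ht.1 fun _ _ => by positivity)] at this
    · refine eq_zero_of_le_integral_right (C := C) hc (fun _ _ => by positivity) fun t ht => ?_
      have := key t ht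
      rwa [intervalIntegral.integral_symm, abs_neg, abs_of_nonneg
        (intervalIntegral.integral_nonneg ht.2 fun _ _ => by positivity)] at this
  simpa [sub_eq_zero] using hzero t ht

end

/-! ### The pairing and the variation of the cost -/

open scoped Classical in
/-- The function `t ↦ Im ⟨χ(t)|μ|ψ(t)⟩` as an element of `L²([0,T])`. -/
def pairing (T : ℝ) (μ : E →L[ℂ] E) (χ ψ : ℝ → E) : Control T :=
  if h : MemLp (fun t => (⟪χ t, μ (ψ t)⟫_ℂ).im) 2 (volume.restrict (Icc 0 T)) then h.toLp else 0

section
variable {T : ℝ} {H : E →ₗ.[ℂ] E} {μ O : E →L[ℂ] E} {a a' b e : Control T}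
  {φ ψ ψ' χ χ' : ℝ → E} {ψ₀ : E} {α : ℝ}

theorem pairing_ae_eq (hχ : ContinuousOn χ (Icc 0 T)) (hψ : ContinuousOn ψ (Icc 0 T)) :
    pairing T μ χ ψ =ᵐ[volume.restrict (Icc 0 T)] fun t => (⟪χ t, μ (ψ t)⟫_ℂ).im := by
  have h := memLp_of_continuousOn (continuousOn_im_inner (μ := μ) hχ hψ)
  rw [pairing, dif_pos h]
  exact h.coeFn_toLp

theorem norm_control_le (hT : 0 ≤ T) {a : Control T} {C : ℝ} (hC : 0 ≤ C)
    (h : ∀ᵐ t ∂volume.restrict (Icc 0 T), |a t| ≤ C) : ‖a‖ ≤ Real.sqrt T * C := by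
  have := Lp.norm_le_of_ae_bound hC (f := a) (by simpa [Real.norm_eq_abs] using h)
  simpa [Real.sqrt_eq_rpow, measureUnivNNReal, Real.coe_toNNReal T hT, ENNReal.ofReal] using this

theorem norm_pairing_sub_le (hT : 0 ≤ T) (hχ : ContinuousOn χ (Icc 0 T))
    (hψ : ContinuousOn ψ (Icc 0 T))
    (hχ' : ContinuousOn χ' (Icc 0 T)) (hψ' : ContinuousOn ψ' (Icc 0 T)) {C : ℝ}
    (h : ∀ t ∈ Icc 0 T, ‖⟪χ t, μ (ψ t)⟫_ℂ - ⟪χ' t, μ (ψ' t)⟫_ℂ‖ ≤ C) :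
    ‖pairing T μ χ ψ - pairing T μ χ' ψ'‖ ≤ Real.sqrt T * C := by
  refine norm_control_le hT ((norm_nonneg _).trans (h 0 ⟨le_rfl, hT⟩)) ?_
  filter_upwards [Lp.coeFn_sub (pairing T μ χ ψ) (pairing T μ χ' ψ'), pairing_ae_eq (μ := μ) hχ hψ,
    pairing_ae_eq (μ := μ) hχ' hψ', ae_restrict_mem measurableSet_Icc] with t h1 h2 h3 ht
  rw [h1, Pi.sub_apply, h2, h3, ← Complex.sub_im]
  exact (Complex.abs_im_le_norm _).trans (h t ht)

theorem norm_pairing_le (hT : 0 ≤ T) (hχ : ContinuousOn χ (Icc 0 T))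
    (hψ : ContinuousOn ψ (Icc 0 T)) {C D : ℝ} (hC : ∀ t ∈ Icc 0 T, ‖χ t‖ ≤ C)
    (hD : ∀ t ∈ Icc 0 T, ‖ψ t‖ ≤ D) :
    ‖pairing T μ χ ψ‖ ≤ Real.sqrt T * (C * (‖μ‖ * D)) := by
  have h0 : (0 : ℝ) ∈ Icc 0 T := ⟨le_rfl, hT⟩
  have hC0 : 0 ≤ C := (norm_nonneg _).trans (hC 0 h0)
  have hD0 : 0 ≤ D := (norm_nonneg _).trans (hD 0 h0)
  refine norm_control_le hT (by positivity) ?_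
  filter_upwards [pairing_ae_eq (μ := μ) hχ hψ, ae_restrict_mem measurableSet_Icc] with t h1 ht
  rw [h1]
  refine (abs_im_inner_map_le _ _).trans ?_
  gcongr
  exacts [hC t ht, hD t ht]

theorem inner_pairing (hT : 0 ≤ T) (hχ : ContinuousOn χ (Icc 0 T)) (hψ : ContinuousOn ψ (Icc 0 T))
    (c : Control T) :
    ⟪c, pairing T μ χ ψ⟫_ℝ = ∫ s in (0 : ℝ)..T, c s * (⟪χ s, μ (ψ s)⟫_ℂ).im := by
  rw [L2.inner_def, intervalIntegral.integral_of_le hT, ← integral_Icc_eq_integral_Ioc]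
  refine integral_congr_ae ?_
  filter_upwards [pairing_ae_eq (μ := μ) hχ hψ] with t ht
  rw [ht]
  simp [mul_comm]

variable [CompleteSpace E]

theorem re_inner_final_eq (hH : IsSelfAdjoint H) (hμ : IsSelfAdjoint μ) (hT : 0 ≤ T)
    (hχ : IsSchrodingerSolution H μ b χ) (hφ : IsSchrodingerSolution H μ a φ) :
    (⟪χ T, φ T⟫_ℂ).re = (⟪χ 0, φ 0⟫_ℂ).re - ⟪a - b, pairing T μ χ φ⟫_ℝ := by
  rw [re_inner_eq hH hμ hχ hφ ⟨le_rfl, hT⟩ ⟨hT, le_rfl⟩, inner_pairing hT hχ.1 hφ.1]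
  congr 1
  rw [intervalIntegral.integral_of_le hT, intervalIntegral.integral_of_le hT,
    ← integral_Icc_eq_integral_Ioc, ← integral_Icc_eq_integral_Ioc]
  refine integral_congr_ae ?_
  filter_upwards [Lp.coeFn_sub a b] with t ht
  rw [ht, Pi.sub_apply]

theorem IsState.eqOn (hH : IsSelfAdjoint H) (hμ : IsSelfAdjoint μ)
    (hφ : IsState H μ ψ₀ a φ) (hψ : IsState H μ ψ₀ a ψ) : EqOn φ ψ (Icc 0 T) :=
  eqOn_of_feedback hH hμ hφ.1 hψ.1 (K := 0) (by simp) (Or.inl rfl) (hφ.2.trans hψ.2.symm)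

/-- By uniqueness on `[0,T]`, the state selected by `Classical.epsilon` may be replaced by any given
one. -/
theorem cost_eq (hH : IsSelfAdjoint H) (hμ : IsSelfAdjoint μ) (hT : 0 ≤ T)
    (hφ : IsState H μ ψ₀ a φ) :
    cost H μ O ψ₀ α a = (⟪φ T, O (φ T)⟫_ℂ).re - α * ‖a‖ ^ 2 := by
  have h : IsState H μ ψ₀ a (state H μ ψ₀ a) := Classical.epsilon_spec ⟨φ, hφ⟩
  rw [cost, h.eqOn hH hμ hφ ⟨hT, le_rfl⟩, integral_sq_control hT]

/-- The variation of the cost functional, in terms of any adjoint state. -/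
theorem cost_sub_cost (hH : IsSelfAdjoint H) (hμ : IsSelfAdjoint μ) (hO : O.IsPositive)
    (hT : 0 ≤ T) (hψ : IsState H μ ψ₀ a ψ) (hψ' : IsState H μ ψ₀ a' ψ')
    (hχ : IsAdjointState H μ O b ψ χ) :
    cost H μ O ψ₀ α a' - cost H μ O ψ₀ α a =
      (⟪ψ' T - ψ T, O (ψ' T - ψ T)⟫_ℂ).re - 2 * ⟪a' - b, pairing T μ χ ψ'⟫_ℝ +
        2 * ⟪a - b, pairing T μ χ ψ⟫_ℝ - α * ‖a'‖ ^ 2 + α * ‖a‖ ^ 2 := by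
  -- Both states start from `ψ₀`, so subtracting the two Green formulas against `χ` cancels the
  -- values at time `0` and leaves `Re ⟪O (ψ T), ψ' T - ψ T⟫`, the linear part of the quadratic
  -- form.
  have h1 := re_inner_final_eq hH hμ hT hχ.1 hψ.1
  have h2 := re_inner_final_eq hH hμ hT hχ.1 hψ'.1
  rw [hψ.2] at h1
  rw [hψ'.2] at h2
  rw [hχ.2] at h1 h2
  have hsymm : ∀ x y, ⟪O x, y⟫_ℂ = ⟪x, O y⟫_ℂ := fun x y => hO.isSymmetric x y
  have h3 : (⟪ψ' T, O (ψ T)⟫_ℂ).re = (⟪O (ψ T), ψ' T⟫_ℂ).re := by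
    rw [← inner_conj_symm, Complex.conj_re]
  rw [cost_eq hH hμ hT hψ, cost_eq hH hμ hT hψ']
  simp only [map_sub, inner_sub_left, inner_sub_right, Complex.sub_re] at *
  rw [h3]
  rw [hsymm] at *
  linarith

/-- The variation formula is exact. At a solution of the Euler–Lagrange equations its linear part
vanishes, and Lipschitz dependence of the state makes the remainder `O(‖e' - e‖²)`. -/
theorem hasFDerivAt_cost (hH : IsSelfAdjoint H) (hμ : IsSelfAdjoint μ) (hO : O.IsPositive)
    (hT : 0 ≤ T) (h : SolvesEulerLagrange H μ O ψ₀ α e) :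
    HasFDerivAt (cost H μ O ψ₀ α) (0 : Control T →L[ℝ] ℝ) e := by
  obtain ⟨ψ, χ, hψ, hχ, hEL⟩ := h
  have hEL' : α • e = -pairing T μ χ ψ := by
    refine Lp.ext ?_
    filter_upwards [hEL, Lp.coeFn_smul α e, Lp.coeFn_neg (pairing T μ χ ψ),
      pairing_ae_eq (μ := μ) hχ.1.1 hψ.1.1] with t h1 h2 h3 h4
    rw [h2, h3, Pi.neg_apply, h4, Pi.smul_apply, smul_eq_mul, h1]
  set L : ℝ := 2 * (‖ψ₀‖ * ‖μ‖ * Real.sqrt T) with hL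
  have hL0 : 0 ≤ L := by positivity
  set K : ℝ := ‖O‖ * L ^ 2 + 2 * (Real.sqrt T * (‖χ 0‖ * (‖μ‖ * L))) + |α| with hK
  refine HasFDerivAt.of_isLittleO ?_
  have hbound : ∀ e' : Control T,
      ‖cost H μ O ψ₀ α e' - cost H μ O ψ₀ α e‖ ≤ K * ‖e' - e‖ ^ 2 := by
    intro e'
    obtain ⟨φ, hφ⟩ := exists_isState hH hμ hT e' ψ₀
    have hφψ : ∀ t ∈ Icc 0 T, ‖φ t - ψ t‖ ≤ L * ‖e' - e‖ := fun t ht => by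
      have := norm_sub_le_of_controls hH hμ hφ.1 hψ.1 (hφ.2.trans hψ.2.symm) ht
      rwa [hψ.2] at this
    have hP : ‖pairing T μ χ φ - pairing T μ χ ψ‖ ≤
        Real.sqrt T * (‖χ 0‖ * (‖μ‖ * (L * ‖e' - e‖))) := by
      refine norm_pairing_sub_le hT hχ.1.1 hφ.1.1 hχ.1.1 hψ.1.1 fun t ht => ?_
      rw [← inner_sub_right, ← map_sub]
      refine (norm_inner_le_norm _ _).trans ?_
      rw [hχ.1.isWeakSolution.norm_eq hH hμ ⟨le_rfl, hT⟩ ht]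
      exact mul_le_mul_of_nonneg_left (μ.le_opNorm_of_le (hφψ t ht)) (norm_nonneg _)
    -- By Euler–Lagrange, `-2 ⟪e' - e, pairing T μ χ ψ⟫ = 2 α ⟪e' - e, e⟫`, which completes the
    -- penalty terms to `-α ‖e' - e‖²`.
    have heq : cost H μ O ψ₀ α e' - cost H μ O ψ₀ α e =
        (⟪φ T - ψ T, O (φ T - ψ T)⟫_ℂ).re -
          2 * ⟪e' - e, pairing T μ χ φ - pairing T μ χ ψ⟫_ℝ - α * ‖e' - e‖ ^ 2 := by
      have h1 : ⟪e' - e, pairing T μ χ ψ⟫_ℝ = -(α * ⟪e' - e, e⟫_ℝ) := by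
        rw [← neg_eq_iff_eq_neg, ← inner_neg_right, ← hEL', real_inner_smul_right]
      have h2 : ⟪e' - e, e⟫_ℝ = ⟪e', e⟫_ℝ - ‖e‖ ^ 2 := by
        rw [inner_sub_left, real_inner_self_eq_norm_sq]
      rw [cost_sub_cost hH hμ hO hT hψ hφ hχ, sub_self, inner_zero_left,
        inner_sub_right (𝕜 := ℝ) (e' - e), h1, @norm_sub_sq ℝ, h2]
      simp only [RCLike.re_to_real]
      ring
    have b1 : |(⟪φ T - ψ T, O (φ T - ψ T)⟫_ℂ).re| ≤ ‖O‖ * L ^ 2 * ‖e' - e‖ ^ 2 := by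
      refine (Complex.abs_re_le_norm _).trans ((norm_inner_le_norm _ _).trans ?_)
      have h1 := hφψ T ⟨hT, le_rfl⟩
      calc _ ≤ (L * ‖e' - e‖) * (‖O‖ * (L * ‖e' - e‖)) :=
            mul_le_mul h1 (O.le_opNorm_of_le h1) (norm_nonneg _) (by positivity)
        _ = _ := by ring
    have b2 : |⟪e' - e, pairing T μ χ φ - pairing T μ χ ψ⟫_ℝ| ≤
        Real.sqrt T * (‖χ 0‖ * (‖μ‖ * L)) * ‖e' - e‖ ^ 2 := by
      refine (abs_real_inner_le_norm _ _).trans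
        ((mul_le_mul_of_nonneg_left hP (norm_nonneg _)).trans_eq (by ring))
    have b3 : |α * ‖e' - e‖ ^ 2| = |α| * ‖e' - e‖ ^ 2 := by
      rw [abs_mul, abs_of_nonneg (sq_nonneg ‖e' - e‖)]
    rw [heq, Real.norm_eq_abs, hK, add_mul, add_mul]
    refine (abs_sub _ _).trans (add_le_add ((abs_sub _ _).trans (add_le_add b1 ?_)) b3.le)
    rw [abs_mul, abs_two]
    linarith
  have hO2 : (fun e' => cost H μ O ψ₀ α e' - cost H μ O ψ₀ α e) =O[𝓝 e]
      fun e' => ‖e' - e‖ ^ 2 := by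
    refine Asymptotics.IsBigO.of_bound K (Eventually.of_forall fun e' => ?_)
    rw [Real.norm_of_nonneg (by positivity : 0 ≤ ‖e' - e‖ ^ 2)]
    exact hbound e'
  have hlittle : (fun e' : Control T => ‖e' - e‖ ^ 2) =o[𝓝 e] fun e' => e' - e := by
    have h1 : Tendsto (fun e' : Control T => e' - e) (𝓝 e) (𝓝 0) :=
      tendsto_sub_nhds_zero_iff.2 tendsto_id
    exact (Asymptotics.isLittleO_norm_pow_id one_lt_two).comp_tendsto h1
  simpa using hO2.trans_isLittleO hlittle

/-- The increase of the cost functional in one iteration of the scheme. -/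
theorem cost_increment (hH : IsSelfAdjoint H) (hμ : IsSelfAdjoint μ) (hO : O.IsPositive)
    (hT : 0 ≤ T) {δ η : ℝ} (hψ : IsState H μ ψ₀ a ψ) (hψ' : IsState H μ ψ₀ a' ψ')
    (hχ : IsAdjointState H μ O b ψ χ) {p q : Control T} (hp : α • p = -pairing T μ χ ψ)
    (hq : α • q = -pairing T μ χ ψ') (hb : b = (1 - η) • a + η • p)
    (ha' : a' = (1 - δ) • b + δ • q) :
    cost H μ O ψ₀ α a' - cost H μ O ψ₀ α a = (⟪ψ' T - ψ T, O (ψ' T - ψ T)⟫_ℂ).re +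
      α * (η * (2 - η) * ‖a - p‖ ^ 2 + δ * (2 - δ) * ‖b - q‖ ^ 2) := by
  rw [cost_sub_cost hH hμ hO hT hψ hψ' hχ]
  have h1 : ∀ c, ⟪c, pairing T μ χ ψ⟫_ℝ = -(α * ⟪c, p⟫_ℝ) := fun c => by
    rw [← neg_eq_iff_eq_neg, ← inner_neg_right, ← hp, real_inner_smul_right]
  have h2 : ∀ c, ⟪c, pairing T μ χ ψ'⟫_ℝ = -(α * ⟪c, q⟫_ℝ) := fun c => by
    rw [← neg_eq_iff_eq_neg, ← inner_neg_right, ← hq, real_inner_smul_right]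
  -- Substituting `a' = b - δ (b - q)` gives the weight `δ (2 - δ) = 1 - (1 - δ)²`; the step `k2` is
  -- its analogue for `η`.
  have k1 : 2 * ⟪a' - b, q⟫_ℝ - ‖a'‖ ^ 2 + ‖b‖ ^ 2 = δ * (2 - δ) * ‖b - q‖ ^ 2 := by
    have : a' = b - δ • (b - q) := by rw [ha', sub_smul, one_smul, smul_sub]; abel
    rw [this]
    simp only [← real_inner_self_eq_norm_sq, inner_sub_left, inner_sub_right, inner_smul_left,
      inner_smul_right, RCLike.conj_to_real, real_inner_comm b q]
    ring
  have k2 : -2 * ⟪a - b, p⟫_ℝ - ‖b‖ ^ 2 + ‖a‖ ^ 2 = η * (2 - η) * ‖a - p‖ ^ 2 := by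
    have : b = a - η • (a - p) := by rw [hb, sub_smul, one_smul, smul_sub]; abel
    rw [this]
    simp only [← real_inner_self_eq_norm_sq, inner_sub_left, inner_sub_right, inner_smul_left,
      inner_smul_right, RCLike.conj_to_real, real_inner_comm a p]
    ring
  rw [h1, h2, ← k1, ← k2]
  ring

end

/-! ### Sequences in metric spaces -/

theorem setOf_subseq_limit_eq {X : Type*} [PseudoMetricSpace X] (u : ℕ → X) :
    {e | ∃ n : ℕ → ℕ, StrictMono n ∧ Tendsto (fun j => u (n j)) atTop (𝓝 e)} =
      {e | MapClusterPt e atTop u} := by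
  ext e
  constructor
  · rintro ⟨n, hn, h⟩
    exact MapClusterPt.of_comp hn.tendsto_atTop h.mapClusterPt
  · intro h
    exact h.tendsto_subseq

theorem isCompact_setOf_subseq_limit {X : Type*} [MetricSpace X] {u : ℕ → X} {K : Set X}
    (hK : IsCompact K) (hu : ∀ k, u k ∈ K) :
    IsCompact {e | ∃ n : ℕ → ℕ, StrictMono n ∧ Tendsto (fun j => u (n j)) atTop (𝓝 e)} := by
  refine hK.of_isClosed_subset ?_ ?_
  · rw [setOf_subseq_limit_eq]
    exact isClosed_setOfPred_clusterPt
  · rintro e ⟨n, -, h⟩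
    exact hK.isClosed.mem_of_tendsto h (Eventually.of_forall fun j => hu _)

/-- The set of subsequential limits of a sequence in a compact set whose steps tend to zero is
connected. -/
theorem isConnected_setOf_subseq_limit {X : Type*} [MetricSpace X] {u : ℕ → X} {K : Set X}
    (hK : IsCompact K) (hu : ∀ k, u k ∈ K)
    (hstep : Tendsto (fun k => dist (u k) (u (k + 1))) atTop (𝓝 0)) :
    IsConnected {e | ∃ n : ℕ → ℕ, StrictMono n ∧ Tendsto (fun j => u (n j)) atTop (𝓝 e)} := by
  set S := {e | ∃ n : ℕ → ℕ, StrictMono n ∧ Tendsto (fun j => u (n j)) atTop (𝓝 e)} with hS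
  have hSc : IsCompact S := isCompact_setOf_subseq_limit hK hu
  constructor
  · obtain ⟨e, -, n, hn, h⟩ := hK.tendsto_subseq hu
    exact ⟨e, n, hn, h⟩
  rw [isPreconnected_closed_iff]
  intro t t' ht ht' hcover h1 h2
  by_contra hempty
  rw [not_nonempty_iff_eq_empty] at hempty
  have hc2 : IsCompact (S ∩ t') := hSc.inter_right ht'
  have hcl1 : IsClosed (S ∩ t) := (hSc.inter_right ht).isClosed
  -- The distance to one piece of a separation of `S`: it is zero on that piece and at least `m > 0`
  -- on the other.
  let f : X → ℝ := fun x => Metric.infDist x (S ∩ t)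
  have hf : Continuous f := Metric.continuous_infDist_pt _
  obtain ⟨z, hz, hmin⟩ := hc2.exists_isMinOn h2 hf.continuousOn
  set m := f z with hm
  have hmpos : 0 < m := by
    refine (hcl1.notMem_iff_infDist_pos h1).1 fun hzt => ?_
    exact (eq_empty_iff_forall_notMem.1 hempty z) ⟨hz.1, hzt.2, hz.2⟩
  have hfS : ∀ e ∈ S, f e = 0 ∨ m ≤ f e := fun e he => by
    rcases hcover he with h | h
    · exact Or.inl (Metric.infDist_zero_of_mem ⟨he, h⟩)
    · exact Or.inr (hmin ⟨he, h⟩)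
  -- The sequence passes infinitely often from near one piece to near the other. As `f` is
  -- 1-Lipschitz and the steps are eventually below `m / 3`, the first index with `f ≥ m / 3` has `f
  -- ≤ 2 m / 3`. A limit of such points contradicts `hfS`.
  have hfreq : ∃ᶠ k in atTop, u k ∈ K ∩ f ⁻¹' Icc (m / 3) (2 * m / 3) := by
    rw [frequently_atTop]
    intro N
    obtain ⟨N', hN'⟩ := eventually_atTop.1 (hstep.eventually_lt_const (by positivity : 0 < m / 3))
    obtain ⟨x, hx⟩ := h1
    obtain ⟨n, hn, hnx⟩ := hx.1
    have hfx : f x = 0 := Metric.infDist_zero_of_mem hx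
    have e1 : ∀ᶠ j in atTop, f (u (n j)) < m / 3 :=
      ((hf.tendsto x).comp hnx).eventually_lt_const (by rw [hfx]; positivity)
    obtain ⟨j, hj1, hj2⟩ := (e1.and (hn.tendsto_atTop.eventually_ge_atTop (max N N'))).exists
    obtain ⟨n', hn', hnz⟩ := hz.1
    have e2 : ∀ᶠ i in atTop, m / 3 < f (u (n' i)) :=
      ((hf.tendsto z).comp hnz).eventually_const_lt (by rw [← hm]; linarith)
    obtain ⟨i, hi1, hi2⟩ := (e2.and (hn'.tendsto_atTop.eventually_ge_atTop (n j))).exists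
    classical
    have hex : ∃ k, n j ≤ k ∧ m / 3 ≤ f (u k) := ⟨n' i, hi2, hi1.le⟩
    obtain ⟨hk1, hk2⟩ := Nat.find_spec hex
    set k := Nat.find hex with hk
    have hlt : n j < k := lt_of_le_of_ne hk1 fun h => by rw [← h] at hk2; linarith
    obtain ⟨k', hk'⟩ : ∃ k', k = k' + 1 := ⟨k - 1, by omega⟩
    have hprev : f (u k') < m / 3 := by
      have := Nat.find_min hex (m := k') (by omega)
      push Not at this
      exact this (by omega)
    have hd := hN' k' (by have := le_max_right N N'; omega)
    have hlip : f (u (k' + 1)) ≤ f (u k') + dist (u (k' + 1)) (u k') :=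
      Metric.infDist_le_infDist_add_dist
    rw [dist_comm] at hlip
    refine ⟨k, by have := le_max_left N N'; omega, hu k, hk2, ?_⟩
    rw [hk']
    linarith
  have hcomp : IsCompact (K ∩ f ⁻¹' Icc (m / 3) (2 * m / 3)) :=
    hK.inter_right (isClosed_Icc.preimage hf)
  obtain ⟨e, he, n, hn, hlim⟩ := hcomp.tendsto_subseq' hfreq
  rcases hfS e ⟨n, hn, hlim⟩ with h | h
  · have := he.2.1; linarith
  · have := he.2.2; linarith

/-- An ultrafilter containing `range c` is the image of one on the index set, so testing index
ultrafilters suffices for total boundedness. -/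
theorem isCompact_closure_range_of_ultrafilter {X : Type*} [MetricSpace X] [CompleteSpace X]
    {c : ℕ → X} (hc : ∀ l : Ultrafilter ℕ, ∃ y, Tendsto c l (𝓝 y)) :
    IsCompact (closure (range c)) := by
  have htb : TotallyBounded (range c) := by
    rw [totallyBounded_iff_ultrafilter]
    intro f hf
    have hmem : range c ∈ f := le_principal_iff.1 hf
    obtain ⟨y, hy⟩ := hc (f.ofComapInfPrincipal (m := c) (s := univ) (by rwa [image_univ]))
    have := f.ofComapInfPrincipal_eq_of_map (m := c) (s := univ) (by rwa [image_univ])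
    rw [← this]
    exact cauchy_nhds.mono hy
  exact htb.closure.isCompact_of_isClosed isClosed_closure

/-- A contractive affine recursion with precompact forcing terms stays in a compact set. -/
theorem exists_isCompact_of_recursion {F : Type*} [NormedAddCommGroup F] [NormedSpace ℝ F]
    [CompleteSpace F] {x c : ℕ → F} {r : ℝ} (hr : |r| < 1) (hx : ∀ k, x (k + 1) = r • x k + c k)
    (hc : ∀ l : Ultrafilter ℕ, ∃ y, Tendsto c l (𝓝 y)) : ∃ K, IsCompact K ∧ ∀ k, x k ∈ K := by
  set D : Set F := insert 0 (insert (x 0) (closure (range c))) with hD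
  have hDc : IsCompact D := ((isCompact_closure_range_of_ultrafilter hc).insert _).insert _
  obtain ⟨M, hM⟩ := hDc.isBounded.exists_norm_le
  have hP : IsCompact (Set.pi univ fun _ : ℕ => D) := isCompact_univ_pi fun _ => hDc
  have hsum : Summable fun i : ℕ => |r| ^ i * M :=
    (summable_geometric_of_lt_one (abs_nonneg _) hr).mul_right _
  -- The compact set is the image of the Tychonoff product `D^ℕ` under the uniformly convergent map
  -- `d ↦ ∑ rⁱ dᵢ`.
  have hcont : ContinuousOn (fun d : ℕ → F => ∑' i, r ^ i • d i) (Set.pi univ fun _ : ℕ => D) := by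
    refine continuousOn_tsum (fun i => by fun_prop) hsum fun i d hd => ?_
    rw [norm_smul, norm_pow, Real.norm_eq_abs]
    exact mul_le_mul_of_nonneg_left (hM _ (hd i trivial)) (by positivity)
  refine ⟨_, hP.image_of_continuousOn hcont, fun k => ?_⟩
  -- Unrolling the recursion: the forcing terms in reverse order, then the initial value, then
  -- zeros. This is why `D` contains `0` and `x 0`.
  let d : ℕ → ℕ → F := fun k i => if i < k then c (k - 1 - i) else if i = k then x 0 else 0
  have hd : ∀ k, x k = ∑ i ∈ Finset.range (k + 1), r ^ i • d k i := by
    intro k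
    induction k with
    | zero => simp [d]
    | succ k ih =>
      rw [hx, ih, Finset.sum_range_succ' _ (k + 1), Finset.smul_sum]
      congr 1
      · refine Finset.sum_congr rfl fun i _ => ?_
        rw [smul_smul, ← pow_succ']
        congr 1
        simp only [d]
        rcases lt_trichotomy i k with h | h | h
        · rw [if_pos h, if_pos (by omega)]; congr 1; omega
        · simp [h]
        · rw [if_neg (by omega), if_neg (by omega), if_neg (by omega), if_neg (by omega)]
      · simp [d]
  refine ⟨d k, fun i _ => ?_, ?_⟩
  · simp only [d]
    split_ifs
    · exact Or.inr (Or.inr (subset_closure ⟨_, rfl⟩))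
    · exact Or.inr (Or.inl rfl)
    · exact Or.inl rfl
  · change ∑' i, r ^ i • d k i = x k
    rw [hd k]
    refine tsum_eq_sum fun i hi => ?_
    have : k < i := by simpa using hi
    simp only [d]
    rw [if_neg (by omega), if_neg (by omega), smul_zero]

/-! ### Limits of pairings and of solutions -/

theorem map_eq_zero_of_isPositive [CompleteSpace E] {O : E →L[ℂ] E} (hO : O.IsPositive) {x : E}
    (hx : (⟪x, O x⟫_ℂ).re = 0) : O x = 0 := by
  set y := O x with hy
  set M := (⟪y, O y⟫_ℂ).re with hM
  have hM0 : 0 ≤ M := hO.re_inner_nonneg_right y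
  have hxy : (⟪x, O y⟫_ℂ).re = ‖y‖ ^ 2 := by
    have : ⟪x, O y⟫_ℂ = ⟪O x, y⟫_ℂ := (hO.isSymmetric x y).symm
    rw [this, ← hy]
    simpa using inner_self_eq_norm_sq (𝕜 := ℂ) y
  have hyx : (⟪y, O x⟫_ℂ).re = ‖y‖ ^ 2 := by
    rw [← hy]
    simpa using inner_self_eq_norm_sq (𝕜 := ℂ) y
  have hq : ∀ s : ℝ, 0 ≤ 2 * s * ‖y‖ ^ 2 + s ^ 2 * M := fun s => by
    have h : 0 ≤ (⟪x + (s : ℂ) • y, O (x + (s : ℂ) • y)⟫_ℂ).re := hO.re_inner_nonneg_right _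
    simp only [map_add, map_smul, inner_add_left, inner_add_right, inner_smul_left,
      inner_smul_right, Complex.add_re, Complex.conj_ofReal, Complex.re_ofReal_mul, hxy, hyx,
      ← hM] at h
    nlinarith
  -- The quadratic in `s` has no constant term, so a small negative `s` makes it negative unless `y
  -- = 0`; `M + 1` avoids dividing by zero.
  have h1 := hq (-(‖y‖ ^ 2 / (M + 1)))
  have h2 : 2 * -(‖y‖ ^ 2 / (M + 1)) * ‖y‖ ^ 2 + (-(‖y‖ ^ 2 / (M + 1))) ^ 2 * M =
      -((‖y‖ ^ 2) ^ 2 * (M + 2) / (M + 1) ^ 2) := by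
    field_simp
    ring
  rw [h2] at h1
  by_contra hne
  have hpos : 0 < ‖y‖ := norm_pos_iff.2 hne
  have : 0 < (‖y‖ ^ 2) ^ 2 * (M + 2) / (M + 1) ^ 2 := by positivity
  linarith

theorem tendsto_pairing {T : ℝ} (hT : 0 ≤ T) {μ : E →L[ℂ] E} {ι : Type*} {l : Filter ι}
    {χ ψ : ι → ℝ → E} {χ' ψ' : ℝ → E} (hχ : ∀ i, ContinuousOn (χ i) (Icc 0 T))
    (hψ : ∀ i, ContinuousOn (ψ i) (Icc 0 T)) (hχ' : ContinuousOn χ' (Icc 0 T))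
    (hψ' : ContinuousOn ψ' (Icc 0 T)) (h1 : TendstoUniformlyOn χ χ' l (Icc 0 T))
    (h2 : TendstoUniformlyOn ψ ψ' l (Icc 0 T)) :
    Tendsto (fun i => pairing T μ (χ i) (ψ i)) l (𝓝 (pairing T μ χ' ψ')) := by
  obtain ⟨C, hC⟩ := isCompact_Icc.exists_bound_of_continuousOn hχ'
  obtain ⟨D, hD⟩ := isCompact_Icc.exists_bound_of_continuousOn hψ'
  have h0 : (0 : ℝ) ∈ Icc 0 T := ⟨le_rfl, hT⟩
  have hC0 : 0 ≤ C := (norm_nonneg _).trans (hC 0 h0)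
  have hD0 : 0 ≤ D := (norm_nonneg _).trans (hD 0 h0)
  rw [Metric.tendsto_nhds]
  intro ε hε
  set K : ℝ := Real.sqrt T * (‖μ‖ * (D + 1) + C * ‖μ‖) + 1 with hK
  have hK0 : 0 < K := by positivity
  set δ : ℝ := min 1 (ε / K) with hδ
  have hδ0 : 0 < δ := lt_min one_pos (by positivity)
  filter_upwards [Metric.tendstoUniformlyOn_iff.1 h1 δ hδ0,
    Metric.tendstoUniformlyOn_iff.1 h2 δ hδ0] with i hi1 hi2
  rw [dist_eq_norm]
  have hb : ∀ t ∈ Icc 0 T, ‖⟪χ i t, μ (ψ i t)⟫_ℂ - ⟪χ' t, μ (ψ' t)⟫_ℂ‖ ≤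
      δ * (‖μ‖ * (D + 1) + C * ‖μ‖) := fun t ht => by
    have k1 := (hi1 t ht).le
    have k2 := (hi2 t ht).le
    rw [dist_comm, dist_eq_norm] at k1 k2
    have k3 : ‖ψ i t‖ ≤ D + 1 := by
      have := norm_sub_norm_le (ψ i t) (ψ' t)
      have := hD t ht
      have : δ ≤ 1 := min_le_left _ _
      linarith
    have e : ⟪χ i t, μ (ψ i t)⟫_ℂ - ⟪χ' t, μ (ψ' t)⟫_ℂ =
        ⟪χ i t - χ' t, μ (ψ i t)⟫_ℂ + ⟪χ' t, μ (ψ i t - ψ' t)⟫_ℂ := by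
      rw [map_sub, inner_sub_left, inner_sub_right]; ring
    rw [e]
    refine (norm_add_le _ _).trans ?_
    have b1 : ‖⟪χ i t - χ' t, μ (ψ i t)⟫_ℂ‖ ≤ δ * (‖μ‖ * (D + 1)) :=
      (norm_inner_le_norm _ _).trans
        (mul_le_mul k1 (μ.le_opNorm_of_le k3) (norm_nonneg _) hδ0.le)
    have b2 : ‖⟪χ' t, μ (ψ i t - ψ' t)⟫_ℂ‖ ≤ C * (‖μ‖ * δ) :=
      (norm_inner_le_norm _ _).trans
        (mul_le_mul (hC t ht) (μ.le_opNorm_of_le k2) (norm_nonneg _) hC0)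
    linarith
  refine (norm_pairing_sub_le hT (hχ i) (hψ i) hχ' hψ' hb).trans_lt ?_
  have h3 : δ ≤ ε / K := min_le_right _ _
  calc _ ≤ Real.sqrt T * (ε / K * (‖μ‖ * (D + 1) + C * ‖μ‖)) := by gcongr
    _ = (K - 1) * (ε / K) := by rw [hK]; ring
    _ < K * (ε / K) := mul_lt_mul_of_pos_right (by linarith) (by positivity)
    _ = ε := by field_simp

section
variable [CompleteSpace E] {T : ℝ} {H : E →ₗ.[ℂ] E} {μ O : E →L[ℂ] E} {ψ₀ : E} {α : ℝ}

/-- Weak convergence of the controls and convergence at one time imply the uniform convergence of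
the solutions. -/
theorem exists_uniform_limit (hH : IsSelfAdjoint H) (hμ : IsSelfAdjoint μ) {ι : Type*}
    (l : Ultrafilter ι) {a : ι → Control T} {e : Control T} {A : ℝ} (hA : ∀ i, ‖a i‖ ≤ A)
    (hweak : ∀ g : Control T, Tendsto (fun i => ⟪g, a i⟫_ℝ) l (𝓝 ⟪g, e⟫_ℝ)) {φ : ι → ℝ → E}
    (hφ : ∀ i, IsSchrodingerSolution H μ (a i) (φ i)) {t₀ : ℝ} (ht₀ : t₀ ∈ Icc 0 T) {C : ℝ}
    (hC : ∀ i, ‖φ i t₀‖ ≤ C) {x : E} (hx : Tendsto (fun i => φ i t₀) l (𝓝 x)) :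
    ∃ φ', IsSchrodingerSolution H μ e φ' ∧ φ' t₀ = x ∧ TendstoUniformlyOn φ φ' l (Icc 0 T) := by
  obtain ⟨φ', h1, h2⟩ := exists_limit_solution hH hμ l (h := fun _ v => H v)
    (fun v => tendsto_const_nhds) hA hweak
    (fun i t ht => ((hφ i).isWeakSolution.norm_eq hH hμ ht₀ ht).trans_le (hC i))
    (fun i => (hφ i).isWeakSolution.continuousOn_inner) (fun i => (hφ i).2)
  exact ⟨φ', h1, tendstoUniformlyOn_of_weak hH hμ hφ h1 h2 ht₀ hx⟩

/-- Two controls which are given by the same feedback law along solutions with a common initial or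
final value coincide; here the feedback acts through the second argument of the pairing. -/
theorem eqOn_of_sub_eq_smul_pairing_right (hH : IsSelfAdjoint H) (hμ : IsSelfAdjoint μ)
    (hT : 0 ≤ T) {a b : Control T} {φ ψ χ : ℝ → E} (hφ : IsSchrodingerSolution H μ a φ)
    (hψ : IsSchrodingerSolution H μ b ψ) (hχ : ContinuousOn χ (Icc 0 T)) {c t₀ : ℝ}
    (hab : a - b = c • (pairing T μ χ φ - pairing T μ χ ψ)) (ht₀ : t₀ = 0 ∨ t₀ = T)
    (h : φ t₀ = ψ t₀) : EqOn φ ψ (Icc 0 T) := by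
  obtain ⟨C, hC⟩ := isCompact_Icc.exists_bound_of_continuousOn hχ
  have hC0 : 0 ≤ C := (norm_nonneg _).trans (hC 0 ⟨le_rfl, hT⟩)
  refine eqOn_of_feedback hH hμ hφ hψ (K := |c| * (C * ‖μ‖)) ?_ ht₀ h
  filter_upwards [Lp.coeFn_sub a b, Lp.coeFn_smul c (pairing T μ χ φ - pairing T μ χ ψ),
    Lp.coeFn_sub (pairing T μ χ φ) (pairing T μ χ ψ), pairing_ae_eq (μ := μ) hχ hφ.1,
    pairing_ae_eq (μ := μ) hχ hψ.1, ae_restrict_mem measurableSet_Icc] with t h1 h2 h3 h4 h5 ht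
  rw [← Pi.sub_apply, ← h1, hab, h2, Pi.smul_apply, h3, Pi.sub_apply, h4, h5, smul_eq_mul,
    ← Complex.sub_im, ← inner_sub_right, ← map_sub, abs_mul, mul_assoc]
  refine mul_le_mul_of_nonneg_left ((abs_im_inner_map_le _ _).trans ?_) (abs_nonneg _)
  rw [mul_assoc]
  exact mul_le_mul_of_nonneg_right (hC t ht) (by positivity)

omit [CompleteSpace E] in
theorem pairing_congr {χ χ' ψ ψ' : ℝ → E} (h1 : EqOn χ χ' (Icc 0 T)) (h2 : EqOn ψ ψ' (Icc 0 T)) :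
    pairing T μ χ ψ = pairing T μ χ' ψ' := by
  have h : (fun t => (⟪χ t, μ (ψ t)⟫_ℂ).im) =ᵐ[volume.restrict (Icc 0 T)]
      fun t => (⟪χ' t, μ (ψ' t)⟫_ℂ).im :=
    ae_restrict_of_forall_mem measurableSet_Icc fun t ht => by
      beta_reduce; rw [h1 ht, h2 ht]
  by_cases hm : MemLp (fun t => (⟪χ t, μ (ψ t)⟫_ℂ).im) 2 (volume.restrict (Icc 0 T))
  · rw [pairing, pairing, dif_pos hm, dif_pos ((memLp_congr_ae h).1 hm)]
    exact (MemLp.toLp_eq_toLp_iff _ _).2 h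
  · rw [pairing, pairing, dif_neg hm, dif_neg fun h' => hm ((memLp_congr_ae h).2 h')]

/-- Moves an adjoint state into the second slot, where the feedback uniqueness statement applies. -/
theorem pairing_swap (hμ : IsSelfAdjoint μ) {χ ψ : ℝ → E} (hχ : ContinuousOn χ (Icc 0 T))
    (hψ : ContinuousOn ψ (Icc 0 T)) : pairing T μ ψ χ = -pairing T μ χ ψ := by
  refine Lp.ext ?_
  filter_upwards [pairing_ae_eq (μ := μ) hχ hψ, pairing_ae_eq (μ := μ) hψ hχ,
    Lp.coeFn_neg (pairing T μ χ ψ)] with t h1 h2 h3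
  rw [h3, Pi.neg_apply, h1, h2, ← inner_conj_symm, Complex.conj_im]
  congr 2
  conv_lhs => rw [← ContinuousLinearMap.isSelfAdjoint_iff'.1 hμ]
  rw [ContinuousLinearMap.adjoint_inner_left]

omit [CompleteSpace E] in
theorem solvesEulerLagrange_of_smul_eq {e : Control T} {ψ χ : ℝ → E} (hψ : IsState H μ ψ₀ e ψ)
    (hχ : IsAdjointState H μ O e ψ χ) (h : α • e = -pairing T μ χ ψ) :
    SolvesEulerLagrange H μ O ψ₀ α e := by
  refine ⟨ψ, χ, hψ, hχ, ?_⟩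
  filter_upwards [Lp.coeFn_smul α e, Lp.coeFn_neg (pairing T μ χ ψ),
    pairing_ae_eq (μ := μ) hχ.1.1 hψ.1.1] with t h1 h2 h3
  rw [← h3, ← Pi.neg_apply, ← h2, ← h, h1, Pi.smul_apply, smul_eq_mul]

end

/-! ### Monotonicity and bounds for the scheme -/

/-- The control `-α⁻¹ Im ⟨χ|μ|ψ⟩` solving the last Euler-Lagrange equation. -/
def feedback (T : ℝ) (μ : E →L[ℂ] E) (α : ℝ) (χ ψ : ℝ → E) : Control T :=
  -(α⁻¹ • pairing T μ χ ψ)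

theorem smul_feedback {T : ℝ} {μ : E →L[ℂ] E} {α : ℝ} (hα : 0 < α) (χ ψ : ℝ → E) :
    α • feedback T μ α χ ψ = -pairing T μ χ ψ := by
  rw [feedback, smul_neg, smul_smul, mul_inv_cancel₀ hα.ne', one_smul]

section
variable {T : ℝ} {H : E →ₗ.[ℂ] E} {μ O : E →L[ℂ] E} {ψ₀ : E} {α δ η : ℝ}
  {ε ε' : ℕ → Control T} {ψ χ : ℕ → ℝ → E}

theorem eq_smul_add_smul_feedback {a b : Control T} {χ ψ : ℝ → E} {θ : ℝ}
    (hχ : ContinuousOn χ (Icc 0 T)) (hψ : ContinuousOn ψ (Icc 0 T))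
    (h : ∀ᵐ t ∂volume.restrict (Icc (0 : ℝ) T),
      b t = (1 - θ) * a t - θ / α * (⟪χ t, μ (ψ t)⟫_ℂ).im) :
    b = (1 - θ) • a + θ • feedback T μ α χ ψ := by
  have e : (1 - θ) • a + θ • feedback T μ α χ ψ =
      (1 - θ) • a - (θ / α) • pairing T μ χ ψ := by
    rw [feedback, smul_neg, smul_smul, div_eq_mul_inv]
    exact (sub_eq_add_neg _ _).symm
  rw [e]
  refine Lp.ext ?_
  filter_upwards [h, Lp.coeFn_sub ((1 - θ) • a) ((θ / α) • pairing T μ χ ψ),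
    Lp.coeFn_smul (1 - θ) a, Lp.coeFn_smul (θ / α) (pairing T μ χ ψ),
    pairing_ae_eq (μ := μ) hχ hψ] with t h1 h2 h3 h4 h5
  rw [h1, h2, Pi.sub_apply, h3, h4, Pi.smul_apply, Pi.smul_apply, h5, smul_eq_mul, smul_eq_mul]

theorem IsMonotonicScheme.control'_eq_feedback (hs : IsMonotonicScheme H μ O ψ₀ α δ η ε ε' ψ χ)
    (k : ℕ) : ε' k = (1 - η) • ε k + η • feedback T μ α (χ k) (ψ k) :=
  eq_smul_add_smul_feedback (hs.adjoint_eq k).1.1 (hs.state_eq k).1.1 (hs.control'_eq k)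

theorem IsMonotonicScheme.control_eq_feedback (hs : IsMonotonicScheme H μ O ψ₀ α δ η ε ε' ψ χ)
    (k : ℕ) : ε (k + 1) = (1 - δ) • ε' k + δ • feedback T μ α (χ k) (ψ (k + 1)) :=
  eq_smul_add_smul_feedback (hs.adjoint_eq k).1.1 (hs.state_eq (k + 1)).1.1 (hs.control_eq k)

variable [CompleteSpace E]

theorem IsMonotonicScheme.norm_state (hH : IsSelfAdjoint H) (hμ : IsSelfAdjoint μ)
    (hs : IsMonotonicScheme H μ O ψ₀ α δ η ε ε' ψ χ) (k : ℕ) {t : ℝ} (ht : t ∈ Icc 0 T) :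
    ‖ψ k t‖ = ‖ψ₀‖ := by
  rw [(hs.state_eq k).1.isWeakSolution.norm_eq hH hμ ⟨le_rfl, ht.1.trans ht.2⟩ ht,
    (hs.state_eq k).2]

theorem IsMonotonicScheme.norm_adjoint_le (hH : IsSelfAdjoint H) (hμ : IsSelfAdjoint μ)
    (hs : IsMonotonicScheme H μ O ψ₀ α δ η ε ε' ψ χ) (k : ℕ) {t : ℝ} (ht : t ∈ Icc 0 T) :
    ‖χ k t‖ ≤ ‖O‖ * ‖ψ₀‖ := by
  have hT : T ∈ Icc 0 T := ⟨ht.1.trans ht.2, le_rfl⟩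
  rw [(hs.adjoint_eq k).1.isWeakSolution.norm_eq hH hμ hT ht, (hs.adjoint_eq k).2,
    ← hs.norm_state hH hμ k hT]
  exact O.le_opNorm _

theorem IsMonotonicScheme.cost_succ (hH : IsSelfAdjoint H) (hμ : IsSelfAdjoint μ)
    (hO : O.IsPositive) (hT : 0 ≤ T) (hα : 0 < α)
    (hs : IsMonotonicScheme H μ O ψ₀ α δ η ε ε' ψ χ) (k : ℕ) :
    cost H μ O ψ₀ α (ε (k + 1)) - cost H μ O ψ₀ α (ε k) =
      (⟪ψ (k + 1) T - ψ k T, O (ψ (k + 1) T - ψ k T)⟫_ℂ).re +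
      α * (η * (2 - η) * ‖ε k - feedback T μ α (χ k) (ψ k)‖ ^ 2 +
        δ * (2 - δ) * ‖ε' k - feedback T μ α (χ k) (ψ (k + 1))‖ ^ 2) :=
  cost_increment hH hμ hO hT (hs.state_eq k) (hs.state_eq (k + 1)) (hs.adjoint_eq k)
    (smul_feedback hα _ _) (smul_feedback hα _ _) (hs.control'_eq_feedback k)
    (hs.control_eq_feedback k)

theorem IsMonotonicScheme.re_inner_le (hH : IsSelfAdjoint H) (hμ : IsSelfAdjoint μ) (hT : 0 ≤ T)
    (hs : IsMonotonicScheme H μ O ψ₀ α δ η ε ε' ψ χ) (k : ℕ) :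
    (⟪ψ k T, O (ψ k T)⟫_ℂ).re ≤ ‖ψ₀‖ * (‖O‖ * ‖ψ₀‖) := by
  have h : ‖ψ k T‖ = ‖ψ₀‖ := hs.norm_state hH hμ k ⟨hT, le_rfl⟩
  refine (Complex.re_le_norm _).trans ((norm_inner_le_norm _ _).trans ?_)
  rw [h]
  exact mul_le_mul_of_nonneg_left (O.le_opNorm_of_le h.le) (norm_nonneg _)

theorem IsMonotonicScheme.monotone_cost (hH : IsSelfAdjoint H) (hμ : IsSelfAdjoint μ)
    (hO : O.IsPositive) (hT : 0 ≤ T) (hα : 0 < α) (hδ : δ ∈ Icc (0 : ℝ) 2)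
    (hη : η ∈ Icc (0 : ℝ) 2) (hs : IsMonotonicScheme H μ O ψ₀ α δ η ε ε' ψ χ) :
    Monotone fun k => cost H μ O ψ₀ α (ε k) := by
  refine monotone_nat_of_le_succ fun k => ?_
  have h1 : 0 ≤ (⟪ψ (k + 1) T - ψ k T, O (ψ (k + 1) T - ψ k T)⟫_ℂ).re :=
    hO.re_inner_nonneg_right _
  have h2 : 0 ≤ η * (2 - η) := mul_nonneg hη.1 (sub_nonneg.2 hη.2)
  have h3 : 0 ≤ δ * (2 - δ) := mul_nonneg hδ.1 (sub_nonneg.2 hδ.2)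
  have h4 : 0 ≤ α * (η * (2 - η) * ‖ε k - feedback T μ α (χ k) (ψ k)‖ ^ 2 +
        δ * (2 - δ) * ‖ε' k - feedback T μ α (χ k) (ψ (k + 1))‖ ^ 2) := by positivity
  have := hs.cost_succ hH hμ hO hT hα k
  linarith

theorem IsMonotonicScheme.exists_tendsto_cost (hH : IsSelfAdjoint H) (hμ : IsSelfAdjoint μ)
    (hO : O.IsPositive) (hT : 0 ≤ T) (hα : 0 < α) (hδ : δ ∈ Icc (0 : ℝ) 2)
    (hη : η ∈ Icc (0 : ℝ) 2) (hs : IsMonotonicScheme H μ O ψ₀ α δ η ε ε' ψ χ) :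
    ∃ c, Tendsto (fun k => cost H μ O ψ₀ α (ε k)) atTop (𝓝 c) := by
  refine ⟨_, tendsto_atTop_ciSup (hs.monotone_cost hH hμ hO hT hα hδ hη)
    ⟨‖ψ₀‖ * (‖O‖ * ‖ψ₀‖), ?_⟩⟩
  rintro _ ⟨k, rfl⟩
  have h1 := hs.re_inner_le hH hμ hT k
  have h2 : 0 ≤ α * ‖ε k‖ ^ 2 := by positivity
  beta_reduce
  rw [cost_eq hH hμ hT (hs.state_eq k)]
  linarith

/-- The cost stays above its initial value while its final-time term is bounded, so the penalty `α
‖ε k‖²` is bounded. The bound on `ε'` follows from its affine expression. -/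
theorem IsMonotonicScheme.exists_norm_control_le (hH : IsSelfAdjoint H) (hμ : IsSelfAdjoint μ)
    (hO : O.IsPositive) (hT : 0 ≤ T) (hα : 0 < α) (hδ : δ ∈ Icc (0 : ℝ) 2)
    (hη : η ∈ Icc (0 : ℝ) 2) (hs : IsMonotonicScheme H μ O ψ₀ α δ η ε ε' ψ χ) :
    ∃ A, (∀ k, ‖ε k‖ ≤ A) ∧ ∀ k, ‖ε' k‖ ≤ A := by
  set M := (‖ψ₀‖ * (‖O‖ * ‖ψ₀‖) - cost H μ O ψ₀ α (ε 0)) / α with hM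
  have h1 : ∀ k, ‖ε k‖ ≤ Real.sqrt M := fun k => by
    refine Real.le_sqrt_of_sq_le ?_
    rw [hM, le_div_iff₀ hα]
    have k1 := hs.monotone_cost hH hμ hO hT hα hδ hη (Nat.zero_le k)
    have k2 := hs.re_inner_le hH hμ hT k
    beta_reduce at k1
    rw [cost_eq hH hμ hT (hs.state_eq k)] at k1
    linarith
  set P := Real.sqrt T * (‖O‖ * ‖ψ₀‖ * (‖μ‖ * ‖ψ₀‖)) with hP
  have h2 : ∀ k, ‖ε' k‖ ≤ |1 - η| * Real.sqrt M + |η| * (|α⁻¹| * P) := fun k => by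
    rw [hs.control'_eq_feedback k]
    refine (norm_add_le _ _).trans ?_
    rw [norm_smul, norm_smul, feedback, norm_neg, norm_smul, Real.norm_eq_abs, Real.norm_eq_abs,
      Real.norm_eq_abs]
    have h3 : ‖pairing T μ (χ k) (ψ k)‖ ≤ P :=
      norm_pairing_le hT (hs.adjoint_eq k).1.1 (hs.state_eq k).1.1
        (fun t ht => hs.norm_adjoint_le hH hμ k ht) (fun t ht => (hs.norm_state hH hμ k ht).le)
    have := h1 k
    gcongr
  exact ⟨max _ _, fun k => (h1 k).trans (le_max_left _ _), fun k => (h2 k).trans (le_max_right _ _)⟩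

/-! ### Compactness of the controls -/

/-- Limits of the states and adjoint states of the scheme along an ultrafilter. -/
structure IsSchemeLimit (H : E →ₗ.[ℂ] E) (μ O : E →L[ℂ] E) (ψ₀ : E) (ψ χ : ℕ → ℝ → E)
    (l : Filter ℕ) (a b : Control T) (φ ω : ℝ → E) : Prop where
  isState : IsState H μ ψ₀ a φ
  isAdjointState : IsAdjointState H μ O b φ ω
  tendsto_state : TendstoUniformlyOn ψ φ l (Icc 0 T)
  tendsto_adjoint : TendstoUniformlyOn χ ω l (Icc 0 T)

/-- States come first, their initial value being fixed. Their norm convergence at `T` then gives the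
convergence of the final values `O (ψ k T)`, as needed for the adjoint states. -/
theorem IsMonotonicScheme.exists_weak_limit (hH : IsSelfAdjoint H) (hμ : IsSelfAdjoint μ)
    (hT : 0 ≤ T) (hs : IsMonotonicScheme H μ O ψ₀ α δ η ε ε' ψ χ) {A : ℝ}
    (hA : ∀ k, ‖ε k‖ ≤ A) (hA' : ∀ k, ‖ε' k‖ ≤ A) (l : Ultrafilter ℕ) :
    ∃ (a b : Control T) (φ ω : ℝ → E), IsSchemeLimit H μ O ψ₀ ψ χ l a b φ ω ∧
      (∀ g : Control T, Tendsto (fun k => ⟪g, ε k⟫_ℝ) l (𝓝 ⟪g, a⟫_ℝ)) ∧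
      (∀ g : Control T, Tendsto (fun k => ⟪g, ε' k⟫_ℝ) l (𝓝 ⟪g, b⟫_ℝ)) := by
  have hT' : T ∈ Icc 0 T := ⟨hT, le_rfl⟩
  obtain ⟨a, -, ha⟩ := QuantumControl.exists_weak_limit (𝕜 := ℝ) l hA
  obtain ⟨b, -, hb⟩ := QuantumControl.exists_weak_limit (𝕜 := ℝ) l hA'
  obtain ⟨φ, hφ, hφ0, hφlim⟩ := exists_uniform_limit hH hμ l hA ha (fun k => (hs.state_eq k).1)
    (t₀ := 0) ⟨le_rfl, hT⟩ (C := ‖ψ₀‖) (x := ψ₀) (fun k => by rw [(hs.state_eq k).2])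
    (tendsto_const_nhds.congr fun k => (hs.state_eq k).2.symm)
  obtain ⟨ω, hω, hωT, hωlim⟩ := exists_uniform_limit hH hμ l hA' hb
    (fun k => (hs.adjoint_eq k).1) hT' (fun k => hs.norm_adjoint_le hH hμ k hT')
    (((O.continuous.tendsto _).comp (hφlim.tendsto_at hT')).congr fun k =>
      (hs.adjoint_eq k).2.symm)
  exact ⟨a, b, φ, ω, ⟨⟨hφ, hφ0⟩, ⟨hω, hωT⟩, hφlim, hωlim⟩, ha, hb⟩

omit [CompleteSpace E] in
theorem IsSchemeLimit.tendsto_feedback (hT : 0 ≤ T)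
    (hs : IsMonotonicScheme H μ O ψ₀ α δ η ε ε' ψ χ) {l : Filter ℕ} {a b : Control T}
    {φ ω : ℝ → E} (h : IsSchemeLimit H μ O ψ₀ ψ χ l a b φ ω) :
    Tendsto (fun k => feedback T μ α (χ k) (ψ k)) l (𝓝 (feedback T μ α ω φ)) :=
  ((tendsto_pairing hT (fun k => (hs.adjoint_eq k).1.1) (fun k => (hs.state_eq k).1.1)
    h.isAdjointState.1.1 h.isState.1.1 h.tendsto_adjoint h.tendsto_state).const_smul _).neg

omit [CompleteSpace E] in
theorem IsSchemeLimit.tendsto_feedback_succ (hT : 0 ≤ T)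
    (hs : IsMonotonicScheme H μ O ψ₀ α δ η ε ε' ψ χ) {l : Filter ℕ} {a b a' b' : Control T}
    {φ ω φ' ω' : ℝ → E} (h : IsSchemeLimit H μ O ψ₀ ψ χ l a b φ ω)
    (h' : IsSchemeLimit H μ O ψ₀ ψ χ (l.map Nat.succ) a' b' φ' ω') :
    Tendsto (fun k => feedback T μ α (χ k) (ψ (k + 1))) l (𝓝 (feedback T μ α ω φ')) :=
  ((tendsto_pairing hT (fun k => (hs.adjoint_eq k).1.1) (fun k => (hs.state_eq (k + 1)).1.1)
    h.isAdjointState.1.1 h'.isState.1.1 h.tendsto_adjoint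
    (fun u hu => h'.tendsto_state u hu)).const_smul _).neg

/-- Eliminating `ε'` gives a recursion of ratio `(1 - δ)(1 - η)` whose forcing converges along every
ultrafilter; the states `ψ (k + 1)` are handled by shifting the ultrafilter. -/
theorem IsMonotonicScheme.exists_isCompact (hH : IsSelfAdjoint H) (hμ : IsSelfAdjoint μ)
    (hT : 0 ≤ T) (hs : IsMonotonicScheme H μ O ψ₀ α δ η ε ε' ψ χ)
    (hδη : |(1 - δ) * (1 - η)| < 1) {A : ℝ}
    (hA : ∀ k, ‖ε k‖ ≤ A) (hA' : ∀ k, ‖ε' k‖ ≤ A) : ∃ K, IsCompact K ∧ ∀ k, ε k ∈ K := by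
  refine exists_isCompact_of_recursion hδη
    (c := fun k => ((1 - δ) * η) • feedback T μ α (χ k) (ψ k) +
      δ • feedback T μ α (χ k) (ψ (k + 1))) (fun k => ?_) fun l => ?_
  · rw [hs.control_eq_feedback k, hs.control'_eq_feedback k, smul_add, smul_smul, smul_smul,
      add_assoc]
  · obtain ⟨a, b, φ, ω, h, -⟩ := hs.exists_weak_limit hH hμ hT hA hA' l
    obtain ⟨a', b', φ', ω', h', -⟩ := hs.exists_weak_limit hH hμ hT hA hA' (l.map Nat.succ)
    exact ⟨_, ((h.tendsto_feedback hT hs).const_smul _).add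
      ((h.tendsto_feedback_succ hT hs h').const_smul _)⟩

/-- Compactness upgrades the weak limit of `ε` to a strong one; `ε'` follows because its feedback
term converges strongly. -/
theorem IsMonotonicScheme.exists_limit (hH : IsSelfAdjoint H) (hμ : IsSelfAdjoint μ)
    (hT : 0 ≤ T) (hs : IsMonotonicScheme H μ O ψ₀ α δ η ε ε' ψ χ) {A : ℝ}
    (hA : ∀ k, ‖ε k‖ ≤ A) (hA' : ∀ k, ‖ε' k‖ ≤ A) {K : Set (Control T)} (hK : IsCompact K)
    (hεK : ∀ k, ε k ∈ K) (l : Ultrafilter ℕ) :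
    ∃ (a b : Control T) (φ ω : ℝ → E), IsSchemeLimit H μ O ψ₀ ψ χ l a b φ ω ∧
      Tendsto ε l (𝓝 a) ∧ Tendsto ε' l (𝓝 b) := by
  obtain ⟨a, b, φ, ω, h, ha, hb⟩ := hs.exists_weak_limit hH hμ hT hA hA' l
  have huniq : ∀ {x : ℕ → Control T} {y z : Control T}, Tendsto x l (𝓝 y) →
      (∀ g : Control T, Tendsto (fun k => ⟪g, x k⟫_ℝ) l (𝓝 ⟪g, z⟫_ℝ)) → y = z :=
    fun hy hz => ext_inner_left ℝ fun g =>
      tendsto_nhds_unique (tendsto_const_nhds.inner hy) (hz g)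
  obtain ⟨y, -, hy⟩ := hK.ultrafilter_le_nhds (l.map ε)
    (by rw [Ultrafilter.coe_map, le_principal_iff, mem_map]; exact univ_mem' hεK)
  have hy' : Tendsto ε l (𝓝 a) := huniq hy ha ▸ hy
  have hb' : Tendsto ε' l (𝓝 ((1 - η) • a + η • feedback T μ α ω φ)) :=
    ((hy'.const_smul _).add ((h.tendsto_feedback hT hs).const_smul _)).congr
      fun k => (hs.control'_eq_feedback k).symm
  exact ⟨a, b, φ, ω, h, hy', huniq hb' hb ▸ hb'⟩

end

/-! ### Identification of the limits -/

/-- The relations satisfied by the limits of one iteration of the scheme. -/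
structure IsLimitIteration {T : ℝ} (μ O : E →L[ℂ] E) (α δ η : ℝ) (a b a' : Control T)
    (φ ω φ' : ℝ → E) : Prop where
  control'_eq : b = (1 - η) • a + η • feedback T μ α ω φ
  control_eq : a' = (1 - δ) • b + δ • feedback T μ α ω φ'
  gap : η * (2 - η) * ‖a - feedback T μ α ω φ‖ ^ 2 = 0
  gap' : δ * (2 - δ) * ‖b - feedback T μ α ω φ'‖ ^ 2 = 0
  map_final : O (φ' T) = O (φ T)

section
variable [CompleteSpace E] {T : ℝ} {H : E →ₗ.[ℂ] E} {μ O : E →L[ℂ] E} {ψ₀ : E} {α δ η : ℝ}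
  {ε ε' : ℕ → Control T} {ψ χ : ℕ → ℝ → E} {a b a' b' a'' : Control T} {φ ω φ' ω' φ'' : ℝ → E}

/-- The cost converges, so its increments tend to zero; each nonnegative term of the increment then
vanishes in the limit. -/
theorem IsMonotonicScheme.isLimitIteration (hH : IsSelfAdjoint H) (hμ : IsSelfAdjoint μ)
    (hO : O.IsPositive) (hT : 0 ≤ T) (hα : 0 < α) (hδ : δ ∈ Icc (0 : ℝ) 2)
    (hη : η ∈ Icc (0 : ℝ) 2) (hs : IsMonotonicScheme H μ O ψ₀ α δ η ε ε' ψ χ) {l : Filter ℕ}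
    [l.NeBot] (hl : l ≤ atTop) (h : IsSchemeLimit H μ O ψ₀ ψ χ l a b φ ω)
    (ha : Tendsto ε l (𝓝 a)) (hb : Tendsto ε' l (𝓝 b))
    (h' : IsSchemeLimit H μ O ψ₀ ψ χ (l.map Nat.succ) a' b' φ' ω')
    (ha' : Tendsto ε (l.map Nat.succ) (𝓝 a')) : IsLimitIteration μ O α δ η a b a' φ ω φ' := by
  have hT' : T ∈ Icc 0 T := ⟨hT, le_rfl⟩
  have hp := h.tendsto_feedback hT hs
  have hq := h.tendsto_feedback_succ hT hs h'
  have ha1 : Tendsto (fun k => ε (k + 1)) l (𝓝 a') := ha'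
  have hφ : Tendsto (fun k => ψ k T) l (𝓝 (φ T)) := h.tendsto_state.tendsto_at hT'
  have hφ' : Tendsto (fun k => ψ (k + 1) T) l (𝓝 (φ' T)) :=
    h'.tendsto_state.tendsto_at hT'
  obtain ⟨c, hc⟩ := hs.exists_tendsto_cost hH hμ hO hT hα hδ hη
  have hinc := ((tendsto_add_atTop_iff_nat 1).2 hc).sub hc
  rw [sub_self] at hinc
  have hd := hφ'.sub hφ
  have hx : Tendsto (fun k => (⟪ψ (k + 1) T - ψ k T, O (ψ (k + 1) T - ψ k T)⟫_ℂ).re) l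
      (𝓝 (⟪φ' T - φ T, O (φ' T - φ T)⟫_ℂ).re) :=
    (Complex.continuous_re.tendsto _).comp (hd.inner ((O.continuous.tendsto _).comp hd))
  have hy := (((ha.sub hp).norm.pow 2).const_mul (η * (2 - η)))
  have hz := (((hb.sub hq).norm.pow 2).const_mul (δ * (2 - δ)))
  have hzero := tendsto_nhds_unique ((hinc.mono_left hl).congr
    fun k => hs.cost_succ hH hμ hO hT hα k) (hx.add ((hy.add hz).const_mul α))
  have k1 : 0 ≤ (⟪φ' T - φ T, O (φ' T - φ T)⟫_ℂ).re := hO.re_inner_nonneg_right _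
  have k2 : 0 ≤ η * (2 - η) * ‖a - feedback T μ α ω φ‖ ^ 2 :=
    mul_nonneg (mul_nonneg hη.1 (sub_nonneg.2 hη.2)) (sq_nonneg _)
  have k3 : 0 ≤ δ * (2 - δ) * ‖b - feedback T μ α ω φ'‖ ^ 2 :=
    mul_nonneg (mul_nonneg hδ.1 (sub_nonneg.2 hδ.2)) (sq_nonneg _)
  have k4 := mul_nonneg hα.le k2
  have k5 := mul_nonneg hα.le k3
  rw [mul_add] at hzero
  refine ⟨?_, ?_, ?_, ?_, ?_⟩
  · exact tendsto_nhds_unique hb (((ha.const_smul _).add (hp.const_smul _)).congr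
      fun k => (hs.control'_eq_feedback k).symm)
  · exact tendsto_nhds_unique ha1 (((hb.const_smul _).add (hq.const_smul _)).congr
      fun k => (hs.control_eq_feedback k).symm)
  · exact (mul_eq_zero_iff_left hα.ne').1 (by linarith)
  · exact (mul_eq_zero_iff_left hα.ne').1 (by linarith)
  · have := map_eq_zero_of_isPositive hO (x := φ' T - φ T) (by linarith)
    rwa [map_sub, sub_eq_zero] at this

omit [CompleteSpace E] in
theorem smul_add_smul_self (θ : ℝ) (x : Control T) : (1 - θ) • x + θ • x = x := by
  rw [← add_smul, sub_add_cancel, one_smul]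

omit [CompleteSpace E] in
theorem feedback_sub_feedback (χ χ' ψ ψ' : ℝ → E) :
    feedback T μ α χ ψ - feedback T μ α χ' ψ' =
      (-α⁻¹) • (pairing T μ χ ψ - pairing T μ χ' ψ') := by
  simp only [feedback, neg_smul, smul_sub]

/-- If `η ∈ (0,2)`, the limits of one iteration agree and are critical. -/
theorem IsLimitIteration.eq_of_eta (hH : IsSelfAdjoint H) (hμ : IsSelfAdjoint μ) (hT : 0 ≤ T)
    (hα : 0 < α) (hη : η * (2 - η) ≠ 0) (h : IsLimitIteration μ O α δ η a b a' φ ω φ')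
    (hφ : IsState H μ ψ₀ a φ) (hφ' : IsState H μ ψ₀ a' φ') (hω : IsAdjointState H μ O b φ ω) :
    a' = a ∧ SolvesEulerLagrange H μ O ψ₀ α a := by
  have hap : a = feedback T μ α ω φ := by
    have := (mul_eq_zero_iff_left hη).1 h.gap
    rwa [sq_eq_zero_iff, norm_eq_zero, sub_eq_zero] at this
  have hba : b = a := by rw [h.control'_eq, ← hap, smul_add_smul_self]
  subst hba
  -- The control difference is a multiple of the difference of pairings with the same `ω`, so
  -- forward uniqueness from the common initial value gives `φ' = φ`.
  have hdiff : a' - b = (-(δ * α⁻¹)) • (pairing T μ ω φ' - pairing T μ ω φ) := by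
    have e : a' - b = δ • (feedback T μ α ω φ' - feedback T μ α ω φ) := by
      rw [h.control_eq, ← hap, sub_smul, one_smul, smul_sub]; abel
    rw [e, feedback_sub_feedback, smul_smul, mul_neg]
  have heq := eqOn_of_sub_eq_smul_pairing_right hH hμ hT hφ'.1 hφ.1 hω.1.1 hdiff (Or.inl rfl)
    (hφ'.2.trans hφ.2.symm)
  refine ⟨?_, solvesEulerLagrange_of_smul_eq hφ hω ?_⟩
  · rw [pairing_congr (fun _ _ => rfl) heq, sub_self, smul_zero, sub_eq_zero] at hdiff
    exact hdiff
  · nth_rw 1 [hap]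
    exact smul_feedback hα _ _

/-- If `δ ∈ (0,2)`, the limits of two consecutive iterations agree and are critical. -/
theorem IsLimitIteration.eq_of_delta (hH : IsSelfAdjoint H) (hμ : IsSelfAdjoint μ) (hT : 0 ≤ T)
    (hα : 0 < α) (hδ : δ * (2 - δ) ≠ 0) (h : IsLimitIteration μ O α δ η a b a' φ ω φ')
    (h' : IsLimitIteration μ O α δ η a' b' a'' φ' ω' φ'')
    (hφ' : IsState H μ ψ₀ a' φ') (hω : IsAdjointState H μ O b φ ω)
    (hω' : IsAdjointState H μ O b' φ' ω') :
    a'' = a' ∧ SolvesEulerLagrange H μ O ψ₀ α a' := by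
  have hbq : b = feedback T μ α ω φ' := by
    have := (mul_eq_zero_iff_left hδ).1 h.gap'
    rwa [sq_eq_zero_iff, norm_eq_zero, sub_eq_zero] at this
  have hbq' : b' = feedback T μ α ω' φ'' := by
    have := (mul_eq_zero_iff_left hδ).1 h'.gap'
    rwa [sq_eq_zero_iff, norm_eq_zero, sub_eq_zero] at this
  have ha'b : a' = b := by rw [h.control_eq, ← hbq, smul_add_smul_self]
  have ha''b : a'' = b' := by rw [h'.control_eq, ← hbq', smul_add_smul_self]
  subst ha'b ha''b
  -- Now the state `φ'` is common and the adjoint states differ. Their final values agree because `O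
  -- (φ' T) = O (φ T)`, so uniqueness runs backward from `T`.
  have hdiff : a'' - a' = (η * α⁻¹) • (pairing T μ φ' ω' - pairing T μ φ' ω) := by
    have e : a'' - a' = η • (feedback T μ α ω' φ' - feedback T μ α ω φ') := by
      rw [h'.control'_eq, ← hbq, sub_smul, one_smul, smul_sub]; abel
    rw [e, feedback_sub_feedback, smul_smul, pairing_swap hμ hω'.1.1 hφ'.1.1,
      pairing_swap hμ hω.1.1 hφ'.1.1, mul_neg, neg_smul, ← smul_neg]
    congr 1
    abel
  have heq := eqOn_of_sub_eq_smul_pairing_right hH hμ hT hω'.1 hω.1 hφ'.1.1 hdiff (Or.inr rfl)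
    (by rw [hω'.2, hω.2, h.map_final])
  refine ⟨?_, solvesEulerLagrange_of_smul_eq hφ' ⟨hω.1, by rw [hω.2, h.map_final]⟩ ?_⟩
  · rw [pairing_congr (fun _ _ => rfl) heq, sub_self, smul_zero, sub_eq_zero] at hdiff
    exact hdiff
  · nth_rw 1 [hbq]
    exact smul_feedback hα _ _

/-- Three consecutive limits are taken because the `δ` case compares two successive adjoint states;
hence the indices `k + 1` and `k + 2`. -/
theorem IsMonotonicScheme.exists_critical_limit (hH : IsSelfAdjoint H) (hμ : IsSelfAdjoint μ)
    (hO : O.IsPositive) (hT : 0 ≤ T) (hα : 0 < α) (hδ : δ ∈ Icc (0 : ℝ) 2)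
    (hη : η ∈ Icc (0 : ℝ) 2) (hδη : |(1 - δ) * (1 - η)| < 1)
    (hs : IsMonotonicScheme H μ O ψ₀ α δ η ε ε' ψ χ) {l : Ultrafilter ℕ}
    (hl : (l : Filter ℕ) ≤ atTop) : ∃ a : Control T, Tendsto (fun k => ε (k + 1)) l (𝓝 a) ∧
      Tendsto (fun k => ε (k + 2)) l (𝓝 a) ∧ SolvesEulerLagrange H μ O ψ₀ α a := by
  obtain ⟨A, hA, hA'⟩ := hs.exists_norm_control_le hH hμ hO hT hα hδ hη
  obtain ⟨K, hK, hεK⟩ := hs.exists_isCompact hH hμ hT hδη hA hA'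
  have hsucc : Tendsto Nat.succ atTop atTop := tendsto_add_atTop_nat 1
  have hl1 : ((l.map Nat.succ : Ultrafilter ℕ) : Filter ℕ) ≤ atTop := (hsucc.mono_left hl)
  obtain ⟨a, b, φ, ω, d, ha, hb⟩ := hs.exists_limit hH hμ hT hA hA' hK hεK l
  obtain ⟨a', b', φ', ω', d', ha', hb'⟩ :=
    hs.exists_limit hH hμ hT hA hA' hK hεK (l.map Nat.succ)
  obtain ⟨a'', b'', φ'', ω'', d'', ha'', hb''⟩ :=
    hs.exists_limit hH hμ hT hA hA' hK hεK ((l.map Nat.succ).map Nat.succ)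
  have i1 := hs.isLimitIteration hH hμ hO hT hα hδ hη hl d ha hb d' ha'
  have i2 := hs.isLimitIteration hH hμ hO hT hα hδ hη hl1 d' ha' hb' d'' ha''
  have hmain : a'' = a' ∧ SolvesEulerLagrange H μ O ψ₀ α a' := by
    by_cases hη0 : η * (2 - η) = 0
    · by_cases hδ0 : δ * (2 - δ) = 0
      · exfalso
        -- `δ (2 - δ) = 0` means `(1 - δ)² = 1`, and likewise for `η`, contradicting the strict
        -- bound.
        have e : ((1 - δ) * (1 - η)) ^ 2 = 1 := by
          have e1 : (1 - δ) ^ 2 = 1 := by linarith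
          have e2 : (1 - η) ^ 2 = 1 := by linarith
          rw [mul_pow, e1, e2, one_mul]
        have := (sq_lt_one_iff_abs_lt_one _).2 hδη
        linarith
      · exact i1.eq_of_delta hH hμ hT hα hδ0 i2 d'.isState d.isAdjointState d'.isAdjointState
    · exact i2.eq_of_eta hH hμ hT hα hη0 d'.isState d''.isState d'.isAdjointState
  refine ⟨a', ha', ?_, hmain.2⟩
  rw [hmain.1] at ha''
  exact ha''

theorem IsMonotonicScheme.tendsto_dist_succ (hH : IsSelfAdjoint H) (hμ : IsSelfAdjoint μ)
    (hO : O.IsPositive) (hT : 0 ≤ T) (hα : 0 < α) (hδ : δ ∈ Icc (0 : ℝ) 2)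
    (hη : η ∈ Icc (0 : ℝ) 2) (hδη : |(1 - δ) * (1 - η)| < 1)
    (hs : IsMonotonicScheme H μ O ψ₀ α δ η ε ε' ψ χ) :
    Tendsto (fun k => dist (ε k) (ε (k + 1))) atTop (𝓝 0) := by
  rw [← tendsto_add_atTop_iff_nat 1, tendsto_iff_ultrafilter]
  intro l hl
  obtain ⟨a, h1, h2, -⟩ := hs.exists_critical_limit hH hμ hO hT hα hδ hη hδη hl
  simpa using h1.dist h2

theorem IsMonotonicScheme.solvesEulerLagrange_of_mem (hH : IsSelfAdjoint H)
    (hμ : IsSelfAdjoint μ) (hO : O.IsPositive) (hT : 0 ≤ T) (hα : 0 < α)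
    (hδ : δ ∈ Icc (0 : ℝ) 2) (hη : η ∈ Icc (0 : ℝ) 2) (hδη : |(1 - δ) * (1 - η)| < 1)
    (hs : IsMonotonicScheme H μ O ψ₀ α δ η ε ε' ψ χ) {e : Control T} (he : e ∈ limitSet ε) :
    SolvesEulerLagrange H μ O ψ₀ α e := by
  obtain ⟨n, hn, hlim⟩ := he
  -- Indices are moved back by one, since the critical limits are those of `ε (k + 1)`; truncation
  -- at `n j = 0` does not matter for large `j`.
  have hpred : Tendsto (fun j => n j - 1) atTop atTop :=
    (tendsto_sub_atTop_nat 1).comp hn.tendsto_atTop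
  let l : Ultrafilter ℕ := (hyperfilter ℕ).map fun j => n j - 1
  have hl : (l : Filter ℕ) ≤ atTop := hpred.mono_left Nat.hyperfilter_le_atTop
  obtain ⟨a, h1, -, h3⟩ := hs.exists_critical_limit hH hμ hO hT hα hδ hη hδη hl
  have h4 : Tendsto (fun j => ε (n j - 1 + 1)) (hyperfilter ℕ) (𝓝 a) := h1
  have h5 : Tendsto (fun j => ε (n j - 1 + 1)) atTop (𝓝 e) := by
    refine hlim.congr' ?_
    filter_upwards [hn.tendsto_atTop.eventually_ge_atTop 1] with j hj
    rw [Nat.sub_add_cancel hj]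
  rw [tendsto_nhds_unique (h5.mono_left Nat.hyperfilter_le_atTop) h4]
  exact h3

end

end QuantumControl

end

/-! ### Structure of the limit set -/

theorem mainTheorem2 {E : Type*} [NormedAddCommGroup E] [InnerProductSpace ℂ E] [CompleteSpace E]
    (H : E →ₗ.[ℂ] E) (hH : IsSelfAdjoint H)
    (μ O : E →L[ℂ] E) (hμ : IsSelfAdjoint μ) (hO : O.IsPositive)
    (ψ₀ : E) (T α δ η : ℝ) (hT : 0 < T) (hα : 0 < α)
    (hδ : δ ∈ Set.Icc (0 : ℝ) 2) (hη : η ∈ Set.Icc (0 : ℝ) 2) (hδη : |(1 - δ) * (1 - η)| < 1)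
    (ε ε' : ℕ → QuantumControl.Control T) (ψ χ : ℕ → ℝ → E)
    (hscheme : QuantumControl.IsMonotonicScheme H μ O ψ₀ α δ η ε ε' ψ χ) :
    IsConnected (QuantumControl.limitSet ε) ∧
    IsCompact (QuantumControl.limitSet ε) ∧
    (∀ e ∈ QuantumControl.limitSet ε,
      HasFDerivAt (QuantumControl.cost H μ O ψ₀ α) (0 : QuantumControl.Control T →L[ℝ] ℝ) e ∧
      QuantumControl.SolvesEulerLagrange H μ O ψ₀ α e) ∧
    (∃ c : ℝ, ∀ e ∈ QuantumControl.limitSet ε, QuantumControl.cost H μ O ψ₀ α e = c) := by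
  obtain ⟨A, hA, hA'⟩ := hscheme.exists_norm_control_le hH hμ hO hT.le hα hδ hη
  obtain ⟨K, hK, hεK⟩ := hscheme.exists_isCompact hH hμ hT.le hδη hA hA'
  have hEL := fun e he => hscheme.solvesEulerLagrange_of_mem hH hμ hO hT.le hα hδ hη hδη (e := e) he
  have hderiv := fun e he => QuantumControl.hasFDerivAt_cost hH hμ hO hT.le (hEL e he)
  refine ⟨QuantumControl.isConnected_setOf_subseq_limit hK hεK
    (hscheme.tendsto_dist_succ hH hμ hO hT.le hα hδ hη hδη),
    QuantumControl.isCompact_setOf_subseq_limit hK hεK,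
    fun e he => ⟨hderiv e he, hEL e he⟩, ?_⟩
  obtain ⟨c, hc⟩ := hscheme.exists_tendsto_cost hH hμ hO hT.le hα hδ hη
  refine ⟨c, fun e he => ?_⟩
  -- Differentiability at `e` supplies the continuity needed to identify `J(e)` with the limit of
  -- the whole sequence of costs, which is the same for every limit point.
  have hcont := (hderiv e he).continuousAt
  obtain ⟨n, hn, hlim⟩ := he
  exact tendsto_nhds_unique (hcont.tendsto.comp hlim) (hc.comp hn.tendsto_atTop)
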